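/- Let $T>0$, $H\in(0,1)$. Let $\mathfrak H$ be the completion of the space of step functions on $[0,T]$ for the inner product $\langle 1_{[0,t]},1_{[0,s]}\rangle_{\mathfrak H}=\frac12(t^{2H}+s^{2H}-|t-s|^{2H})$, let $\mathbb W=(\mathbb W(h))_{h\in\mathfrak H}$ be an isonormal Gaussian process over $\mathfrak H$ on a probability space $(\Omega,\mathcal F,P)$, and let $B_t=\mathbb W(1_{[0,t]})$, a fractional Brownian motion with Hurst coefficient $H$. Let $I_2$ be the double Wiener integral, so that $I_2(h\odot g)=\mathbb W(h)\mathbb W(g)-\langle h,g\rangle_{\mathfrak H}$; let $\otimes_1$ be the contraction of order one, $(a\otimes b)\otimes_1(c\otimes d)=\langle b,d\rangle_{\mathfrak H}\,a\otimes c$, and $\odot_1$ its symmetrization. For $m\in\mathbb N$ put $t_j^m=jT/m$, $1_j^m=1_{(t_{j-1}^m,t_j^m]}$, $V_{m,T}^{(2)}=\sum_{j=1}^{m-1}(B_{t^m_{j+1}}-2B_{t^m_j}+B_{t^m_{j-1}})^2$, and for $\alpha\in\{1,2\}$ $$f_n^{[\alpha]}=\frac{\sqrt n\,\sum_{j=1}^{\alpha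 n-1}(1^{\alpha n}_{j+1}-1^{\alpha n}_j)^{\otimes 2}}{E[V^{(2)}_{\alpha n,T}]},\qquad \widetilde G_n=2I_2(f_n^{[2]}\otimes_1 f_n^{[2]})-4I_2(f_n^{[2]}\odot_1 f_n^{[1]})+2I_2(f_n^{[1]}\otimes_1 f_n^{[1]}).$$ For $j\in\mathbb Z$ let $$\widehat\rho(j)=\tfrac12\{-|j-2|^{2H}+4|j-1|^{2H}-6|j|^{2H}+4|j+1|^{2H}-|j+2|^{2H}\},$$ $$\widetilde\rho(j)=2^{-2H-1}\{-|j-3|^{2H}+2|j-2|^{2H}+|j-1|^{2H}-4|j|^{2H}+|j+1|^{2H}+2|j+2|^{2H}-|j+3|^{2H}\},$$ and, with $c=4-2^{2H}$ and all sums over integers $i_1,i_2,i_3\in\mathbb Z$ unless indicated, $$\Sigma_{11}=2\Big[1+\tfrac{2}{c^2}\sum_{i=1}^\infty\widehat\rho(i)^2\Big],\quad \Sigma_{22}=\tfrac12\Sigma_{11},\quad \Sigma_{12}=\tfrac{2^{2H}}{c^2}\sum_{\ell\in\mathbb Z}\widetilde\rho(\ell)^2,$$ $$\kappa(1;1,1)=c^{-3}\sum\widehat\rho(i_1)\widehat\rho(i_1-i_2)\widehat\rho(i_2),\qquad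 \kappa(2;2,2)=\tfrac14\kappa(1;1,1),$$ $$\kappa(2;1,1)=\kappa(1;1,2)=2^{2H-1}c^{-3}\sum\widehat\rho(i_1)\widetilde\rho(i_2-2i_1)\widetilde\rho(i_2),$$ $$\kappa(1;2,2)=\kappa(2;1,2)=2^{2H-2}c^{-3}\sum\widehat\rho(i_1)\widetilde\rho(i_1-i_2)\widetilde\rho(i_2),$$ $$\kappa(1,1;1,1)=c^{-4}\sum\widehat\rho(i_1)\widehat\rho(i_1-i_2)\widehat\rho(i_2-i_3)\widehat\rho(i_3),\qquad \kappa(2,2;2,2)=\tfrac18\kappa(1,1;1,1),$$ $$\kappa(1,1;2,2)=2^{2H-2}c^{-4}\sum\{\widetilde\rho(2i_1)\widehat\rho(i_1-i_2)\widetilde\rho(2i_2-i_3)\widehat\rho(i_3)+\widetilde\rho(2i_1+1)\widehat\rho(i_1-i_2)\widetilde\rho(2i_2-i_3+1)\widehat\rho(i_3)\},$$ $$\kappa(1,1;1,2)=2^{2H-1}c^{-4}\sum\widehat\rho(i_1)\widetilde\rho(2i_1-i_2)\widetilde\rho(i_2-2i_3)\widehat\rho(i_3),$$ $$\kappa(1,2;2,2)=2^{2H-3}c^{-4}\sum\widehat\rho(i_1)\widehat\rho(i_1-i_2)\widetilde\rho(i_2-i_3)\widetilde\rho(i_3),$$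 $$\kappa(1,2;1,2)=2^{2H-3}c^{-4}\sum\widehat\rho(i_1)\widetilde\rho(2i_1-i_2)\widehat\rho(i_2-i_3)\widetilde\rho(i_3)+2^{4H-3}c^{-4}\Big\{\sum\widetilde\rho(2i_1)\widetilde\rho(2i_1-i_2)\widetilde\rho(i_2-2i_3)\widetilde\rho(2i_3)+\sum\widetilde\rho(2i_1+1)\widetilde\rho(2i_1-i_2)\widetilde\rho(i_2-2i_3)\widetilde\rho(2i_3+1)\Big\}.$$ Then all these lattice sums converge absolutely; the symmetric $3\times3$ matrix $\mathfrak U$ with entries $\mathfrak U_{11}=\Sigma_{11}$, $\mathfrak U_{12}=\Sigma_{12}$, $\mathfrak U_{22}=\Sigma_{22}$, $$\mathfrak U_{13}=4\kappa(1;2,2)-8\kappa(1;1,2)+4\kappa(1;1,1),\qquad \mathfrak U_{23}=4\kappa(2;2,2)-8\kappa(2;1,2)+4\kappa(2;1,1),$$ $$\mathfrak U_{33}=8\kappa(2,2;2,2)+32\kappa(1,2;1,2)+8\kappa(1,1;1,1)-32\kappa(1,2;2,2)+16\kappa(1,1;2,2)-32\kappa(1,1;1,2)$$ is positive semidefinite;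 and the random vectors $U_n=(I_2(f_n^{[1]}),I_2(f_n^{[2]}),n^{1/2}\widetilde G_n)$ converge in distribution, as $n\to\infty$, to the centered normal distribution $N_3(0,\mathfrak U)$. -/

import Mathlib

open MeasureTheory ProbabilityTheory Filter Topology
open scoped TensorProduct

noncomputable section

namespace FBM

/-! ### Step functions on `[0,T]` and the covariance of fractional Brownian motion -/

/-- The covariance function of fractional Brownian motion with Hurst coefficient `H`. -/
def fbmCov (H s t : ℝ) : ℝ :=
  (t ^ (2 * H) + s ^ (2 * H) - |t - s| ^ (2 * H)) / 2

/-- The function `1_{[0,t]}` on `ℝ`. -/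
def ind (t : ℝ) : ℝ → ℝ := (Set.Icc 0 t).indicator 1

/-- The space of step functions on `[0,T]`: the linear span of `1_{[0,t]}`, `t ∈ [0,T]`. -/
def stepFun (T : ℝ) : Submodule ℝ (ℝ → ℝ) :=
  Submodule.span ℝ (Set.range fun t : Set.Icc (0 : ℝ) T ↦ ind t)

theorem linearIndependent_ind (T : ℝ) :
    LinearIndependent ℝ (fun t : Set.Icc (0 : ℝ) T ↦ ind t) := by
  rw [linearIndependent_iff]
  intro l hl
  by_contra hne
  have hs : l.support.Nonempty := Finsupp.support_nonempty_iff.2 hne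
  set m := l.support.max' hs with hm
  have hmem : m ∈ l.support := Finset.max'_mem _ _
  have h1 := congrFun hl (m : ℝ)
  rw [Finsupp.linearCombination_apply, Finsupp.sum, Finset.sum_apply,
    Finset.sum_eq_single m] at h1
  · have : ind (m : ℝ) m = 1 := by
      simp [ind, m.2.1]
    simp only [Pi.smul_apply, this, smul_eq_mul, mul_one, Pi.zero_apply] at h1
    exact (Finsupp.mem_support_iff.1 hmem) h1
  · intro t ht htm
    have hlt : t < m := lt_of_le_of_ne (Finset.le_max' _ _ ht) htm
    have : ind (t : ℝ) m = 0 := by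
      have h2 : ¬ ((m : ℝ) ≤ t) := not_le.2 (by exact_mod_cast hlt)
      simp [ind, h2]
    simp [this]
  · exact fun h ↦ absurd hmem h

/-- The functions `1_{[0,t]}`, `t ∈ [0,T]`, form a basis of the space of step functions. -/
def stepBasis (T : ℝ) : Module.Basis (Set.Icc (0 : ℝ) T) ℝ (stepFun T) :=
  Module.Basis.span (linearIndependent_ind T)

/-- The space of step functions on `[0,T]`, to be equipped with the inner product attached to the
Hurst coefficient `H`. -/
def FbmStep (_H T : ℝ) : Type := stepFun T

instance (H T : ℝ) : AddCommGroup (FbmStep H T) := inferInstanceAs (AddCommGroup (stepFun T))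

instance (H T : ℝ) : Module ℝ (FbmStep H T) := inferInstanceAs (Module ℝ (stepFun T))

/-- The basis of indicator functions, on the type carrying the inner product. -/
def fbmBasis (H T : ℝ) : Module.Basis (Set.Icc (0 : ℝ) T) ℝ (FbmStep H T) := stepBasis T

/-- The bilinear form on step functions with
`⟨1_{[0,s]}, 1_{[0,t]}⟩ = (t^{2H} + s^{2H} - |t - s|^{2H}) / 2`. -/
def fbmForm (H T : ℝ) : FbmStep H T →ₗ[ℝ] FbmStep H T →ₗ[ℝ] ℝ :=
  (fbmBasis H T).constr ℝ fun s ↦ (fbmBasis H T).constr ℝ fun t ↦ fbmCov H s t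

theorem fbmForm_basis (H T : ℝ) (s t : Set.Icc (0 : ℝ) T) :
    fbmForm H T (fbmBasis H T s) (fbmBasis H T t) = fbmCov H s t := by
  simp [fbmForm, Module.Basis.constr_basis]

theorem fbmForm_apply (H T : ℝ) (f g : FbmStep H T) :
    fbmForm H T f g = ∑ s ∈ ((fbmBasis H T).repr f).support,
      ∑ t ∈ ((fbmBasis H T).repr g).support,
        (fbmBasis H T).repr f s * (fbmBasis H T).repr g t * fbmCov H s t := by
  simp only [fbmForm, Module.Basis.constr_apply, Finsupp.sum, LinearMap.sum_apply,
    LinearMap.smul_apply, smul_eq_mul, Finset.mul_sum, mul_assoc]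

/-! ### Positivity of the covariance -/

theorem integrable_one_sub_cos {q : ℝ} (h0 : 0 < q) (h2 : q < 2) (x : ℝ) :
    IntegrableOn (fun u : ℝ ↦ (1 - Real.cos (x * u)) * u ^ (-1 - q)) (Set.Ioi 0) := by
  have hm : ∀ s : Set ℝ, AEStronglyMeasurable
      (fun u : ℝ ↦ (1 - Real.cos (x * u)) * u ^ (-1 - q)) (volume.restrict s) := by
    intro s
    apply Measurable.aestronglyMeasurable
    fun_prop
  rw [← Set.Ioc_union_Ioi_eq_Ioi (zero_le_one (α := ℝ))]
  refine IntegrableOn.union ?_ ?_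
  · have hI : IntegrableOn (fun u : ℝ ↦ x ^ 2 * u ^ (1 - q)) (Set.Ioc 0 1) := by
      refine Integrable.const_mul ?_ _
      exact (intervalIntegrable_iff_integrableOn_Ioc_of_le zero_le_one).1
        (intervalIntegral.intervalIntegrable_rpow' (by linarith))
    refine Integrable.mono' hI (hm _) ?_
    refine (ae_restrict_iff' measurableSet_Ioc).2 (ae_of_all _ fun u hu ↦ ?_)
    have hu0 : 0 < u := hu.1
    have e : u ^ (1 - q) = u ^ 2 * u ^ (-1 - q) := by
      rw [← Real.rpow_two, ← Real.rpow_add hu0]; congr 1; ring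
    have hp : 0 < u ^ (-1 - q) := Real.rpow_pos_of_pos hu0 _
    have hc := Real.one_sub_sq_div_two_le_cos (x := x * u)
    have hc1 := Real.cos_le_one (x * u)
    rw [Real.norm_of_nonneg (mul_nonneg (by linarith) hp.le), e, ← mul_assoc]
    refine mul_le_mul_of_nonneg_right ?_ hp.le
    nlinarith [sq_nonneg (x * u)]
  · have hI : IntegrableOn (fun u : ℝ ↦ 2 * u ^ (-1 - q)) (Set.Ioi 1) :=
      Integrable.const_mul (integrableOn_Ioi_rpow_of_lt (by linarith) one_pos) _
    refine Integrable.mono' hI (hm _) ?_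
    refine (ae_restrict_iff' measurableSet_Ioi).2 (ae_of_all _ fun u hu ↦ ?_)
    have hu0 : 0 < u := lt_trans one_pos hu
    have hp : 0 < u ^ (-1 - q) := Real.rpow_pos_of_pos hu0 _
    have hc := Real.neg_one_le_cos (x * u)
    have hc1 := Real.cos_le_one (x * u)
    rw [Real.norm_of_nonneg (mul_nonneg (by linarith) hp.le)]
    exact mul_le_mul_of_nonneg_right (by linarith) hp.le

theorem integral_one_sub_cos {q : ℝ} (h0 : 0 < q) (x : ℝ) :
    ∫ u in Set.Ioi (0 : ℝ), (1 - Real.cos (x * u)) * u ^ (-1 - q) =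
      |x| ^ q * ∫ u in Set.Ioi (0 : ℝ), (1 - Real.cos u) * u ^ (-1 - q) := by
  rcases eq_or_ne x 0 with rfl | hx
  · simp [Real.zero_rpow h0.ne']
  have hx' : 0 < |x| := abs_pos.2 hx
  have h1 := integral_comp_mul_left_Ioi
    (fun u : ℝ ↦ (1 - Real.cos u) * u ^ (-1 - q)) 0 hx'
  rw [mul_zero, smul_eq_mul] at h1
  have h2 : ∫ u in Set.Ioi (0 : ℝ), (1 - Real.cos (|x| * u)) * (|x| * u) ^ (-1 - q) =
      |x| ^ (-1 - q) * ∫ u in Set.Ioi (0 : ℝ), (1 - Real.cos (x * u)) * u ^ (-1 - q) := by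
    rw [← integral_const_mul]
    refine setIntegral_congr_fun measurableSet_Ioi fun u hu ↦ ?_
    have hu0 : (0 : ℝ) < u := hu
    have hcos : Real.cos (|x| * u) = Real.cos (x * u) := by
      rw [← Real.cos_abs (x * u), abs_mul, abs_of_pos hu0]
    simp only [hcos, Real.mul_rpow hx'.le hu0.le]
    ring
  rw [h2] at h1
  have h3 : |x| ^ q * |x| ^ (-1 - q) = |x|⁻¹ := by
    rw [← Real.rpow_add hx', show q + (-1 - q) = -1 by ring, Real.rpow_neg_one]
  have h4 : |x| ^ (-1 - q) ≠ 0 := (Real.rpow_pos_of_pos hx' _).ne'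
  apply mul_left_cancel₀ h4
  rw [h1, ← h3]
  ring

theorem integral_one_sub_cos_pos {q : ℝ} (h0 : 0 < q) (h2 : q < 2) :
    0 < ∫ u in Set.Ioi (0 : ℝ), (1 - Real.cos u) * u ^ (-1 - q) := by
  have hint := integrable_one_sub_cos h0 h2 1
  simp only [one_mul] at hint
  rw [setIntegral_pos_iff_support_of_nonneg_ae _ hint]
  · refine lt_of_lt_of_le ?_ (measure_mono (s := Set.Ioo (0 : ℝ) 1) ?_)
    · simp
    · intro u hu
      refine ⟨?_, hu.1⟩
      have hc : Real.cos u < 1 := by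
        rw [← Real.cos_zero]
        exact Real.cos_lt_cos_of_nonneg_of_le_pi le_rfl
          (by linarith [hu.2, Real.pi_gt_three]) hu.1
      have hp : 0 < u ^ (-1 - q) := Real.rpow_pos_of_pos hu.1 _
      exact (mul_pos (by linarith) hp).ne'
  · refine (ae_restrict_iff' measurableSet_Ioi).2 (ae_of_all _ fun u hu ↦ ?_)
    exact mul_nonneg (by linarith [Real.cos_le_one u]) (Real.rpow_nonneg (le_of_lt hu) _)

theorem fbmCov_nonneg {H : ℝ} (hH : H ∈ Set.Ioo (0 : ℝ) 1) {ι : Type*} (s : Finset ι)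
    (a t : ι → ℝ) (ht : ∀ i ∈ s, 0 ≤ t i) :
    0 ≤ ∑ i ∈ s, ∑ j ∈ s, a i * a j * fbmCov H (t i) (t j) := by
  have h0 : 0 < 2 * H := by linarith [hH.1]
  have h2 : 2 * H < 2 := by linarith [hH.2]
  set q := 2 * H with hq
  set K := ∫ u in Set.Ioi (0 : ℝ), (1 - Real.cos u) * u ^ (-1 - q) with hK
  have hKpos : 0 < K := integral_one_sub_cos_pos h0 h2
  let F : ℝ → ℝ → ℝ := fun x u ↦ (1 - Real.cos (x * u)) * u ^ (-1 - q)
  have hF : ∀ x, IntegrableOn (F x) (Set.Ioi 0) := integrable_one_sub_cos h0 h2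
  have hFi : ∀ x, ∫ u in Set.Ioi (0 : ℝ), F x u = |x| ^ q * K := integral_one_sub_cos h0
  have hterm : ∀ i ∈ s, ∀ j ∈ s, a i * a j * fbmCov H (t i) (t j) * (2 * K) =
      ∫ u in Set.Ioi (0 : ℝ), a i * a j * (F (t j) u + F (t i) u - F (t j - t i) u) := by
    intro i hi j hj
    have e1 : ∫ u in Set.Ioi (0 : ℝ), (F (t j) u + F (t i) u - F (t j - t i) u) =
        (∫ u in Set.Ioi (0 : ℝ), (F (t j) u + F (t i) u)) -
          ∫ u in Set.Ioi (0 : ℝ), F (t j - t i) u :=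
      integral_sub ((hF _).add (hF _)) (hF _)
    rw [integral_const_mul, e1, integral_add (hF _) (hF _), hFi, hFi, hFi, abs_of_nonneg (ht i hi),
      abs_of_nonneg (ht j hj), fbmCov]
    ring
  have hsum : (∑ i ∈ s, ∑ j ∈ s, a i * a j * fbmCov H (t i) (t j)) * (2 * K) =
      ∫ u in Set.Ioi (0 : ℝ), ∑ i ∈ s, ∑ j ∈ s,
        a i * a j * (F (t j) u + F (t i) u - F (t j - t i) u) := by
    rw [integral_finsetSum]
    · rw [Finset.sum_mul]
      refine Finset.sum_congr rfl fun i hi ↦ ?_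
      rw [integral_finsetSum]
      · rw [Finset.sum_mul]
        exact Finset.sum_congr rfl fun j hj ↦ hterm i hi j hj
      · exact fun j _ ↦ (((hF _).add (hF _)).sub (hF _)).const_mul _
    · exact fun i _ ↦ integrable_finsetSum _
        fun j _ ↦ (((hF _).add (hF _)).sub (hF _)).const_mul _
  have hnn : 0 ≤ ∫ u in Set.Ioi (0 : ℝ), ∑ i ∈ s, ∑ j ∈ s,
        a i * a j * (F (t j) u + F (t i) u - F (t j - t i) u) := by
    refine setIntegral_nonneg measurableSet_Ioi fun u hu ↦ ?_
    have e : ∑ i ∈ s, ∑ j ∈ s, a i * a j * (F (t j) u + F (t i) u - F (t j - t i) u) =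
        ((∑ i ∈ s, a i * (1 - Real.cos (t i * u))) ^ 2 +
          (∑ i ∈ s, a i * Real.sin (t i * u)) ^ 2) * u ^ (-1 - q) := by
      rw [sq, sq, Finset.sum_mul_sum, Finset.sum_mul_sum, ← Finset.sum_add_distrib,
        Finset.sum_mul]
      refine Finset.sum_congr rfl fun i _ ↦ ?_
      rw [← Finset.sum_add_distrib, Finset.sum_mul]
      refine Finset.sum_congr rfl fun j _ ↦ ?_
      simp only [F]
      rw [sub_mul (t j), Real.cos_sub]
      ring
    rw [e]
    exact mul_nonneg (by positivity) (Real.rpow_nonneg (le_of_lt hu) _)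
  rw [← hsum] at hnn
  exact nonneg_of_mul_nonneg_left hnn (by positivity)

/-! ### The Hilbert space of fractional Brownian motion -/

instance (H T : ℝ) [hH : Fact (H ∈ Set.Ioo (0 : ℝ) 1)] :
    PreInnerProductSpace.Core ℝ (FbmStep H T) where
  inner f g := fbmForm H T f g
  conj_inner_symm f g := by
    simp only [conj_trivial, fbmForm_apply]
    rw [Finset.sum_comm]
    refine Finset.sum_congr rfl fun s _ ↦ Finset.sum_congr rfl fun t _ ↦ ?_
    simp only [fbmCov, abs_sub_comm (s : ℝ) t]
    ring
  re_inner_nonneg f := by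
    simp only [fbmForm_apply, RCLike.re_to_real]
    exact fbmCov_nonneg hH.out _ _ (fun t : Set.Icc (0 : ℝ) T ↦ (t : ℝ)) fun i _ ↦ i.2.1
  add_left f g h := by simp
  smul_left f g r := by simp

instance (H T : ℝ) [Fact (H ∈ Set.Ioo (0 : ℝ) 1)] : SeminormedAddCommGroup (FbmStep H T) :=
  InnerProductSpace.Core.toSeminormedAddCommGroup (𝕜 := ℝ)

instance (H T : ℝ) [Fact (H ∈ Set.Ioo (0 : ℝ) 1)] : InnerProductSpace ℝ (FbmStep H T) :=
  .ofCore _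

/-- The Hilbert space `𝔥`: the completion of the step functions on `[0,T]` for the inner product
`⟨1_{[0,s]}, 1_{[0,t]}⟩ = (t^{2H} + s^{2H} - |t - s|^{2H}) / 2`. -/
abbrev FbmHilbert (H T : ℝ) [Fact (H ∈ Set.Ioo (0 : ℝ) 1)] : Type :=
  UniformSpace.Completion (FbmStep H T)

theorem ind_min_mem (T t : ℝ) : ind (min t T) ∈ stepFun T := by
  by_cases h : 0 ≤ min t T
  · exact Submodule.subset_span ⟨⟨min t T, h, min_le_right _ _⟩, rfl⟩
  · have : ind (min t T) = 0 := by
      rw [ind, Set.Icc_eq_empty h, Set.indicator_empty']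
    rw [this]
    exact zero_mem _

/-- `1_{[0,t]}`, restricted to `[0,T]`, as a step function. -/
def stepInd (H T t : ℝ) : FbmStep H T := (⟨ind (min t T), ind_min_mem T t⟩ : stepFun T)

/-- `1_{[0,t]}` as an element of `𝔥`, for `t ∈ [0,T]`. -/
def indH (H T : ℝ) [Fact (H ∈ Set.Ioo (0 : ℝ) 1)] (t : ℝ) : FbmHilbert H T :=
  ((stepInd H T t : FbmStep H T) : UniformSpace.Completion (FbmStep H T))

theorem inner_indH (H T : ℝ) [Fact (H ∈ Set.Ioo (0 : ℝ) 1)] {s t : ℝ}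
    (hs : s ∈ Set.Icc 0 T) (ht : t ∈ Set.Icc 0 T) :
    inner ℝ (indH H T s) (indH H T t) = fbmCov H s t := by
  have key : ∀ r (hr : r ∈ Set.Icc 0 T), stepInd H T r = fbmBasis H T ⟨r, hr⟩ := by
    intro r hr
    refine Subtype.ext ?_
    change ind (min r T) = ((stepBasis T ⟨r, hr⟩ : stepFun T) : ℝ → ℝ)
    rw [min_eq_left hr.2]
    exact (congrArg Subtype.val
      (Module.Basis.span_apply (linearIndependent_ind T) ⟨r, hr⟩)).symm
  rw [indH, indH, UniformSpace.Completion.inner_coe, key s hs, key t ht]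
  exact fbmForm_basis H T ⟨s, hs⟩ ⟨t, ht⟩

/-! ### Isonormal Gaussian processes and second-order Wiener integrals -/

section Wiener

variable {E : Type*} [NormedAddCommGroup E] [InnerProductSpace ℝ E]
  {Ω : Type*} [MeasurableSpace Ω] {P : Measure Ω}

/-- An isonormal Gaussian process over `E`: a linear isometry of `E` into `L²(P)` all of whose
values are centered Gaussian (so that, by linearity, all finite families are jointly Gaussian, with
`E[W(h) W(g)] = ⟨h, g⟩`). -/
def IsIsonormal (W : E →ₗᵢ[ℝ] Lp ℝ 2 P) : Prop :=
  ∀ h : E, HasLaw (W h : Ω → ℝ) (gaussianReal 0 (‖h‖₊ ^ 2)) P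

/-- The product `W(h) W(g) - ⟨h, g⟩`. -/
def wickMul (W : E →ₗᵢ[ℝ] Lp ℝ 2 P) (h g : E) : Ω →ₘ[P] ℝ :=
  (W h : Ω →ₘ[P] ℝ) * (W g : Ω →ₘ[P] ℝ) - AEEqFun.const Ω (inner ℝ h g)

theorem coeFn_wickMul (W : E →ₗᵢ[ℝ] Lp ℝ 2 P) (h g : E) :
    ∀ᵐ ω ∂P, wickMul W h g ω = W h ω * W g ω - inner ℝ h g := by
  filter_upwards [AEEqFun.coeFn_sub ((W h : Ω →ₘ[P] ℝ) * (W g : Ω →ₘ[P] ℝ))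
      (AEEqFun.const Ω (inner ℝ h g : ℝ)),
    AEEqFun.coeFn_mul (W h : Ω →ₘ[P] ℝ) (W g : Ω →ₘ[P] ℝ),
    AEEqFun.coeFn_const (μ := P) Ω (inner ℝ h g : ℝ)] with ω h1 h2 h3
  rw [wickMul, h1, Pi.sub_apply, h2, h3, Pi.mul_apply, Function.const_apply]

theorem wickMul_comm (W : E →ₗᵢ[ℝ] Lp ℝ 2 P) (h g : E) : wickMul W h g = wickMul W g h := by
  rw [wickMul, wickMul, mul_comm, real_inner_comm]

theorem wickMul_add_left (W : E →ₗᵢ[ℝ] Lp ℝ 2 P) (a b c : E) :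
    wickMul W (a + b) c = wickMul W a c + wickMul W b c := by
  apply AEEqFun.ext
  filter_upwards [coeFn_wickMul W (a + b) c, coeFn_wickMul W a c, coeFn_wickMul W b c,
    AEEqFun.coeFn_add (wickMul W a c) (wickMul W b c), Lp.coeFn_add (W a) (W b)]
    with ω h1 h2 h3 h4 h5
  rw [h1, h4, Pi.add_apply, h2, h3, map_add, h5, inner_add_left, Pi.add_apply]
  ring

theorem wickMul_smul_left (W : E →ₗᵢ[ℝ] Lp ℝ 2 P) (r : ℝ) (a c : E) :
    wickMul W (r • a) c = r • wickMul W a c := by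
  apply AEEqFun.ext
  filter_upwards [coeFn_wickMul W (r • a) c, coeFn_wickMul W a c,
    AEEqFun.coeFn_smul r (wickMul W a c), Lp.coeFn_smul r (W a)] with ω h1 h2 h3 h4
  rw [h1, h3, Pi.smul_apply, h2, map_smul, h4, real_inner_smul_left, Pi.smul_apply, smul_eq_mul,
    smul_eq_mul]
  ring

/-- The double Wiener integral `I₂` with respect to `W`, on finite-rank elements of `E ⊗ E`:
the linear map with `I₂(h ⊗ g) = W(h) W(g) - ⟨h, g⟩`. -/
def I2 (W : E →ₗᵢ[ℝ] Lp ℝ 2 P) : E ⊗[ℝ] E →ₗ[ℝ] (Ω →ₘ[P] ℝ) :=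
  TensorProduct.lift <| LinearMap.mk₂ ℝ
    (wickMul W)
    (fun a b c ↦ wickMul_add_left W a b c)
    (fun r a c ↦ wickMul_smul_left W r a c)
    (fun a b c ↦ by
      rw [wickMul_comm, wickMul_add_left, wickMul_comm W b, wickMul_comm W c])
    (fun r a c ↦ by
      rw [wickMul_comm, wickMul_smul_left, wickMul_comm W c])

theorem I2_tmul (W : E →ₗᵢ[ℝ] Lp ℝ 2 P) (h g : E) :
    I2 W (h ⊗ₜ g) =
      (W h : Ω →ₘ[P] ℝ) * (W g : Ω →ₘ[P] ℝ) - AEEqFun.const Ω (inner ℝ h g) := by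
  simp [I2, wickMul]

/-- The contraction of order one, `(a ⊗ b) ⊗₁ (c ⊗ d) = ⟨b, d⟩ a ⊗ c`. -/
def contr₁ : E ⊗[ℝ] E →ₗ[ℝ] E ⊗[ℝ] E →ₗ[ℝ] E ⊗[ℝ] E :=
  (TensorProduct.map₂ (TensorProduct.mk ℝ E E) (innerₗ E)).compr₂
    (TensorProduct.rid ℝ (E ⊗[ℝ] E)).toLinearMap

theorem contr₁_tmul (a b c d : E) :
    contr₁ (a ⊗ₜ[ℝ] b) (c ⊗ₜ[ℝ] d) = (inner ℝ b d : ℝ) • (a ⊗ₜ[ℝ] c) := by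
  simp [contr₁]

/-- The symmetrization of a tensor. -/
def symm₂ (z : E ⊗[ℝ] E) : E ⊗[ℝ] E :=
  (2⁻¹ : ℝ) • (z + TensorProduct.comm ℝ E E z)

end Wiener

/-! ### Second-order differences and the kernels -/

section Kernels

variable {H T : ℝ} [Fact (H ∈ Set.Ioo (0 : ℝ) 1)]
  {Ω : Type*} [MeasurableSpace Ω] {P : Measure Ω}

/-- The sampling time `t_j^n = j T / n`. -/
def grid (T : ℝ) (n j : ℕ) : ℝ := j * T / n

/-- The fractional Brownian motion `B_t = W(1_{[0,t]})`. -/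
def fbm (W : FbmHilbert H T →ₗᵢ[ℝ] Lp ℝ 2 P) (t : ℝ) : Ω → ℝ := W (indH H T t)

/-- The second-order difference `d_{n,j} = B_{t_{j+1}} - 2 B_{t_j} + B_{t_{j-1}}`, `1 ≤ j < n`. -/
def secondDiff (W : FbmHilbert H T →ₗᵢ[ℝ] Lp ℝ 2 P) (n j : ℕ) (ω : Ω) : ℝ :=
  fbm W (grid T n (j + 1)) ω - 2 * fbm W (grid T n j) ω + fbm W (grid T n (j - 1)) ω

/-- The sum of squares `V_{n,T}^{(2)} = ∑_{j=1}^{n-1} d_{n,j}²`. -/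
def quadVar (W : FbmHilbert H T →ₗᵢ[ℝ] Lp ℝ 2 P) (n : ℕ) (ω : Ω) : ℝ :=
  ∑ j ∈ Finset.Ico 1 n, secondDiff W n j ω ^ 2

/-- `1_j^n = 1_{(t_{j-1}^n, t_j^n]}` as an element of `𝔥`, for `1 ≤ j ≤ n`. -/
def cell (H T : ℝ) [Fact (H ∈ Set.Ioo (0 : ℝ) 1)] (n j : ℕ) : FbmHilbert H T :=
  indH H T (grid T n j) - indH H T (grid T n (j - 1))

/-- The kernel
`f_n^{[α]} = n^{1/2} ∑_{j=1}^{αn-1} (1_{j+1}^{αn} - 1_j^{αn})^{⊗2} / E[V_{αn,T}^{(2)}]`. -/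
def kernel (W : FbmHilbert H T →ₗᵢ[ℝ] Lp ℝ 2 P) (α n : ℕ) :
    FbmHilbert H T ⊗[ℝ] FbmHilbert H T :=
  (√(n : ℝ) / ∫ ω, quadVar W (α * n) ω ∂P) •
    ∑ j ∈ Finset.Ico 1 (α * n),
      (cell H T (α * n) (j + 1) - cell H T (α * n) j) ⊗ₜ[ℝ]
        (cell H T (α * n) (j + 1) - cell H T (α * n) j)

/-- `G̃_n = 2 I₂(f_n^{[2]} ⊗₁ f_n^{[2]}) - 4 I₂(f_n^{[2]} ⊙₁ f_n^{[1]})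
+ 2 I₂(f_n^{[1]} ⊗₁ f_n^{[1]})`, where `f ⊙₁ g` is the symmetrization of `f ⊗₁ g`. -/
def gTilde (W : FbmHilbert H T →ₗᵢ[ℝ] Lp ℝ 2 P) (n : ℕ) : Ω →ₘ[P] ℝ :=
  (2 : ℝ) • I2 W (contr₁ (kernel W 2 n) (kernel W 2 n))
    - (4 : ℝ) • I2 W (symm₂ (contr₁ (kernel W 2 n) (kernel W 1 n)))
    + (2 : ℝ) • I2 W (contr₁ (kernel W 1 n) (kernel W 1 n))

/-- The random vector `U_n = (I₂(f_n^{[1]}), I₂(f_n^{[2]}), n^{1/2} G̃_n)`. -/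
def vecU (W : FbmHilbert H T →ₗᵢ[ℝ] Lp ℝ 2 P) (n : ℕ) (ω : Ω) : EuclideanSpace ℝ (Fin 3) :=
  !₂[I2 W (kernel W 1 n) ω, I2 W (kernel W 2 n) ω, √(n : ℝ) * gTilde W n ω]

end Kernels

/-! ### The limiting covariance matrix -/

/-- `ρ̂`. -/
def rhoHat (H : ℝ) (j : ℤ) : ℝ :=
  1 / 2 * (-|(j : ℝ) - 2| ^ (2 * H) + 4 * |(j : ℝ) - 1| ^ (2 * H) - 6 * |(j : ℝ)| ^ (2 * H)
    + 4 * |(j : ℝ) + 1| ^ (2 * H) - |(j : ℝ) + 2| ^ (2 * H))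

/-- `ρ̃`. -/
def rhoTilde (H : ℝ) (j : ℤ) : ℝ :=
  1 / 2 ^ (2 * H + 1) *
    (-|(j : ℝ) - 3| ^ (2 * H) + 2 * |(j : ℝ) - 2| ^ (2 * H) + |(j : ℝ) - 1| ^ (2 * H)
      - 4 * |(j : ℝ)| ^ (2 * H) + |(j : ℝ) + 1| ^ (2 * H) + 2 * |(j : ℝ) + 2| ^ (2 * H)
      - |(j : ℝ) + 3| ^ (2 * H))

/-- `c = 4 - 2^{2H}`. -/
def cH (H : ℝ) : ℝ := 4 - 2 ^ (2 * H)

/-! The summands of the lattice sums. -/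

def s11 (H : ℝ) (i : ℕ) : ℝ := rhoHat H (i + 1) ^ 2

def s12 (H : ℝ) (i : ℤ) : ℝ := rhoTilde H i ^ 2

def t1_11 (H : ℝ) (i : ℤ × ℤ) : ℝ := rhoHat H i.1 * rhoHat H (i.1 - i.2) * rhoHat H i.2

def t2_11 (H : ℝ) (i : ℤ × ℤ) : ℝ :=
  rhoHat H i.1 * rhoTilde H (i.2 - 2 * i.1) * rhoTilde H i.2

def t1_22 (H : ℝ) (i : ℤ × ℤ) : ℝ :=
  rhoHat H i.1 * rhoTilde H (i.1 - i.2) * rhoTilde H i.2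

def t11_11 (H : ℝ) (i : ℤ × ℤ × ℤ) : ℝ :=
  rhoHat H i.1 * rhoHat H (i.1 - i.2.1) * rhoHat H (i.2.1 - i.2.2) * rhoHat H i.2.2

def t11_22 (H : ℝ) (i : ℤ × ℤ × ℤ) : ℝ :=
  rhoTilde H (2 * i.1) * rhoHat H (i.1 - i.2.1) * rhoTilde H (2 * i.2.1 - i.2.2)
      * rhoHat H i.2.2
    + rhoTilde H (2 * i.1 + 1) * rhoHat H (i.1 - i.2.1) * rhoTilde H (2 * i.2.1 - i.2.2 + 1)
      * rhoHat H i.2.2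

def t11_12 (H : ℝ) (i : ℤ × ℤ × ℤ) : ℝ :=
  rhoHat H i.1 * rhoTilde H (2 * i.1 - i.2.1) * rhoTilde H (i.2.1 - 2 * i.2.2)
    * rhoHat H i.2.2

def t12_22 (H : ℝ) (i : ℤ × ℤ × ℤ) : ℝ :=
  rhoHat H i.1 * rhoHat H (i.1 - i.2.1) * rhoTilde H (i.2.1 - i.2.2) * rhoTilde H i.2.2

def t12_12a (H : ℝ) (i : ℤ × ℤ × ℤ) : ℝ :=
  rhoHat H i.1 * rhoTilde H (2 * i.1 - i.2.1) * rhoHat H (i.2.1 - i.2.2) * rhoTilde H i.2.2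

def t12_12b (H : ℝ) (i : ℤ × ℤ × ℤ) : ℝ :=
  rhoTilde H (2 * i.1) * rhoTilde H (2 * i.1 - i.2.1) * rhoTilde H (i.2.1 - 2 * i.2.2)
    * rhoTilde H (2 * i.2.2)

def t12_12c (H : ℝ) (i : ℤ × ℤ × ℤ) : ℝ :=
  rhoTilde H (2 * i.1 + 1) * rhoTilde H (2 * i.1 - i.2.1) * rhoTilde H (i.2.1 - 2 * i.2.2)
    * rhoTilde H (2 * i.2.2 + 1)

/-- All the lattice sums entering the covariance matrix converge absolutely. -/
structure LatticeSummable (H : ℝ) : Prop where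
  s11 : Summable (s11 H)
  s12 : Summable (s12 H)
  t1_11 : Summable (t1_11 H)
  t2_11 : Summable (t2_11 H)
  t1_22 : Summable (t1_22 H)
  t11_11 : Summable (t11_11 H)
  t11_22 : Summable (t11_22 H)
  t11_12 : Summable (t11_12 H)
  t12_22 : Summable (t12_22 H)
  t12_12a : Summable (t12_12a H)
  t12_12b : Summable (t12_12b H)
  t12_12c : Summable (t12_12c H)

def Sigma11 (H : ℝ) : ℝ := 2 * (1 + 2 / cH H ^ 2 * ∑' i, s11 H i)

def Sigma22 (H : ℝ) : ℝ := 1 / 2 * Sigma11 H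

def Sigma12 (H : ℝ) : ℝ := 2 ^ (2 * H) / cH H ^ 2 * ∑' i, s12 H i

/-- `κ(1;1,1)`. -/
def kappa1_11 (H : ℝ) : ℝ := 1 / cH H ^ 3 * ∑' i, t1_11 H i

/-- `κ(2;1,1)`, which is also `κ(1;1,2)`. -/
def kappa2_11 (H : ℝ) : ℝ := 2 ^ (2 * H - 1) / cH H ^ 3 * ∑' i, t2_11 H i

/-- `κ(1;2,2)`, which is also `κ(2;1,2)`. -/
def kappa1_22 (H : ℝ) : ℝ := 2 ^ (2 * H - 2) / cH H ^ 3 * ∑' i, t1_22 H i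

/-- `κ(2;2,2)`. -/
def kappa2_22 (H : ℝ) : ℝ := 1 / 4 * kappa1_11 H

/-- `κ(1,1;1,1)`. -/
def kappa11_11 (H : ℝ) : ℝ := 1 / cH H ^ 4 * ∑' i, t11_11 H i

/-- `κ(2,2;2,2)`. -/
def kappa22_22 (H : ℝ) : ℝ := 1 / 8 * kappa11_11 H

/-- `κ(1,1;2,2)`. -/
def kappa11_22 (H : ℝ) : ℝ := 2 ^ (2 * H - 2) / cH H ^ 4 * ∑' i, t11_22 H i

/-- `κ(1,1;1,2)`. -/
def kappa11_12 (H : ℝ) : ℝ := 2 ^ (2 * H - 1) / cH H ^ 4 * ∑' i, t11_12 H i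

/-- `κ(1,2;2,2)`. -/
def kappa12_22 (H : ℝ) : ℝ := 2 ^ (2 * H - 3) / cH H ^ 4 * ∑' i, t12_22 H i

/-- `κ(1,2;1,2)`. -/
def kappa12_12 (H : ℝ) : ℝ :=
  2 ^ (2 * H - 3) / cH H ^ 4 * ∑' i, t12_12a H i
    + 2 ^ (4 * H - 3) / cH H ^ 4 * (∑' i, t12_12b H i + ∑' i, t12_12c H i)

def U13 (H : ℝ) : ℝ := 4 * kappa1_22 H - 8 * kappa2_11 H + 4 * kappa1_11 H

def U23 (H : ℝ) : ℝ := 4 * kappa2_22 H - 8 * kappa1_22 H + 4 * kappa2_11 H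

def U33 (H : ℝ) : ℝ :=
  8 * kappa22_22 H + 32 * kappa12_12 H + 8 * kappa11_11 H
    - 32 * kappa12_22 H + 16 * kappa11_22 H - 32 * kappa11_12 H

/-- The asymptotic covariance matrix `𝔘`. -/
def covU (H : ℝ) : Matrix (Fin 3) (Fin 3) ℝ :=
  !![Sigma11 H, Sigma12 H, U13 H;
     Sigma12 H, Sigma22 H, U23 H;
     U13 H, U23 H, U33 H]

end FBM

end

/-!
By Lévy's continuity theorem it suffices to follow the characteristic functions of the linear
combinations of the components of `U_n`. Each of them is a double Wiener integral `I₂(z_n)` of a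
symmetric finite-rank tensor `z_n` (`ae_inner_vecU`), which is a polynomial of degree two, for the
contraction of order one, in the kernels `f_n^{[1]}` and `f_n^{[2]}`.

A symmetric tensor is a self-adjoint operator of finite rank. Diagonalizing it writes `I₂(z)` as a
sum `∑ λ_k (X_k² - 1)` with independent standard normal variables `X_k`, where `‖z‖² = ∑ λ_k²` and
`max |λ_k|` is at most the operator norm. Since `X² - 1` is centered with variance `2`, such sums
are asymptotically `N(0, v)` as soon as the operator norms tend to `0` and `2 ‖z_n‖² → v`
(`IsIsonormal.tendsto_integral_exp_I2`).

The operator norm of the kernels is of order `n^{-1/2}`, by Schur's test applied to the Gram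
matrix of the second differences: its entries are `(T/n)^{2H} ρ̂(j - k)`, and `ρ̂` is summable
because it is a combination of third differences of `|x|^{2H}`, which decay like
`|x|^{2H - 3}` with `H < 1`.

For the Hilbert--Schmidt norm, `‖z_n‖²` expands into cyclic traces of words of length two, three
and four in the operators of the two kernels (`norm_sq_combination`). Such a trace is a sum, over
closed chains of grid indices, of products of values of `ρ̂` and `ρ̃`. As the summand depends only
on the differences of the indices, its average converges to a lattice sum, by dominated convergence
(`tendsto_average_tsum`). For the words with two coarse and two fine kernels, an index is then split
by parity to reach the form in which the lattice sums of `𝔘` are written (`tsum_t11_22_eq`,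
`tsum_alternatingSummand`).

The covariance matrix is positive semidefinite because its quadratic form is thereby a limit of
the nonnegative numbers `2 ‖z_n‖²`.
-/

namespace FBM

/-! ### Elements of the tensor square as finite-rank operators -/

section Tensor

variable {E : Type*} [NormedAddCommGroup E] [InnerProductSpace ℝ E]

/-- The finite-rank operator attached to a tensor: `a ⊗ b` acts as `x ↦ ⟨b, x⟩ a`. -/
noncomputable def tensorOp : E ⊗[ℝ] E →ₗ[ℝ] (E →L[ℝ] E) :=
  TensorProduct.lift <| LinearMap.mk₂ ℝ (fun a b ↦ (innerSL ℝ b).smulRight a)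
    (fun a a' b ↦ by ext x; simp)
    (fun r a b ↦ by ext x; simp [smul_smul, mul_comm])
    (fun a b b' ↦ by ext x; simp [add_smul])
    (fun r a b ↦ by ext x; simp [smul_smul])

theorem tensorOp_tmul (a b x : E) : tensorOp (a ⊗ₜ[ℝ] b) x = (inner ℝ b x : ℝ) • a := by
  simp [tensorOp]

theorem inner_tmul_eq_inner_tensorOp (a b : E) (z : E ⊗[ℝ] E) :
    inner ℝ (a ⊗ₜ[ℝ] b) z = inner ℝ a (tensorOp z b) := by
  induction z with
  | zero => simp
  | tmul c d => simp [tensorOp_tmul, inner_smul_right, real_inner_comm, mul_comm]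
  | add z w hz hw => simp [inner_add_right, hz, hw]

theorem inner_tensorOp_comm (z : E ⊗[ℝ] E) (x y : E) :
    inner ℝ x (tensorOp (TensorProduct.comm ℝ E E z) y) = inner ℝ y (tensorOp z x) := by
  rw [← inner_tmul_eq_inner_tensorOp, ← inner_tmul_eq_inner_tensorOp,
    ← TensorProduct.inner_comm_comm, TensorProduct.comm_comm]
  simp

theorem tensorOp_contr₁ (z w : E ⊗[ℝ] E) :
    tensorOp (contr₁ z w) = tensorOp z ∘L tensorOp (TensorProduct.comm ℝ E E w) := by
  induction z with
  | zero => simp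
  | add z z' hz hz' => simp [hz, hz']
  | tmul a b =>
    induction w with
    | zero => simp
    | add w w' hw hw' => simp [hw, hw']
    | tmul c d =>
      ext x
      simp [contr₁_tmul, tensorOp_tmul, smul_smul, mul_comm]

theorem comm_contr₁ (z w : E ⊗[ℝ] E) :
    TensorProduct.comm ℝ E E (contr₁ z w) = contr₁ w z := by
  induction z with
  | zero => simp
  | add z z' hz hz' => simp [hz, hz']
  | tmul a b =>
    induction w with
    | zero => simp
    | add w w' hw hw' => simp [hw, hw']
    | tmul c d => simp [contr₁_tmul, real_inner_comm]

theorem norm_tensorOp_comm_le (z : E ⊗[ℝ] E) :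
    ‖tensorOp (TensorProduct.comm ℝ E E z)‖ ≤ ‖tensorOp z‖ := by
  refine ContinuousLinearMap.opNorm_le_bound _ (norm_nonneg _) fun x ↦ ?_
  set v := tensorOp (TensorProduct.comm ℝ E E z) x with hv
  have h1 : ‖v‖ * ‖v‖ ≤ ‖tensorOp z‖ * ‖x‖ * ‖v‖ := by
    calc ‖v‖ * ‖v‖ = inner ℝ x (tensorOp z v) := by
          rw [← inner_tensorOp_comm, ← hv, real_inner_self_eq_norm_mul_norm]
      _ ≤ ‖x‖ * ‖tensorOp z v‖ := real_inner_le_norm _ _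
      _ ≤ ‖x‖ * (‖tensorOp z‖ * ‖v‖) := by gcongr; exact ContinuousLinearMap.le_opNorm _ _
      _ = _ := by ring
  rcases (norm_nonneg v).eq_or_lt with h | h
  · rw [← h]; positivity
  · exact le_of_mul_le_mul_right h1 h

theorem norm_tensorOp_contr₁_le (z w : E ⊗[ℝ] E) :
    ‖tensorOp (contr₁ z w)‖ ≤ ‖tensorOp z‖ * ‖tensorOp w‖ := by
  rw [tensorOp_contr₁]
  exact (ContinuousLinearMap.opNorm_comp_le _ _).trans
    (mul_le_mul_of_nonneg_left (norm_tensorOp_comm_le w) (norm_nonneg _))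

theorem norm_tensorOp_symm₂_le (z : E ⊗[ℝ] E) : ‖tensorOp (symm₂ z)‖ ≤ ‖tensorOp z‖ := by
  rw [symm₂, map_smul, map_add, norm_smul]
  have h1 := norm_add_le (tensorOp z) (tensorOp (TensorProduct.comm ℝ E E z))
  have h2 := norm_tensorOp_comm_le z
  norm_num
  linarith

theorem comm_symm₂ (z : E ⊗[ℝ] E) : TensorProduct.comm ℝ E E (symm₂ z) = symm₂ z := by
  simp [symm₂, add_comm]

/-- Schur's test for the Gram matrix: the operator `∑ ⟨d_j, ·⟩ d_j` is bounded by the largest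
absolute row sum of `⟨d_j, d_k⟩`. -/
theorem norm_tensorOp_sum_tmul_self_le {ι : Type*} (s : Finset ι) (d : ι → E) {K : ℝ}
    (hK0 : 0 ≤ K) (hK : ∀ j ∈ s, ∑ k ∈ s, |inner ℝ (d j) (d k)| ≤ K) :
    ‖tensorOp (∑ j ∈ s, d j ⊗ₜ[ℝ] d j)‖ ≤ K := by
  refine ContinuousLinearMap.opNorm_le_bound _ hK0 fun x ↦ ?_
  set c : ι → ℝ := fun j ↦ inner ℝ (d j) x with hc
  have hv : tensorOp (∑ j ∈ s, d j ⊗ₜ[ℝ] d j) x = ∑ j ∈ s, c j • d j := by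
    simp [map_sum, tensorOp_tmul, hc]
  rw [hv]
  set v := ∑ j ∈ s, c j • d j with hvdef
  -- `‖v‖² ≤ K ∑ c_j² = K ⟨x, v⟩ ≤ K ‖x‖ ‖v‖`
  have h1 : ∑ j ∈ s, c j ^ 2 ≤ ‖x‖ * ‖v‖ := by
    refine le_trans (le_of_eq ?_) (real_inner_le_norm x v)
    rw [hvdef, inner_sum]
    refine Finset.sum_congr rfl fun j _ ↦ ?_
    rw [inner_smul_right, real_inner_comm, sq]
  have h2 : ‖v‖ * ‖v‖ ≤ K * ∑ j ∈ s, c j ^ 2 := by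
    have e : ‖v‖ * ‖v‖ = ∑ j ∈ s, ∑ k ∈ s, c j * c k * inner ℝ (d j) (d k) := by
      rw [← real_inner_self_eq_norm_mul_norm, hvdef, sum_inner]
      refine Finset.sum_congr rfl fun j _ ↦ ?_
      rw [inner_sum]
      refine Finset.sum_congr rfl fun k _ ↦ ?_
      rw [inner_smul_left, inner_smul_right]
      simp only [conj_trivial]
      ring
    have h3 : ∑ j ∈ s, ∑ k ∈ s, c j * c k * inner ℝ (d j) (d k) ≤
        ∑ j ∈ s, ∑ k ∈ s, (c j ^ 2 * |inner ℝ (d j) (d k)| / 2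
          + c k ^ 2 * |inner ℝ (d k) (d j)| / 2) := by
      refine Finset.sum_le_sum fun j _ ↦ Finset.sum_le_sum fun k _ ↦ ?_
      rw [real_inner_comm (d j) (d k)]
      set r : ℝ := inner ℝ (d j) (d k)
      have ha : |c j * c k| ≤ (c j ^ 2 + c k ^ 2) / 2 := by
        rw [abs_le]; constructor <;> nlinarith [sq_nonneg (c j + c k), sq_nonneg (c j - c k)]
      calc c j * c k * r ≤ |c j * c k| * |r| := by rw [← abs_mul]; exact le_abs_self _
        _ ≤ (c j ^ 2 + c k ^ 2) / 2 * |r| := by gcongr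
        _ = _ := by ring
    have h4 : ∑ j ∈ s, ∑ k ∈ s, c j ^ 2 * |inner ℝ (d j) (d k)| / 2 ≤
        K * (∑ j ∈ s, c j ^ 2) / 2 := by
      rw [Finset.mul_sum, Finset.sum_div]
      refine Finset.sum_le_sum fun j hj ↦ ?_
      rw [← Finset.sum_div, ← Finset.mul_sum, mul_comm K]
      gcongr
      exact hK j hj
    rw [e]
    refine h3.trans ?_
    simp only [Finset.sum_add_distrib]
    rw [Finset.sum_comm (f := fun j k ↦ c k ^ 2 * |inner ℝ (d k) (d j)| / 2)]
    linarith
  rcases (norm_nonneg v).eq_or_lt with h | h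
  · rw [← h]; positivity
  · refine le_of_mul_le_mul_right ?_ h
    calc ‖v‖ * ‖v‖ ≤ K * ∑ j ∈ s, c j ^ 2 := h2
      _ ≤ K * (‖x‖ * ‖v‖) := by gcongr
      _ = _ := by ring

/-- A specialization of `real_inner_smul_left`, stated so that it applies to the inner product on
`E ⊗ E`. -/
theorem tensor_inner_smul_left (r : ℝ) (z w : E ⊗[ℝ] E) : inner ℝ (r • z) w = r * inner ℝ z w :=
  real_inner_smul_left z w r

/-- A specialization of `real_inner_smul_right`, stated so that it applies to the inner product on
`E ⊗ E`. -/
theorem tensor_inner_smul_right (r : ℝ) (z w : E ⊗[ℝ] E) : inner ℝ z (r • w) = r * inner ℝ z w :=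
  real_inner_smul_right z w r

/-- Every tensor lives on a finite-dimensional subspace, where the spectral theorem is available
even if `E` is not complete. -/
theorem exists_finite_submodule_mapIncl (z : E ⊗[ℝ] E) :
    ∃ (S : Submodule ℝ E) (_ : FiniteDimensional ℝ S) (y : S ⊗[ℝ] S),
      TensorProduct.mapIncl S S y = z := by
  obtain ⟨A, B, hA, hB, h⟩ :=
    TensorProduct.exists_finite_submodule_of_setFinite {z} (Set.finite_singleton z)
  obtain ⟨y, hy⟩ := Set.singleton_subset_iff.1 h
  refine ⟨A ⊔ B, inferInstance, TensorProduct.map (Submodule.inclusion le_sup_left)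
    (Submodule.inclusion le_sup_right) y, ?_⟩
  rw [← hy, TensorProduct.mapIncl, TensorProduct.mapIncl, ← LinearMap.comp_apply,
    ← TensorProduct.map_comp]
  rfl

/-- Spectral decomposition of a symmetric tensor. -/
theorem exists_orthonormal_eq_sum (z : E ⊗[ℝ] E) (hz : TensorProduct.comm ℝ E E z = z) :
    ∃ (N : ℕ) (e : Fin N → E) (c : Fin N → ℝ), Orthonormal ℝ e ∧
      z = ∑ k, c k • (e k ⊗ₜ[ℝ] e k) := by
  obtain ⟨S, hS, y, rfl⟩ := exists_finite_submodule_mapIncl z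
  have hy : TensorProduct.comm ℝ S S y = y := by
    apply (TensorProduct.mapInclIsometry S S).injective
    rw [TensorProduct.mapInclIsometry_apply, TensorProduct.mapInclIsometry_apply, ← hz.trans rfl]
    simp only [TensorProduct.mapIncl]
    rw [TensorProduct.map_comm]
  have hT : (tensorOp y : S →ₗ[ℝ] S).IsSymmetric := by
    intro a b
    have := inner_tensorOp_comm y a b
    rw [hy] at this
    rw [ContinuousLinearMap.coe_coe, this, real_inner_comm]
  let b := hT.eigenvectorBasis rfl
  refine ⟨_, fun k ↦ (b k : E), hT.eigenvalues rfl, ?_, ?_⟩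
  · exact b.orthonormal.comp_linearIsometry S.subtypeₗᵢ
  · have h : y = ∑ k, hT.eigenvalues rfl k • (b k ⊗ₜ[ℝ] b k) := by
      refine ((b.tensorProduct b).sum_repr y).symm.trans ?_
      rw [Fintype.sum_prod_type]
      refine Finset.sum_congr rfl fun i _ ↦ ?_
      rw [Finset.sum_eq_single i]
      · rw [OrthonormalBasis.repr_apply_apply, OrthonormalBasis.tensorProduct_apply,
          inner_tmul_eq_inner_tensorOp]
        have := hT.apply_eigenvectorBasis rfl i
        rw [ContinuousLinearMap.coe_coe] at this
        rw [this]
        simp [inner_smul_right, b]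
      · intro j _ hj
        rw [OrthonormalBasis.repr_apply_apply, OrthonormalBasis.tensorProduct_apply,
          inner_tmul_eq_inner_tensorOp]
        have := hT.apply_eigenvectorBasis rfl j
        rw [ContinuousLinearMap.coe_coe] at this
        rw [this, inner_smul_right, b.orthonormal.2 hj.symm]
        simp
      · simp
    conv_lhs => rw [h]
    simp [map_sum, TensorProduct.mapIncl]

section Spectral

variable {ι : Type*} [Fintype ι] {e : ι → E} {c : ι → ℝ} {z : E ⊗[ℝ] E}

theorem norm_sq_eq_sum_sq (he : Orthonormal ℝ e) (hz : z = ∑ k, c k • (e k ⊗ₜ[ℝ] e k)) :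
    ‖z‖ ^ 2 = ∑ k, c k ^ 2 := by
  classical
  rw [← real_inner_self_eq_norm_sq, hz]
  simp only [sum_inner, inner_sum, tensor_inner_smul_left, tensor_inner_smul_right,
    TensorProduct.inner_tmul, orthonormal_iff_ite.1 he]
  simp [sq]

/-- The coefficients of a spectral decomposition are eigenvalues, hence bounded by the operator
norm. -/
theorem abs_le_norm_tensorOp (he : Orthonormal ℝ e) (hz : z = ∑ k, c k • (e k ⊗ₜ[ℝ] e k))
    (k : ι) : |c k| ≤ ‖tensorOp z‖ := by
  classical
  have h := (tensorOp z).le_opNorm (e k)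
  have h2 : tensorOp z (e k) = c k • e k := by
    rw [hz]
    simp [tensorOp_tmul, orthonormal_iff_ite.1 he]
  rwa [h2, norm_smul, he.1 k, mul_one, mul_one, Real.norm_eq_abs] at h

end Spectral

end Tensor

/-! ### A central limit theorem in the second Wiener chaos -/

theorem integral_pow_gaussianReal_zero_one (n : ℕ) :
    ∫ x, x ^ n ∂gaussianReal 0 1 = iteratedDeriv n (fun t : ℝ ↦ Real.exp (t ^ 2 / 2)) 0 := by
  have h := iteratedDeriv_mgf_zero (X := id) (μ := gaussianReal 0 1) (by simp) n
  have e : mgf id (gaussianReal 0 1) = fun t : ℝ ↦ Real.exp (t ^ 2 / 2) := by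
    funext t
    rw [mgf_gaussianReal Measure.map_id]
    simp
  rw [e] at h
  rw [h]
  rfl

theorem iteratedDeriv_exp_sq_div_two :
    iteratedDeriv 2 (fun t : ℝ ↦ Real.exp (t ^ 2 / 2)) 0 = 1 ∧
      iteratedDeriv 4 (fun t : ℝ ↦ Real.exp (t ^ 2 / 2)) 0 = 3 := by
  have key : ∀ p p' : ℝ → ℝ, (∀ t, HasDerivAt p (p' t) t) →
      deriv (fun t : ℝ ↦ p t * Real.exp (t ^ 2 / 2)) =
        fun t ↦ (p' t + t * p t) * Real.exp (t ^ 2 / 2) := by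
    intro p p' hp
    funext t
    have h1 : HasDerivAt (fun t : ℝ ↦ Real.exp (t ^ 2 / 2)) (Real.exp (t ^ 2 / 2) * t) t := by
      have := ((hasDerivAt_pow 2 t).div_const 2).exp
      convert this using 1
      norm_num
    have h2 : HasDerivAt (fun t : ℝ ↦ p t * Real.exp (t ^ 2 / 2)) _ t := (hp t).mul h1
    rw [h2.deriv]
    ring
  have d1 : deriv (fun t : ℝ ↦ Real.exp (t ^ 2 / 2)) = fun t ↦ t * Real.exp (t ^ 2 / 2) := by
    have := key (fun _ ↦ 1) (fun _ ↦ 0) fun t ↦ hasDerivAt_const t 1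
    simpa using this
  have d2 : deriv (fun t : ℝ ↦ t * Real.exp (t ^ 2 / 2)) =
      fun t ↦ (1 + t ^ 2) * Real.exp (t ^ 2 / 2) := by
    rw [key (fun t ↦ t) (fun _ ↦ 1) fun t ↦ hasDerivAt_id t]
    funext t; ring
  have d3 : deriv (fun t : ℝ ↦ (1 + t ^ 2) * Real.exp (t ^ 2 / 2)) =
      fun t ↦ (3 * t + t ^ 3) * Real.exp (t ^ 2 / 2) := by
    rw [key (fun t ↦ 1 + t ^ 2) (fun t ↦ 2 * t) fun t ↦ by
      simpa using (hasDerivAt_pow 2 t).const_add 1]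
    funext t; ring
  have d4 : deriv (fun t : ℝ ↦ (3 * t + t ^ 3) * Real.exp (t ^ 2 / 2)) =
      fun t ↦ (3 + 3 * t ^ 2 + t * (3 * t + t ^ 3)) * Real.exp (t ^ 2 / 2) :=
    key (fun t ↦ 3 * t + t ^ 3) (fun t ↦ 3 + 3 * t ^ 2) fun t ↦ by
      have h : HasDerivAt (fun t : ℝ ↦ 3 * t + t ^ 3) _ t :=
        ((hasDerivAt_id t).const_mul 3).add (hasDerivAt_pow 3 t)
      simpa using h
  simp [iteratedDeriv_succ, iteratedDeriv_zero, d1, d2, d3, d4]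

theorem integral_sq_gaussianReal_zero_one : ∫ x, x ^ 2 ∂gaussianReal 0 1 = 1 := by
  rw [integral_pow_gaussianReal_zero_one, iteratedDeriv_exp_sq_div_two.1]

theorem integral_pow_four_gaussianReal_zero_one : ∫ x, x ^ 4 ∂gaussianReal 0 1 = 3 := by
  rw [integral_pow_gaussianReal_zero_one, iteratedDeriv_exp_sq_div_two.2]

theorem integrable_pow_gaussianReal_zero_one (n : ℕ) :
    Integrable (fun x : ℝ ↦ x ^ n) (gaussianReal 0 1) := by
  have h := (memLp_id_gaussianReal (μ := 0) (v := 1) n).integrable_norm_pow'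
  refine (integrable_norm_iff (by fun_prop)).1 ?_
  simpa [norm_pow] using h

/-- The characteristic function of the centered chi-square variable `X² - 1`, `X ∼ N(0,1)`. -/
noncomputable def chiSqCharFun (s : ℝ) : ℂ :=
  ∫ x, Complex.exp ((s * (x ^ 2 - 1) : ℝ) * Complex.I) ∂gaussianReal 0 1

theorem norm_chiSqCharFun_le_one (s : ℝ) : ‖chiSqCharFun s‖ ≤ 1 := by
  refine (norm_integral_le_integral_norm _).trans ?_
  simp only [Complex.norm_exp_ofReal_mul_I]
  simp

/-- `X² - 1` has mean `0` and variance `2`, so its characteristic function agrees with that of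
`N(0,2)` to second order at the origin. -/
theorem chiSqCharFun_sub_exp_isLittleO :
    (fun s : ℝ ↦ chiSqCharFun s - Complex.exp (-(s ^ 2 : ℝ))) =o[𝓝 0] fun s ↦ s ^ 2 := by
  -- normalized to unit variance, to apply the Taylor expansion of characteristic functions
  set Y : ℝ → ℝ := fun x ↦ (x ^ 2 - 1) / √2 with hY
  have hs : √(2 : ℝ) ≠ 0 := by positivity
  have hs2 : √(2 : ℝ) ^ 2 = 2 := Real.sq_sqrt (by norm_num)
  have i2 := integrable_pow_gaussianReal_zero_one 2
  have i4 := integrable_pow_gaussianReal_zero_one 4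
  have h0 : ∫ x, Y x ∂gaussianReal 0 1 = 0 := by
    rw [hY, integral_div, integral_sub i2 (integrable_const _), integral_sq_gaussianReal_zero_one]
    simp
  have h1 : ∫ x, (Y ^ 2) x ∂gaussianReal 0 1 = 1 := by
    have e : ∀ x, (Y ^ 2) x = (x ^ 4 - 2 * x ^ 2 + 1) / 2 := by
      intro x
      simp only [hY, Pi.pow_apply, div_pow, hs2]
      ring
    simp only [e]
    have i42 : Integrable (fun x : ℝ ↦ x ^ 4 - 2 * x ^ 2) (gaussianReal 0 1) :=
      i4.sub (i2.const_mul 2)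
    rw [integral_div, integral_add i42 (integrable_const _),
      integral_sub i4 (i2.const_mul 2), integral_const_mul, integral_sq_gaussianReal_zero_one,
      integral_pow_four_gaussianReal_zero_one]
    norm_num
  have hm : Measurable Y := by fun_prop
  have ht := taylor_charFun_two hm.aemeasurable h0 h1
  have hc : Tendsto (fun s : ℝ ↦ √2 * s) (𝓝 0) (𝓝 0) := by
    have : Continuous fun s : ℝ ↦ √2 * s := by fun_prop
    simpa using this.tendsto 0
  have ht2 := ht.comp_tendsto hc
  have e1 : ∀ s : ℝ, charFun ((gaussianReal 0 1).map Y) (√2 * s) = chiSqCharFun s := by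
    intro s
    rw [charFun_apply_real, integral_map hm.aemeasurable (by fun_prop), chiSqCharFun]
    refine integral_congr_ae (ae_of_all _ fun x ↦ ?_)
    simp only [hY]
    congr 2
    norm_cast
    field_simp
  have hA : (fun s : ℝ ↦ chiSqCharFun s - (1 - (s : ℂ) ^ 2)) =o[𝓝 0] fun s ↦ s ^ 2 := by
    have ht3 : (fun s : ℝ ↦ chiSqCharFun s - (1 - (s : ℂ) ^ 2)) =o[𝓝 0]
        fun s : ℝ ↦ (√2 * s) ^ 2 := by
      refine ht2.congr (fun s ↦ ?_) (fun s ↦ rfl)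
      simp only [Function.comp_apply, e1]
      congr 2
      rw [← Complex.ofReal_pow, mul_pow, hs2]
      push_cast; ring
    refine ht3.trans_isBigO ?_
    simp only [mul_pow]
    exact Asymptotics.isBigO_const_mul_self _ _ _
  have hB : (fun s : ℝ ↦ (1 - (s : ℂ) ^ 2) - Complex.exp (-(s ^ 2 : ℝ))) =o[𝓝 0]
      fun s ↦ s ^ 2 := by
    have hd : (fun x : ℝ ↦ Real.exp x - 1 - x) =o[𝓝 0] fun x ↦ x := by
      have := (Real.hasDerivAt_exp 0).isLittleO
      simpa using this
    have hq : Tendsto (fun s : ℝ ↦ -s ^ 2) (𝓝 0) (𝓝 0) := by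
      have : Continuous fun s : ℝ ↦ -s ^ 2 := by fun_prop
      simpa using this.tendsto 0
    have h3 := (hd.comp_tendsto hq).neg_right
    refine Asymptotics.IsLittleO.of_norm_left ?_
    refine h3.norm_left.congr (fun s ↦ ?_) (fun s ↦ by simp)
    rw [← norm_neg, ← Complex.norm_real]
    congr 1
    simp
    ring
  exact (hA.add hB).congr_left fun s ↦ by ring

theorem norm_prod_sub_prod_le {ι : Type*} (s : Finset ι) (a b : ι → ℂ) (ha : ∀ i, ‖a i‖ ≤ 1)
    (hb : ∀ i, ‖b i‖ ≤ 1) : ‖∏ i ∈ s, a i - ∏ i ∈ s, b i‖ ≤ ∑ i ∈ s, ‖a i - b i‖ := by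
  classical
  induction s using Finset.induction_on with
  | empty => simp
  | insert i s hi ih =>
    rw [Finset.prod_insert hi, Finset.prod_insert hi, Finset.sum_insert hi]
    have e : a i * ∏ x ∈ s, a x - b i * ∏ x ∈ s, b x =
        (a i - b i) * ∏ x ∈ s, a x + b i * (∏ x ∈ s, a x - ∏ x ∈ s, b x) := by ring
    rw [e]
    refine (norm_add_le _ _).trans ?_
    rw [norm_mul, norm_mul]
    have h1 : ‖∏ x ∈ s, a x‖ ≤ 1 := by
      rw [norm_prod]; exact Finset.prod_le_one (fun _ _ ↦ norm_nonneg _) fun i _ ↦ ha i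
    gcongr
    · exact mul_le_of_le_one_right (norm_nonneg _) h1
    · exact (mul_le_of_le_one_left (norm_nonneg _) (hb i)).trans ih

section Wiener

variable {E : Type*} [NormedAddCommGroup E] [InnerProductSpace ℝ E]
  {Ω : Type*} [MeasurableSpace Ω] {P : Measure Ω}

theorem ae_sum_smul_apply {ι : Type*} (s : Finset ι) (c : ι → ℝ) (f : ι → Ω →ₘ[P] ℝ) :
    ∀ᵐ ω ∂P, (∑ k ∈ s, c k • f k : Ω →ₘ[P] ℝ) ω = ∑ k ∈ s, c k * f k ω := by
  classical
  induction s using Finset.induction_on with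
  | empty =>
    filter_upwards [AEEqFun.coeFn_zero (α := Ω) (μ := P) (β := ℝ)] with ω h
    simpa using h
  | insert i s hi ih =>
    filter_upwards [ih, AEEqFun.coeFn_add (c i • f i) (∑ k ∈ s, c k • f k),
      AEEqFun.coeFn_smul (c i) (f i)] with ω h1 h2 h3
    rw [Finset.sum_insert hi, Finset.sum_insert hi, h2, Pi.add_apply, h1, h3, Pi.smul_apply,
      smul_eq_mul]

theorem ae_I2_eq_sum (W : E →ₗᵢ[ℝ] Lp ℝ 2 P) {N : ℕ} {e : Fin N → E} {c : Fin N → ℝ}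
    {z : E ⊗[ℝ] E} (he : Orthonormal ℝ e) (hz : z = ∑ k, c k • (e k ⊗ₜ[ℝ] e k)) :
    ∀ᵐ ω ∂P, I2 W z ω = ∑ k, c k * (W (e k) ω ^ 2 - 1) := by
  have h : I2 W z = ∑ k, c k • wickMul W (e k) (e k) := by
    rw [hz, map_sum]
    refine Finset.sum_congr rfl fun k _ ↦ ?_
    rw [map_smul, I2_tmul, wickMul]
  rw [h]
  have h2 : ∀ᵐ ω ∂P, ∀ k, wickMul W (e k) (e k) ω = W (e k) ω * W (e k) ω - inner ℝ (e k) (e k) :=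
    ae_all_iff.2 fun k ↦ coeFn_wickMul W (e k) (e k)
  filter_upwards [ae_sum_smul_apply Finset.univ c fun k ↦ wickMul W (e k) (e k), h2] with ω h1 h2
  rw [h1]
  refine Finset.sum_congr rfl fun k _ ↦ ?_
  rw [h2, real_inner_self_eq_norm_sq, he.1 k]
  ring

/-- Pointwise linearity of `W`, needed to read off the joint law of finitely many values. -/
theorem ae_map_sum_smul (W : E →ₗᵢ[ℝ] Lp ℝ 2 P) {N : ℕ} (e : Fin N → E) (t : Fin N → ℝ) :
    ∀ᵐ ω ∂P, W (∑ k, t k • e k) ω = ∑ k, t k * W (e k) ω := by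
  have h : ((W (∑ k, t k • e k) : Lp ℝ 2 P) : Ω →ₘ[P] ℝ) =
      ∑ k, t k • ((W (e k) : Lp ℝ 2 P) : Ω →ₘ[P] ℝ) := by
    rw [map_sum, AddSubgroup.val_finsetSum]
    refine Finset.sum_congr rfl fun k _ ↦ ?_
    rw [map_smul]
    rfl
  rw [h]
  exact ae_sum_smul_apply Finset.univ t fun k ↦ ((W (e k) : Lp ℝ 2 P) : Ω →ₘ[P] ℝ)

theorem IsIsonormal.charFun_map {W : E →ₗᵢ[ℝ] Lp ℝ 2 P} (hW : IsIsonormal W) (h : E) (t : ℝ) :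
    charFun (P.map (W h)) t = Complex.exp (-((‖h‖ ^ 2 * t ^ 2 / 2 : ℝ) : ℂ)) := by
  rw [(hW h).map_eq, charFun_gaussianReal]
  congr 1
  push_cast
  simp

variable [IsProbabilityMeasure P]

/-- An isonormal process maps an orthonormal family to independent variables. -/
theorem IsIsonormal.iIndepFun {W : E →ₗᵢ[ℝ] Lp ℝ 2 P} (hW : IsIsonormal W) {N : ℕ}
    {e : Fin N → E} (he : Orthonormal ℝ e) : iIndepFun (fun k ↦ (W (e k) : Ω → ℝ)) P := by
  have hm : ∀ k, AEMeasurable (W (e k) : Ω → ℝ) P := fun k ↦ (hW (e k)).aemeasurable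
  -- the joint characteristic function at `t` is that of `W (∑ t_k e_k)` at `1`
  rw [iIndepFun_iff_charFun_pi hm]
  intro t
  have h1 : charFun (P.map (fun ω ↦ WithLp.toLp 2 fun k ↦ W (e k) ω)) t =
      charFun (P.map (W (∑ k, t k • e k))) 1 := by
    rw [charFun_apply, charFun_apply_real, integral_map (by fun_prop) (by fun_prop),
      integral_map (hW _).aemeasurable (by fun_prop)]
    refine integral_congr_ae ?_
    filter_upwards [ae_map_sum_smul W e t] with ω hω
    rw [hω]
    simp [PiLp.inner_apply]
  rw [h1]
  simp only [hW.charFun_map]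
  rw [← Complex.exp_sum]
  congr 1
  have hn : ‖∑ k, t k • e k‖ ^ 2 = ∑ k, t k ^ 2 := by
    rw [← real_inner_self_eq_norm_sq, he.inner_sum]
    simp [sq]
  rw [hn]
  simp [he.1, Finset.sum_div]

theorem IsIsonormal.integral_exp_I2 {W : E →ₗᵢ[ℝ] Lp ℝ 2 P} (hW : IsIsonormal W) {N : ℕ}
    {e : Fin N → E} {c : Fin N → ℝ} {z : E ⊗[ℝ] E} (he : Orthonormal ℝ e)
    (hz : z = ∑ k, c k • (e k ⊗ₜ[ℝ] e k)) :
    ∫ ω, Complex.exp ((I2 W z ω : ℝ) * Complex.I) ∂P = ∏ k, chiSqCharFun (c k) := by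
  have hm : ∀ k, AEMeasurable (W (e k) : Ω → ℝ) P := fun k ↦ (hW (e k)).aemeasurable
  have h1 : ∫ ω, Complex.exp ((I2 W z ω : ℝ) * Complex.I) ∂P =
      ∫ ω, ∏ k, Complex.exp ((c k * (W (e k) ω ^ 2 - 1) : ℝ) * Complex.I) ∂P := by
    refine integral_congr_ae ?_
    filter_upwards [ae_I2_eq_sum W he hz] with ω hω
    rw [hω, ← Complex.exp_sum, ← Finset.sum_mul]
    push_cast
    rfl
  rw [h1, (hW.iIndepFun he).integral_fun_prod_comp
    (f := fun k x ↦ Complex.exp ((c k * (x ^ 2 - 1) : ℝ) * Complex.I)) hm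
    (fun k ↦ by fun_prop)]
  refine Finset.prod_congr rfl fun k _ ↦ ?_
  have hl := hW (e k)
  have hn : (‖e k‖₊ ^ 2) = 1 := by
    ext; simp [he.1 k]
  rw [hn] at hl
  rw [chiSqCharFun, ← hl.map_eq, integral_map (hm k) (by fun_prop)]

/-- The central limit theorem in the second chaos: symmetric tensors whose operator norms vanish
and whose Hilbert--Schmidt norms converge have asymptotically normal double integrals. -/
theorem IsIsonormal.tendsto_integral_exp_I2 {W : E →ₗᵢ[ℝ] Lp ℝ 2 P} (hW : IsIsonormal W)
    (z : ℕ → E ⊗[ℝ] E) (hsymm : ∀ n, TensorProduct.comm ℝ E E (z n) = z n)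
    (hop : Tendsto (fun n ↦ ‖tensorOp (z n)‖) atTop (𝓝 0)) {v : ℝ}
    (hnorm : Tendsto (fun n ↦ 2 * ‖z n‖ ^ 2) atTop (𝓝 v)) :
    Tendsto (fun n ↦ ∫ ω, Complex.exp ((I2 W (z n) ω : ℝ) * Complex.I) ∂P) atTop
      (𝓝 (Complex.exp (-(v / 2 : ℝ)))) := by
  -- The characteristic function is `∏ chiSqCharFun (c k)`, to be compared factor by factor with
  -- `∏ exp (-(c k)²) = exp (-‖z n‖²)`.
  choose N e c he hz using fun n ↦ exists_orthonormal_eq_sum (z n) (hsymm n)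
  have hlim : Tendsto (fun n ↦ Complex.exp (-((‖z n‖ ^ 2 : ℝ) : ℂ))) atTop
      (𝓝 (Complex.exp (-(v / 2 : ℝ)))) := by
    have h1 : Tendsto (fun n ↦ ‖z n‖ ^ 2) atTop (𝓝 (v / 2)) := by
      convert hnorm.div_const 2 using 2
      ring
    exact ((Complex.continuous_exp.comp (Complex.continuous_ofReal.neg)).tendsto _).comp h1
  suffices hd : Tendsto (fun n ↦ (∫ ω, Complex.exp ((I2 W (z n) ω : ℝ) * Complex.I) ∂P) -
      Complex.exp (-((‖z n‖ ^ 2 : ℝ) : ℂ))) atTop (𝓝 0) by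
    simpa using hd.add hlim
  rw [tendsto_zero_iff_norm_tendsto_zero]
  obtain ⟨B, hB⟩ := hnorm.bddAbove_range
  have hB' : ∀ n, ‖z n‖ ^ 2 ≤ B := fun n ↦ by
    have := hB ⟨n, rfl⟩
    simp only at this
    nlinarith [sq_nonneg ‖z n‖]
  have hB0 : 0 ≤ B := (sq_nonneg _).trans (hB' 0)
  rw [Metric.tendsto_atTop]
  intro ε hε
  have hε' : 0 < ε / (B + 1) := by positivity
  obtain ⟨δ, hδ, hδ'⟩ := Metric.eventually_nhds_iff.1
    (chiSqCharFun_sub_exp_isLittleO.bound (half_pos hε'))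
  obtain ⟨n₀, hn₀⟩ := Metric.tendsto_atTop.1 hop δ hδ
  refine ⟨n₀, fun n hn ↦ ?_⟩
  have hcδ : ∀ k, |c n k| < δ := fun k ↦ by
    have h1 := hn₀ n hn
    rw [Real.dist_0_eq_abs, abs_of_nonneg (norm_nonneg _)] at h1
    exact (abs_le_norm_tensorOp (he n) (hz n) k).trans_lt h1
  have hsq := norm_sq_eq_sum_sq (he n) (hz n)
  have hexp : Complex.exp (-((‖z n‖ ^ 2 : ℝ) : ℂ)) =
      ∏ k, Complex.exp (-((c n k ^ 2 : ℝ) : ℂ)) := by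
    rw [← Complex.exp_sum, hsq]
    push_cast
    rw [Finset.sum_neg_distrib]
  rw [Real.dist_0_eq_abs, abs_of_nonneg (norm_nonneg _), hW.integral_exp_I2 (he n) (hz n), hexp]
  have hb1 : ∀ k, ‖Complex.exp (-((c n k ^ 2 : ℝ) : ℂ))‖ ≤ 1 := fun k ↦ by
    rw [← Complex.ofReal_neg, Complex.norm_exp_ofReal]
    exact Real.exp_le_one_iff.2 (by nlinarith [sq_nonneg (c n k)])
  calc _ ≤ ∑ k, ‖chiSqCharFun (c n k) - Complex.exp (-((c n k ^ 2 : ℝ) : ℂ))‖ :=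
        norm_prod_sub_prod_le _ _ _ (fun k ↦ norm_chiSqCharFun_le_one _) hb1
    _ ≤ ∑ k, ε / (B + 1) / 2 * c n k ^ 2 := by
        refine Finset.sum_le_sum fun k _ ↦ ?_
        have := hδ' (y := c n k) (by rw [Real.dist_0_eq_abs]; exact hcδ k)
        rwa [Real.norm_of_nonneg (sq_nonneg _)] at this
    _ = ε / (B + 1) / 2 * ‖z n‖ ^ 2 := by rw [← Finset.mul_sum, hsq]
    _ ≤ ε / (B + 1) / 2 * B := by gcongr; exact hB' n
    _ < ε := by
        rw [div_div, div_mul_eq_mul_div, div_lt_iff₀ (by positivity)]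
        nlinarith

end Wiener

/-! ### The correlations of the second differences -/

theorem exists_sub_eq_deriv_of_pos {f f' : ℝ → ℝ} (hf : ∀ y > 0, HasDerivAt f (f' y) y) {x : ℝ}
    (hx : 0 < x) : ∃ ξ > x, f (x + 1) - f x = f' ξ := by
  obtain ⟨ξ, hξ, h⟩ := exists_hasDerivAt_eq_slope f f' (show x < x + 1 by linarith)
    (fun y hy ↦ (hf y (lt_of_lt_of_le hx hy.1)).continuousAt.continuousWithinAt)
    (fun y hy ↦ hf y (hx.trans hy.1))
  exact ⟨ξ, hξ.1, by rw [h]; simp⟩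

/-- The third forward difference of `x ↦ |x| ^ q`. -/
noncomputable def thirdDiff (q x : ℝ) : ℝ :=
  |x + 3| ^ q - 3 * |x + 2| ^ q + 3 * |x + 1| ^ q - |x| ^ q

/-- The symmetry that reduces negative arguments to positive ones. -/
theorem thirdDiff_neg (q x : ℝ) : thirdDiff q (-3 - x) = -thirdDiff q x := by
  simp only [thirdDiff]
  rw [show -3 - x + 3 = -x by ring, show -3 - x + 2 = -(x + 1) by ring,
    show -3 - x + 1 = -(x + 2) by ring, show -3 - x = -(x + 3) by ring]
  simp only [abs_neg]
  ring

/-- Three applications of the mean value theorem: the third difference is a value of the third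
derivative. -/
theorem abs_thirdDiff_le {q : ℝ} (hq : q < 3) {x : ℝ} (hx : 0 < x) :
    |thirdDiff q x| ≤ |q * ((q - 1) * (q - 2))| * x ^ (q - 3) := by
  have hpow : ∀ (p : ℝ), ∀ y > 0, HasDerivAt (fun y : ℝ ↦ y ^ p) (p * y ^ (p - 1)) y :=
    fun p y hy ↦ Real.hasDerivAt_rpow_const (Or.inl hy.ne')
  have hΔ : ∀ {f f' : ℝ → ℝ}, (∀ y > 0, HasDerivAt f (f' y) y) →
      ∀ y > 0, HasDerivAt (fun y ↦ f (y + 1) - f y) (f' (y + 1) - f' y) y := by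
    intro f f' hf y hy
    have h1 := (hf (y + 1) (by linarith)).comp_add_const y 1
    exact h1.sub (hf y hy)
  have d0 := hpow q
  have d1 : ∀ y > 0, HasDerivAt (fun y : ℝ ↦ q * y ^ (q - 1))
      (q * ((q - 1) * y ^ (q - 1 - 1))) y := fun y hy ↦ (hpow (q - 1) y hy).const_mul q
  have d2 : ∀ y > 0, HasDerivAt (fun y : ℝ ↦ q * ((q - 1) * y ^ (q - 1 - 1)))
      (q * ((q - 1) * ((q - 1 - 1) * y ^ (q - 1 - 1 - 1)))) y :=
    fun y hy ↦ ((hpow (q - 1 - 1) y hy).const_mul (q - 1)).const_mul q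
  obtain ⟨ξ₁, h₁, e₁⟩ := exists_sub_eq_deriv_of_pos (hΔ (hΔ d0)) hx
  obtain ⟨ξ₂, h₂, e₂⟩ := exists_sub_eq_deriv_of_pos (hΔ d1) (hx.trans h₁)
  obtain ⟨ξ₃, h₃, e₃⟩ := exists_sub_eq_deriv_of_pos d2 ((hx.trans h₁).trans h₂)
  have hξ : x < ξ₃ := h₁.trans (h₂.trans h₃)
  have e : thirdDiff q x = q * ((q - 1) * ((q - 1 - 1) * ξ₃ ^ (q - 1 - 1 - 1))) := by
    rw [← e₃, ← e₂, ← e₁, thirdDiff, abs_of_pos (by linarith : 0 < x + 3),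
      abs_of_pos (by linarith : 0 < x + 2), abs_of_pos (by linarith : 0 < x + 1), abs_of_pos hx,
      show x + 1 + 1 + 1 = x + 3 by ring, show x + 1 + 1 = x + 2 by ring]
    ring
  rw [e, show q - 1 - 1 = q - 2 by ring, show q - 2 - 1 = q - 3 by ring, ← mul_assoc (q - 1),
    ← mul_assoc q, abs_mul, abs_of_pos (Real.rpow_pos_of_pos (hx.trans hξ) _)]
  exact mul_le_mul_of_nonneg_left
    (Real.rpow_le_rpow_of_nonpos hx hξ.le (sub_nonpos.2 hq.le)) (abs_nonneg _)

theorem summable_thirdDiff {q : ℝ} (hq : q < 2) : Summable fun j : ℤ ↦ thirdDiff q j := by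
  have h1 : Summable fun n : ℕ ↦ thirdDiff q n := by
    rw [← summable_nat_add_iff 1]
    refine Summable.of_norm_bounded
      (g := fun n : ℕ ↦ |q * ((q - 1) * (q - 2))| * ((n + 1 : ℕ) : ℝ) ^ (q - 3)) ?_ fun n ↦ ?_
    · refine Summable.mul_left _ ?_
      exact (summable_nat_add_iff (f := fun n : ℕ ↦ (n : ℝ) ^ (q - 3)) 1).2
        (Real.summable_nat_rpow.2 (by linarith))
    · exact abs_thirdDiff_le (by linarith) (by positivity)
  refine Summable.of_nat_of_neg_add_one (by simpa using h1) ?_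
  rw [← summable_nat_add_iff 2]
  refine h1.neg.congr fun n ↦ ?_
  rw [← thirdDiff_neg]
  congr 1
  push_cast
  ring

section Lattice

variable {H : ℝ}

theorem rhoHat_eq (j : ℤ) : rhoHat H j =
    1 / 2 * (thirdDiff (2 * H) (j - 2 : ℤ) - thirdDiff (2 * H) (j - 1 : ℤ)) := by
  simp only [rhoHat, thirdDiff]
  push_cast
  rw [show (j : ℝ) - 2 + 3 = j + 1 by ring, show (j : ℝ) - 2 + 2 = j by ring,
    show (j : ℝ) - 2 + 1 = j - 1 by ring, show (j : ℝ) - 1 + 3 = j + 2 by ring,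
    show (j : ℝ) - 1 + 2 = j + 1 by ring, show (j : ℝ) - 1 + 1 = j by ring]
  ring

theorem rhoTilde_eq (j : ℤ) : rhoTilde H j = 1 / 2 ^ (2 * H + 1) *
    (thirdDiff (2 * H) (j - 2 : ℤ) + thirdDiff (2 * H) (j - 3 : ℤ) - thirdDiff (2 * H) (j : ℤ)
      - thirdDiff (2 * H) (j - 1 : ℤ)) := by
  simp only [rhoTilde, thirdDiff]
  push_cast
  rw [show (j : ℝ) - 2 + 3 = j + 1 by ring, show (j : ℝ) - 2 + 2 = j by ring,
    show (j : ℝ) - 2 + 1 = j - 1 by ring, show (j : ℝ) - 1 + 3 = j + 2 by ring,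
    show (j : ℝ) - 1 + 2 = j + 1 by ring, show (j : ℝ) - 1 + 1 = j by ring,
    show (j : ℝ) - 3 + 3 = j by ring, show (j : ℝ) - 3 + 2 = j - 1 by ring,
    show (j : ℝ) - 3 + 1 = j - 2 by ring]
  ring

theorem summable_thirdDiff_sub (hH : H < 1) (k : ℤ) :
    Summable fun j : ℤ ↦ thirdDiff (2 * H) (j - k : ℤ) :=
  (summable_thirdDiff (by linarith)).comp_injective (Equiv.subRight k).injective

theorem summable_rhoHat (hH : H < 1) : Summable (rhoHat H) := by
  simp only [funext rhoHat_eq]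
  exact ((summable_thirdDiff_sub hH 2).sub (summable_thirdDiff_sub hH 1)).mul_left _

theorem summable_rhoTilde (hH : H < 1) : Summable (rhoTilde H) := by
  simp only [funext rhoTilde_eq]
  exact ((((summable_thirdDiff_sub hH 2).add (summable_thirdDiff_sub hH 3)).sub
    (summable_thirdDiff (by linarith))).sub (summable_thirdDiff_sub hH 1)).mul_left _

theorem rhoHat_neg (j : ℤ) : rhoHat H (-j) = rhoHat H j := by
  simp only [rhoHat]
  push_cast
  rw [show -(j : ℝ) - 2 = -(j + 2) by ring, show -(j : ℝ) - 1 = -(j + 1) by ring,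
    show -(j : ℝ) + 1 = -(j - 1) by ring, show -(j : ℝ) + 2 = -(j - 2) by ring]
  simp only [abs_neg]
  ring

theorem rhoTilde_neg (j : ℤ) : rhoTilde H (-j) = rhoTilde H j := by
  simp only [rhoTilde]
  push_cast
  rw [show -(j : ℝ) - 2 = -(j + 2) by ring, show -(j : ℝ) - 1 = -(j + 1) by ring,
    show -(j : ℝ) + 1 = -(j - 1) by ring, show -(j : ℝ) + 2 = -(j - 2) by ring,
    show -(j : ℝ) - 3 = -(j + 3) by ring, show -(j : ℝ) + 3 = -(j - 3) by ring]
  simp only [abs_neg]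
  ring

theorem rhoHat_sub_comm (j k : ℤ) : rhoHat H (j - k) = rhoHat H (k - j) := by
  rw [← rhoHat_neg, neg_sub]

theorem rhoTilde_sub_comm (j k : ℤ) : rhoTilde H (j - k) = rhoTilde H (k - j) := by
  rw [← rhoTilde_neg, neg_sub]

theorem _root_.Summable.bounded_mul {ι : Type*} {f g : ι → ℝ} (hf : Summable f) {M : ℝ}
    (hg : ∀ i, |g i| ≤ M) : Summable fun i ↦ f i * g i := by
  refine Summable.of_norm_bounded (hf.norm.mul_right M) fun i ↦ ?_
  rw [norm_mul]
  exact mul_le_mul_of_nonneg_left (hg i) (norm_nonneg _)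

theorem _root_.Summable.exists_abs_le {ι : Type*} {f : ι → ℝ} (hf : Summable f) :
    ∃ M, ∀ i, |f i| ≤ M :=
  ⟨_, fun i ↦ hf.abs.le_tsum i fun j _ ↦ abs_nonneg (f j)⟩

/-- A lattice sum over `ℤ²` of a product of three factors converges as soon as two of the factors
are evaluated along an injective change of variables. -/
theorem summable_chain₂ {a b c : ℤ → ℝ} (ha : Summable a) (hb : Summable b) (hc : Summable c)
    (e : ℤ × ℤ → ℤ × ℤ) (he : Function.Injective e) (m : ℤ × ℤ → ℤ) :
    Summable fun i ↦ a (e i).1 * b (e i).2 * c (m i) := by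
  obtain ⟨M, hM⟩ := hc.exists_abs_le
  exact ((summable_mul_of_summable_norm ha.norm hb.norm).comp_injective he).bounded_mul
    fun i ↦ hM (m i)

/-- A lattice sum over `ℤ³` of a product of four factors converges as soon as three of the factors
are evaluated along an injective change of variables. -/
theorem summable_chain₃ {a b c d : ℤ → ℝ} (ha : Summable a) (hb : Summable b) (hc : Summable c)
    (hd : Summable d) (e : ℤ × ℤ × ℤ → ℤ × ℤ × ℤ) (he : Function.Injective e)
    (m : ℤ × ℤ × ℤ → ℤ) :
    Summable fun i ↦ a (e i).1 * (b (e i).2.1 * c (e i).2.2) * d (m i) := by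
  obtain ⟨M, hM⟩ := hd.exists_abs_le
  have h2 := summable_mul_of_summable_norm hb.norm hc.norm
  exact ((summable_mul_of_summable_norm ha.norm h2.norm).comp_injective he).bounded_mul
    fun i ↦ hM (m i)

/-- The summand of the lattice sum attached to the alternating trace of two coarse and two fine
factors. -/
noncomputable def alternatingSummand (H : ℝ) (i : ℤ × ℤ × ℤ) : ℝ :=
  rhoTilde H i.1 * rhoTilde H (i.1 - 2 * i.2.1) * rhoTilde H (i.2.2 - 2 * i.2.1)
    * rhoTilde H i.2.2

theorem summable_alternatingSummand (hH : H < 1) : Summable (alternatingSummand H) := by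
  have ht := summable_rhoTilde hH
  refine (summable_chain₃ ht ht ht ht (fun i ↦ (i.1, i.1 - 2 * i.2.1, i.2.2)) ?_
    fun i ↦ i.2.2 - 2 * i.2.1).congr fun i ↦ by simp only [alternatingSummand]; ring
  rintro ⟨a, b, c⟩ ⟨a', b', c'⟩ h
  simp only [Prod.mk.injEq] at h ⊢
  omega

/-- The two summands of `t11_22` are the values of `t12_12a` at points with even and with odd second
coordinate. -/
theorem t11_22_split (i : ℤ × ℤ × ℤ) : t11_22 H i =
    t12_12a H (i.1 - i.2.1, -2 * i.2.1, i.2.2 - 2 * i.2.1)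
      + t12_12a H (i.1 - i.2.1, -1 - 2 * i.2.1, i.2.2 - 1 - 2 * i.2.1) := by
  simp only [t11_22, t12_12a]
  rw [show 2 * (i.1 - i.2.1) - -2 * i.2.1 = 2 * i.1 by ring,
    show -2 * i.2.1 - (i.2.2 - 2 * i.2.1) = -i.2.2 by ring,
    show 2 * (i.1 - i.2.1) - (-1 - 2 * i.2.1) = 2 * i.1 + 1 by ring,
    show -1 - 2 * i.2.1 - (i.2.2 - 1 - 2 * i.2.1) = -i.2.2 by ring, rhoHat_neg,
    rhoTilde_sub_comm i.2.2, ← rhoTilde_neg (i.2.2 - 1 - 2 * i.2.1),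
    show -(i.2.2 - 1 - 2 * i.2.1) = 2 * i.2.1 - i.2.2 + 1 by ring]
  ring

theorem injective_evenEmb : Function.Injective
    fun i : ℤ × ℤ × ℤ ↦ (i.1 - i.2.1, -2 * i.2.1, i.2.2 - 2 * i.2.1) := by
  rintro ⟨a, b, c⟩ ⟨a', b', c'⟩ h
  simp only [Prod.mk.injEq] at h ⊢
  omega

theorem injective_oddEmb : Function.Injective
    fun i : ℤ × ℤ × ℤ ↦ (i.1 - i.2.1, -1 - 2 * i.2.1, i.2.2 - 1 - 2 * i.2.1) := by
  rintro ⟨a, b, c⟩ ⟨a', b', c'⟩ h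
  simp only [Prod.mk.injEq] at h ⊢
  omega

theorem latticeSummable (hH : H < 1) : LatticeSummable H := by
  have hr := summable_rhoHat hH
  have ht := summable_rhoTilde hH
  have h12a : Summable (t12_12a H) := by
    refine (summable_chain₃ hr ht hr ht (fun i ↦ (i.1, 2 * i.1 - i.2.1, i.2.1 - i.2.2)) ?_
      fun i ↦ i.2.2).congr fun i ↦ by simp only [t12_12a]; ring
    rintro ⟨a, b, c⟩ ⟨a', b', c'⟩ h
    simp only [Prod.mk.injEq] at h ⊢
    omega
  refine ⟨?_, ?_, ?_, ?_, ?_, ?_, ?_, ?_, ?_, h12a, ?_, ?_⟩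
  · obtain ⟨M, hM⟩ := hr.exists_abs_le
    have hi : Function.Injective fun i : ℕ ↦ ((i : ℤ) + 1) := fun a b h ↦ by
      simp only at h; omega
    exact ((hr.comp_injective hi).bounded_mul fun i ↦ hM (i + 1)).congr fun i ↦ by
      simp [s11, sq]
  · obtain ⟨M, hM⟩ := ht.exists_abs_le
    exact (ht.bounded_mul hM).congr fun i ↦ by simp [s12, sq]
  · refine (summable_chain₂ hr hr hr id Function.injective_id fun i ↦ i.1 - i.2).congr
      fun i ↦ by simp only [t1_11, id]; ring
  · refine (summable_chain₂ hr ht ht id Function.injective_id fun i ↦ i.2 - 2 * i.1).congr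
      fun i ↦ by simp only [t2_11, id]; ring
  · refine (summable_chain₂ hr ht ht id Function.injective_id fun i ↦ i.1 - i.2).congr
      fun i ↦ by simp only [t1_22, id]; ring
  · refine (summable_chain₃ hr hr hr hr (fun i ↦ (i.1, i.2.1 - i.2.2, i.2.2)) ?_
      fun i ↦ i.1 - i.2.1).congr fun i ↦ by simp only [t11_11]; ring
    rintro ⟨a, b, c⟩ ⟨a', b', c'⟩ h
    simp only [Prod.mk.injEq] at h ⊢
    omega
  · simp only [funext t11_22_split]
    exact (h12a.comp_injective injective_evenEmb).add (h12a.comp_injective injective_oddEmb)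
  · refine (summable_chain₃ hr ht hr ht (fun i ↦ (i.1, 2 * i.1 - i.2.1, i.2.2)) ?_
      fun i ↦ i.2.1 - 2 * i.2.2).congr fun i ↦ by simp only [t11_12]; ring
    rintro ⟨a, b, c⟩ ⟨a', b', c'⟩ h
    simp only [Prod.mk.injEq] at h ⊢
    omega
  · refine (summable_chain₃ hr hr ht ht (fun i ↦ (i.1, i.1 - i.2.1, i.2.1 - i.2.2)) ?_
      fun i ↦ i.2.2).congr fun i ↦ by simp only [t12_22]; ring
    rintro ⟨a, b, c⟩ ⟨a', b', c'⟩ h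
    simp only [Prod.mk.injEq] at h ⊢
    omega
  · refine (summable_chain₃ ht ht ht ht (fun i ↦ (2 * i.1, 2 * i.1 - i.2.1, 2 * i.2.2)) ?_
      fun i ↦ i.2.1 - 2 * i.2.2).congr fun i ↦ by simp only [t12_12b]; ring
    rintro ⟨a, b, c⟩ ⟨a', b', c'⟩ h
    simp only [Prod.mk.injEq] at h ⊢
    omega
  · refine (summable_chain₃ ht ht ht ht (fun i ↦ (2 * i.1 + 1, 2 * i.1 - i.2.1, 2 * i.2.2 + 1)) ?_
      fun i ↦ i.2.1 - 2 * i.2.2).congr fun i ↦ by simp only [t12_12c]; ring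
    rintro ⟨a, b, c⟩ ⟨a', b', c'⟩ h
    simp only [Prod.mk.injEq] at h ⊢
    omega

/-- A sum over `κ` splits along two injections of `ι` whose ranges partition `κ`. -/
theorem tsum_eq_tsum_add_tsum {ι κ : Type*} {F : κ → ℝ} (hF : Summable F) (e₀ e₁ : ι → κ)
    (he : Function.Bijective (Sum.elim e₀ e₁)) :
    ∑' i, F i = ∑' i, F (e₀ i) + ∑' i, F (e₁ i) := by
  rw [← (Equiv.ofBijective _ he).tsum_eq F]
  have h0 : Summable fun i ↦ F (e₀ i) :=
    hF.comp_injective fun a b h ↦ Sum.inl_injective (he.1 (by simpa using h))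
  have h1 : Summable fun i ↦ F (e₁ i) :=
    hF.comp_injective fun a b h ↦ Sum.inr_injective (he.1 (by simpa using h))
  exact (HasSum.sum h0.hasSum h1.hasSum).tsum_eq

/-- Splitting the fine index by parity identifies the two lattice sums attached to the
trace of two adjacent coarse and two adjacent fine factors. -/
theorem tsum_t11_22_eq (hH : H < 1) : ∑' i, t11_22 H i = ∑' i, t12_12a H i := by
  have h := (latticeSummable hH).t12_12a
  rw [tsum_eq_tsum_add_tsum h
    (fun i : ℤ × ℤ × ℤ ↦ (i.1 - i.2.1, -2 * i.2.1, i.2.2 - 2 * i.2.1))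
    (fun i : ℤ × ℤ × ℤ ↦ (i.1 - i.2.1, -1 - 2 * i.2.1, i.2.2 - 1 - 2 * i.2.1))]
  · exact (tsum_congr t11_22_split).trans
      ((h.comp_injective injective_evenEmb).tsum_add (h.comp_injective injective_oddEmb))
  · constructor
    · rintro (⟨a, b, c⟩ | ⟨a, b, c⟩) (⟨a', b', c'⟩ | ⟨a', b', c'⟩) h <;>
        simp only [Sum.elim_inl, Sum.elim_inr, Prod.mk.injEq] at h <;> grind
    · rintro ⟨x, y, z⟩
      rcases Int.even_or_odd' y with ⟨m, rfl | rfl⟩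
      · exact ⟨Sum.inl (x - m, -m, z - 2 * m), by simp⟩
      · exact ⟨Sum.inr (x - m - 1, -m - 1, z - 1 - 2 * m), by simp; omega⟩

/-- Splitting by the parity of the first fine index gives the two lattice sums with
`ρ̃(2 i₁)` and `ρ̃(2 i₁ + 1)`. -/
theorem tsum_alternatingSummand (hH : H < 1) :
    ∑' i, alternatingSummand H i = ∑' i, t12_12b H i + ∑' i, t12_12c H i := by
  rw [tsum_eq_tsum_add_tsum (summable_alternatingSummand hH)
    (fun i : ℤ × ℤ × ℤ ↦ (-2 * i.1, i.2.2 - i.1, i.2.1 - 2 * i.1))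
    (fun i : ℤ × ℤ × ℤ ↦ (-1 - 2 * i.1, i.2.2 - i.1, i.2.1 - 2 * i.1))]
  · congr 1
    · refine tsum_congr fun i ↦ ?_
      simp only [alternatingSummand, t12_12b]
      rw [show -2 * i.1 = -(2 * i.1) by ring, rhoTilde_neg,
        show -(2 * i.1) - 2 * (i.2.2 - i.1) = -(2 * i.2.2) by ring, rhoTilde_neg,
        show i.2.1 - 2 * i.1 - 2 * (i.2.2 - i.1) = i.2.1 - 2 * i.2.2 by ring,
        rhoTilde_sub_comm i.2.1 (2 * i.1)]
      ring
    · refine tsum_congr fun i ↦ ?_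
      simp only [alternatingSummand, t12_12c]
      rw [show -1 - 2 * i.1 = -(2 * i.1 + 1) by ring, rhoTilde_neg,
        show -(2 * i.1 + 1) - 2 * (i.2.2 - i.1) = -(2 * i.2.2 + 1) by ring, rhoTilde_neg,
        show i.2.1 - 2 * i.1 - 2 * (i.2.2 - i.1) = i.2.1 - 2 * i.2.2 by ring,
        rhoTilde_sub_comm i.2.1 (2 * i.1)]
      ring
  · constructor
    · rintro (⟨a, b, c⟩ | ⟨a, b, c⟩) (⟨a', b', c'⟩ | ⟨a', b', c'⟩) h <;>
        simp only [Sum.elim_inl, Sum.elim_inr, Prod.mk.injEq] at h <;> grind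
    · rintro ⟨x, y, z⟩
      rcases Int.even_or_odd' x with ⟨m, rfl | rfl⟩
      · exact ⟨Sum.inl (-m, z - 2 * m, y - m), by simp⟩
      · exact ⟨Sum.inr (-m - 1, z - 2 * m - 2, y - m - 1), by simp; omega⟩

theorem rhoHat_zero (h0 : 0 < H) : rhoHat H 0 = cH H := by
  simp [rhoHat, cH, Real.zero_rpow (by positivity : 2 * H ≠ 0)]
  ring

theorem tsum_rhoHat_sq (h0 : 0 < H) (hH : H < 1) :
    ∑' i : ℤ, rhoHat H i ^ 2 = cH H ^ 2 + 2 * ∑' i, s11 H i := by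
  have hs := (latticeSummable hH).s11
  have e : ∀ n : ℕ, rhoHat H (-((n : ℤ) + 1)) ^ 2 = s11 H n := fun n ↦ by rw [rhoHat_neg, s11]
  rw [tsum_of_add_one_of_neg_add_one (f := fun i : ℤ ↦ rhoHat H i ^ 2) hs
    (hs.congr fun n ↦ (e n).symm)]
  simp only [e]
  rw [rhoHat_zero h0]
  change (∑' n, s11 H n) + _ + _ = _
  ring

end Lattice

/-! ### Lattice sums as limits of averages over grids -/

/-- Averages of a translation-invariant summand over boxes converge to the lattice sum: `base` is
the position of an index tuple, `off` its shape relative to that position, `t` the summand, which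
depends on the shape only, and `A n` a box in which every shape occurs at all but a bounded number
of the positions `0, …, n`. -/
theorem tendsto_average_tsum {ι κ : Type*} {t : ι → ℝ} (ht : Summable t) (A : ℕ → Finset κ)
    (base : κ → ℤ) (off : κ → ι) (hinj : Function.Injective fun x ↦ (base x, off x))
    (hbase : ∀ n, ∀ x ∈ A n, base x ∈ Finset.Ioo (0 : ℤ) n)
    (hfill : ∀ i, ∃ C : ℕ, ∀ n : ℕ, ∀ k : ℤ, C ≤ k → k ≤ n - C →
      ∃ x ∈ A n, base x = k ∧ off x = i) :
    Tendsto (fun n : ℕ ↦ (∑ x ∈ A n, t (off x)) / n) atTop (𝓝 (∑' i, t i)) := by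
  classical
  -- `N n i` is the number of occurrences of the shape `i`, between `n - 2C` and `n`
  set N : ℕ → ι → ℕ := fun n i ↦ ((A n).filter fun x ↦ off x = i).card with hN
  have hsum : ∀ n : ℕ, (∑ x ∈ A n, t (off x)) / n = ∑' i, (N n i / n : ℝ) * t i := by
    intro n
    rw [Finset.sum_comp t off, tsum_eq_sum (s := (A n).image off), Finset.sum_div]
    · refine Finset.sum_congr rfl fun i _ ↦ ?_
      rw [nsmul_eq_mul]
      ring
    · intro i hi
      have : N n i = 0 := by
        rw [hN, Finset.card_eq_zero, Finset.filter_eq_empty_iff]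
        exact fun x hx h ↦ hi (Finset.mem_image.2 ⟨x, hx, h⟩)
      simp [this]
  have hle : ∀ n i, N n i ≤ n := by
    intro n i
    have h1 : (((A n).filter fun x ↦ off x = i).image base).card = N n i := by
      rw [Finset.card_image_of_injOn]
      intro x hx y hy hxy
      simp only [Finset.coe_filter, Set.mem_ofPred_eq] at hx hy
      exact hinj (by simp only [Prod.mk.injEq]; exact ⟨hxy, hx.2.trans hy.2.symm⟩)
    rw [← h1]
    refine (Finset.card_le_card (t := Finset.Ioo (0 : ℤ) n) ?_).trans (by simp)
    intro k hk
    obtain ⟨x, hx, rfl⟩ := Finset.mem_image.1 hk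
    exact hbase n x (Finset.mem_filter.1 hx).1
  have hge : ∀ i, ∃ C : ℕ, ∀ n : ℕ, (n : ℝ) - 2 * C ≤ N n i := by
    intro i
    obtain ⟨C, hC⟩ := hfill i
    refine ⟨C, fun n ↦ ?_⟩
    have h1 : (Finset.Icc (C : ℤ) (n - C)).card ≤ N n i := by
      refine (Finset.card_le_card (t := ((A n).filter fun x ↦ off x = i).image base) ?_).trans
        Finset.card_image_le
      intro k hk
      rw [Finset.mem_Icc] at hk
      obtain ⟨x, hx, hb, ho⟩ := hC n k hk.1 hk.2
      exact Finset.mem_image.2 ⟨x, Finset.mem_filter.2 ⟨hx, ho⟩, hb⟩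
    rw [Int.card_Icc] at h1
    have h2 : (n : ℤ) - 2 * C ≤ N n i := by omega
    exact_mod_cast h2
  simp only [hsum]
  refine tendsto_tsum_of_dominated_convergence (bound := fun i ↦ |t i|) ht.abs (fun i ↦ ?_)
    (Eventually.of_forall fun n i ↦ ?_)
  · obtain ⟨C, hC⟩ := hge i
    have h1 : Tendsto (fun n : ℕ ↦ (N n i / n : ℝ)) atTop (𝓝 1) := by
      have hl : Tendsto (fun n : ℕ ↦ 1 - 2 * C / (n : ℝ)) atTop (𝓝 1) := by
        simpa using (tendsto_const_div_atTop_nhds_zero_nat (2 * C : ℝ)).const_sub 1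
      refine tendsto_of_tendsto_of_tendsto_of_le_of_le' hl tendsto_const_nhds ?_ ?_
      · filter_upwards [eventually_gt_atTop 0] with n hn
        have hn' : (0 : ℝ) < n := by exact_mod_cast hn
        rw [one_sub_div hn'.ne']
        gcongr
        exact hC n
      · exact Eventually.of_forall fun n ↦
          div_le_one_of_le₀ (by exact_mod_cast hle n i) (Nat.cast_nonneg n)
    simpa using h1.mul_const (t i)
  · rw [norm_mul, Real.norm_eq_abs (t i)]
    refine mul_le_of_le_one_left (abs_nonneg _) ?_
    rw [Real.norm_of_nonneg (by positivity)]
    exact div_le_one_of_le₀ (by exact_mod_cast hle n i) (Nat.cast_nonneg n)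

/-- The interior indices `0 < j < m` of a grid with `m` cells. Integers are used so that differences
of indices are not truncated. -/
noncomputable def interior (m : ℕ) : Finset ℤ := Finset.Ioo 0 (m : ℤ)

theorem mem_interior {m : ℕ} {j : ℤ} : j ∈ interior m ↔ 0 < j ∧ j < m := Finset.mem_Ioo

section Limits

/-! In the names below, each digit `1` or `2` stands for an index running over the coarse or the
fine grid. Neighbouring indices of the closed chain are coupled by `ρ̂` if they lie on the same
grid, and by `ρ̃` otherwise. In each proof the shape of a chain is the tuple of summation indices of the
lattice sum, expressed through the differences of the indices of the chain. -/

variable {H : ℝ}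

theorem tendsto_sum_hat_hat (hH : H < 1) :
    Tendsto (fun n : ℕ ↦ (∑ j ∈ interior n, ∑ k ∈ interior n,
      rhoHat H (j - k) * rhoHat H (k - j)) / n) atTop (𝓝 (∑' i : ℤ, rhoHat H i ^ 2)) := by
  have hs : Summable fun i : ℤ ↦ rhoHat H i ^ 2 := by
    obtain ⟨M, hM⟩ := (summable_rhoHat hH).exists_abs_le
    exact ((summable_rhoHat hH).bounded_mul hM).congr fun i ↦ by simp [sq]
  refine (tendsto_average_tsum hs (fun n ↦ interior n ×ˢ interior n) (fun x ↦ x.1)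
    (fun x ↦ x.2 - x.1) ?_ ?_ fun i ↦ ⟨i.natAbs + 1, fun n k h1 h2 ↦ ⟨(k, i + k), ?_⟩⟩).congr
    fun n ↦ ?_
  · rintro ⟨a, b⟩ ⟨a', b'⟩ h
    simp only [Prod.mk.injEq] at h ⊢
    omega
  · intro n x hx
    exact (Finset.mem_product.1 hx).1
  · simp only [Finset.mem_product, mem_interior, true_and]
    omega
  · rw [Finset.sum_product]
    congr 1
    refine Finset.sum_congr rfl fun j _ ↦ Finset.sum_congr rfl fun k _ ↦ ?_
    rw [rhoHat_sub_comm j k, sq]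

theorem tendsto_sum_tilde_tilde (hH : H < 1) :
    Tendsto (fun n : ℕ ↦ (∑ j ∈ interior n, ∑ k ∈ interior (2 * n),
      rhoTilde H (k - 2 * j) * rhoTilde H (k - 2 * j)) / n) atTop (𝓝 (∑' i, s12 H i)) := by
  refine (tendsto_average_tsum (latticeSummable hH).s12 (fun n ↦ interior n ×ˢ interior (2 * n))
    (fun x ↦ x.1) (fun x ↦ x.2 - 2 * x.1) ?_ ?_
    fun i ↦ ⟨i.natAbs + 1, fun n k h1 h2 ↦ ⟨(k, i + 2 * k), ?_⟩⟩).congr fun n ↦ ?_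
  · rintro ⟨a, b⟩ ⟨a', b'⟩ h
    simp only [Prod.mk.injEq] at h ⊢
    omega
  · intro n x hx
    exact (Finset.mem_product.1 hx).1
  · simp only [Finset.mem_product, mem_interior, true_and]
    omega
  · rw [Finset.sum_product]
    simp only [s12, sq]

theorem tendsto_sum_111 (hH : H < 1) :
    Tendsto (fun n : ℕ ↦ (∑ j ∈ interior n, ∑ k ∈ interior n, ∑ l ∈ interior n,
      rhoHat H (j - k) * rhoHat H (k - l) * rhoHat H (l - j)) / n) atTop
      (𝓝 (∑' i, t1_11 H i)) := by
  refine (tendsto_average_tsum (latticeSummable hH).t1_11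
    (fun n ↦ interior n ×ˢ interior n ×ˢ interior n) (fun x ↦ x.1)
    (fun x ↦ (x.2.1 - x.1, x.2.2 - x.1)) ?_ ?_
    fun i ↦ ⟨i.1.natAbs + i.2.natAbs + 1,
      fun n k h1 h2 ↦ ⟨(k, i.1 + k, i.2 + k), ?_⟩⟩).congr fun n ↦ ?_
  · rintro ⟨a, b, c⟩ ⟨a', b', c'⟩ h
    simp only [Prod.mk.injEq] at h ⊢
    omega
  · intro n x hx
    exact (Finset.mem_product.1 hx).1
  · simp only [Finset.mem_product, mem_interior, add_sub_cancel_right, Prod.mk.eta, and_self,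
      and_true]
    omega
  · simp only [Finset.sum_product]
    congr 1
    refine Finset.sum_congr rfl fun j _ ↦ Finset.sum_congr rfl fun k _ ↦
      Finset.sum_congr rfl fun l _ ↦ ?_
    simp only [t1_11]
    rw [rhoHat_sub_comm j k]
    congr 3
    ring

/-- Two coarse factors and one fine factor. -/
theorem tendsto_sum_112 (hH : H < 1) :
    Tendsto (fun n : ℕ ↦ (∑ j ∈ interior n, ∑ k ∈ interior n, ∑ l ∈ interior (2 * n),
      rhoHat H (j - k) * rhoTilde H (l - 2 * k) * rhoTilde H (l - 2 * j)) / n) atTop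
      (𝓝 (∑' i, t2_11 H i)) := by
  refine (tendsto_average_tsum (latticeSummable hH).t2_11
    (fun n ↦ interior n ×ˢ interior n ×ˢ interior (2 * n)) (fun x ↦ x.1)
    (fun x ↦ (x.2.1 - x.1, x.2.2 - 2 * x.1)) ?_ ?_
    fun i ↦ ⟨i.1.natAbs + i.2.natAbs + 1,
      fun n k h1 h2 ↦ ⟨(k, i.1 + k, i.2 + 2 * k), ?_⟩⟩).congr fun n ↦ ?_
  · rintro ⟨a, b, c⟩ ⟨a', b', c'⟩ h
    simp only [Prod.mk.injEq] at h ⊢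
    omega
  · intro n x hx
    exact (Finset.mem_product.1 hx).1
  · simp only [Finset.mem_product, mem_interior, add_sub_cancel_right, Prod.mk.eta, and_self,
      and_true]
    omega
  · simp only [Finset.sum_product]
    congr 1
    refine Finset.sum_congr rfl fun j _ ↦ Finset.sum_congr rfl fun k _ ↦
      Finset.sum_congr rfl fun l _ ↦ ?_
    simp only [t2_11]
    rw [rhoHat_sub_comm j k]
    congr 3
    ring

/-- One coarse factor and two fine factors. -/
theorem tendsto_sum_122 (hH : H < 1) :
    Tendsto (fun n : ℕ ↦ (∑ j ∈ interior n, ∑ k ∈ interior (2 * n), ∑ l ∈ interior (2 * n),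
      rhoTilde H (k - 2 * j) * rhoHat H (k - l) * rhoTilde H (l - 2 * j)) / n) atTop
      (𝓝 (∑' i, t1_22 H i)) := by
  refine (tendsto_average_tsum (latticeSummable hH).t1_22
    (fun n ↦ interior n ×ˢ interior (2 * n) ×ˢ interior (2 * n)) (fun x ↦ x.1)
    (fun x ↦ (x.2.1 - x.2.2, 2 * x.1 - x.2.2)) ?_ ?_
    fun i ↦ ⟨i.1.natAbs + i.2.natAbs + 1,
      fun n k h1 h2 ↦ ⟨(k, i.1 - i.2 + 2 * k, 2 * k - i.2), ?_⟩⟩).congr fun n ↦ ?_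
  · rintro ⟨a, b, c⟩ ⟨a', b', c'⟩ h
    simp only [Prod.mk.injEq] at h ⊢
    omega
  · intro n x hx
    exact (Finset.mem_product.1 hx).1
  · obtain ⟨a, b⟩ := i
    simp only [Finset.mem_product, mem_interior, Prod.mk.injEq, true_and]
    dsimp only at h1 h2
    omega
  · simp only [Finset.sum_product]
    congr 1
    refine Finset.sum_congr rfl fun j _ ↦ Finset.sum_congr rfl fun k _ ↦
      Finset.sum_congr rfl fun l _ ↦ ?_
    simp only [t1_22]
    rw [rhoTilde_sub_comm (2 * j) l, show k - l - (2 * j - l) = k - 2 * j by ring]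
    ring

theorem tendsto_sum_1111 (hH : H < 1) :
    Tendsto (fun n : ℕ ↦ (∑ j ∈ interior n, ∑ k ∈ interior n, ∑ l ∈ interior n,
      ∑ p ∈ interior n,
      rhoHat H (j - k) * rhoHat H (k - l) * rhoHat H (l - p) * rhoHat H (p - j)) / n) atTop
      (𝓝 (∑' i, t11_11 H i)) := by
  refine (tendsto_average_tsum (latticeSummable hH).t11_11
    (fun n ↦ interior n ×ˢ interior n ×ˢ interior n ×ˢ interior n) (fun x ↦ x.1)
    (fun x ↦ (x.2.1 - x.1, x.2.2.1 - x.1, x.2.2.2 - x.1)) ?_ ?_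
    fun i ↦ ⟨i.1.natAbs + i.2.1.natAbs + i.2.2.natAbs + 1,
      fun n k h1 h2 ↦ ⟨(k, i.1 + k, i.2.1 + k, i.2.2 + k), ?_⟩⟩).congr fun n ↦ ?_
  · rintro ⟨a, b, c, d⟩ ⟨a', b', c', d'⟩ h
    simp only [Prod.mk.injEq] at h ⊢
    omega
  · intro n x hx
    exact (Finset.mem_product.1 hx).1
  · simp only [Finset.mem_product, mem_interior, add_sub_cancel_right, Prod.mk.eta, and_self,
      and_true]
    omega
  · simp only [Finset.sum_product]
    congr 1
    refine Finset.sum_congr rfl fun j _ ↦ Finset.sum_congr rfl fun k _ ↦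
      Finset.sum_congr rfl fun l _ ↦ Finset.sum_congr rfl fun p _ ↦ ?_
    simp only [t11_11, sub_sub_sub_cancel_right]
    rw [rhoHat_sub_comm j k]

/-- Three coarse factors and one fine factor. -/
theorem tendsto_sum_1112 (hH : H < 1) :
    Tendsto (fun n : ℕ ↦ (∑ j ∈ interior n, ∑ k ∈ interior n, ∑ l ∈ interior (2 * n),
      ∑ p ∈ interior n,
      rhoHat H (j - k) * rhoTilde H (l - 2 * k) * rhoTilde H (l - 2 * p) * rhoHat H (p - j)) / n)
      atTop (𝓝 (∑' i, t11_12 H i)) := by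
  refine (tendsto_average_tsum (latticeSummable hH).t11_12
    (fun n ↦ interior n ×ˢ interior n ×ˢ interior (2 * n) ×ˢ interior n) (fun x ↦ x.1)
    (fun x ↦ (x.2.1 - x.1, x.2.2.1 - 2 * x.1, x.2.2.2 - x.1)) ?_ ?_
    fun i ↦ ⟨i.1.natAbs + i.2.1.natAbs + i.2.2.natAbs + 1,
      fun n k h1 h2 ↦ ⟨(k, i.1 + k, i.2.1 + 2 * k, i.2.2 + k), ?_⟩⟩).congr fun n ↦ ?_
  · rintro ⟨a, b, c, d⟩ ⟨a', b', c', d'⟩ h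
    simp only [Prod.mk.injEq] at h ⊢
    omega
  · intro n x hx
    exact (Finset.mem_product.1 hx).1
  · simp only [Finset.mem_product, mem_interior, add_sub_cancel_right, Prod.mk.eta, and_self,
      and_true]
    omega
  · simp only [Finset.sum_product]
    congr 1
    refine Finset.sum_congr rfl fun j _ ↦ Finset.sum_congr rfl fun k _ ↦
      Finset.sum_congr rfl fun l _ ↦ Finset.sum_congr rfl fun p _ ↦ ?_
    simp only [t11_12]
    rw [rhoHat_sub_comm j k, show 2 * (k - j) - (l - 2 * j) = 2 * k - l by ring,
      rhoTilde_sub_comm l (2 * k), show l - 2 * j - 2 * (p - j) = l - 2 * p by ring]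

/-- One coarse factor and three fine factors. -/
theorem tendsto_sum_1222 (hH : H < 1) :
    Tendsto (fun n : ℕ ↦ (∑ j ∈ interior n, ∑ k ∈ interior (2 * n), ∑ l ∈ interior (2 * n),
      ∑ p ∈ interior (2 * n),
      rhoTilde H (k - 2 * j) * rhoHat H (k - l) * rhoHat H (l - p) * rhoTilde H (p - 2 * j)) / n)
      atTop (𝓝 (∑' i, t12_22 H i)) := by
  refine (tendsto_average_tsum (latticeSummable hH).t12_22
    (fun n ↦ interior n ×ˢ interior (2 * n) ×ˢ interior (2 * n) ×ˢ interior (2 * n))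
    (fun x ↦ x.1)
    (fun x ↦ (x.2.2.1 - x.2.2.2, x.2.1 - x.2.2.2, 2 * x.1 - x.2.2.2)) ?_ ?_
    fun i ↦ ⟨i.1.natAbs + i.2.1.natAbs + i.2.2.natAbs + 1,
      fun n k h1 h2 ↦ ⟨(k, i.2.1 - i.2.2 + 2 * k, i.1 - i.2.2 + 2 * k, 2 * k - i.2.2),
        ?_⟩⟩).congr fun n ↦ ?_
  · rintro ⟨a, b, c, d⟩ ⟨a', b', c', d'⟩ h
    simp only [Prod.mk.injEq] at h ⊢
    omega
  · intro n x hx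
    exact (Finset.mem_product.1 hx).1
  · obtain ⟨a, b, c⟩ := i
    simp only [Finset.mem_product, mem_interior, Prod.mk.injEq, true_and]
    dsimp only at h1 h2
    omega
  · simp only [Finset.sum_product]
    congr 1
    refine Finset.sum_congr rfl fun j _ ↦ Finset.sum_congr rfl fun k _ ↦
      Finset.sum_congr rfl fun l _ ↦ Finset.sum_congr rfl fun p _ ↦ ?_
    simp only [t12_22, sub_sub_sub_cancel_right]
    rw [rhoHat_sub_comm k l, rhoTilde_sub_comm p (2 * j)]
    ring

/-- Two adjacent coarse factors and two adjacent fine factors. -/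
theorem tendsto_sum_1122 (hH : H < 1) :
    Tendsto (fun n : ℕ ↦ (∑ j ∈ interior n, ∑ k ∈ interior n, ∑ l ∈ interior (2 * n),
      ∑ p ∈ interior (2 * n),
      rhoHat H (j - k) * rhoTilde H (l - 2 * k) * rhoHat H (l - p) * rhoTilde H (p - 2 * j)) / n)
      atTop (𝓝 (∑' i, t12_12a H i)) := by
  refine (tendsto_average_tsum (latticeSummable hH).t12_12a
    (fun n ↦ interior n ×ˢ interior n ×ˢ interior (2 * n) ×ˢ interior (2 * n)) (fun x ↦ x.1)
    (fun x ↦ (x.2.1 - x.1, x.2.2.1 - 2 * x.1, x.2.2.2 - 2 * x.1)) ?_ ?_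
    fun i ↦ ⟨i.1.natAbs + i.2.1.natAbs + i.2.2.natAbs + 1,
      fun n k h1 h2 ↦ ⟨(k, i.1 + k, i.2.1 + 2 * k, i.2.2 + 2 * k), ?_⟩⟩).congr fun n ↦ ?_
  · rintro ⟨a, b, c, d⟩ ⟨a', b', c', d'⟩ h
    simp only [Prod.mk.injEq] at h ⊢
    omega
  · intro n x hx
    exact (Finset.mem_product.1 hx).1
  · simp only [Finset.mem_product, mem_interior, add_sub_cancel_right, Prod.mk.eta, and_self,
      and_true]
    omega
  · simp only [Finset.sum_product]
    congr 1
    refine Finset.sum_congr rfl fun j _ ↦ Finset.sum_congr rfl fun k _ ↦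
      Finset.sum_congr rfl fun l _ ↦ Finset.sum_congr rfl fun p _ ↦ ?_
    simp only [t12_12a, sub_sub_sub_cancel_right]
    rw [rhoHat_sub_comm j k, show 2 * (k - j) - (l - 2 * j) = 2 * k - l by ring,
      rhoTilde_sub_comm l (2 * k)]

/-- Coarse and fine factors in alternation. -/
theorem tendsto_sum_1212 (hH : H < 1) :
    Tendsto (fun n : ℕ ↦ (∑ j ∈ interior n, ∑ k ∈ interior (2 * n), ∑ l ∈ interior n,
      ∑ p ∈ interior (2 * n), rhoTilde H (k - 2 * j) * rhoTilde H (k - 2 * l)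
        * rhoTilde H (p - 2 * l) * rhoTilde H (p - 2 * j)) / n)
      atTop (𝓝 (∑' i, alternatingSummand H i)) := by
  refine (tendsto_average_tsum (summable_alternatingSummand hH)
    (fun n ↦ interior n ×ˢ interior (2 * n) ×ˢ interior n ×ˢ interior (2 * n)) (fun x ↦ x.1)
    (fun x ↦ (x.2.1 - 2 * x.1, x.2.2.1 - x.1, x.2.2.2 - 2 * x.1)) ?_ ?_
    fun i ↦ ⟨i.1.natAbs + i.2.1.natAbs + i.2.2.natAbs + 1,
      fun n k h1 h2 ↦ ⟨(k, i.1 + 2 * k, i.2.1 + k, i.2.2 + 2 * k), ?_⟩⟩).congr fun n ↦ ?_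
  · rintro ⟨a, b, c, d⟩ ⟨a', b', c', d'⟩ h
    simp only [Prod.mk.injEq] at h ⊢
    omega
  · intro n x hx
    exact (Finset.mem_product.1 hx).1
  · simp only [Finset.mem_product, mem_interior, add_sub_cancel_right, Prod.mk.eta, and_self,
      and_true]
    omega
  · simp only [Finset.sum_product]
    congr 1
    refine Finset.sum_congr rfl fun j _ ↦ Finset.sum_congr rfl fun k _ ↦
      Finset.sum_congr rfl fun l _ ↦ Finset.sum_congr rfl fun p _ ↦ ?_
    simp only [alternatingSummand]
    rw [show k - 2 * j - 2 * (l - j) = k - 2 * l by ring,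
      show p - 2 * j - 2 * (l - j) = p - 2 * l by ring]

end Limits

/-! ### Gram matrices of the second differences -/

section Gram

variable {H T : ℝ} [Fact (H ∈ Set.Ioo (0 : ℝ) 1)]

/-- The vector `1_{j+1}^m - 1_j^m`, indexed by integers; only indices `0 < j < m` matter. -/
noncomputable def gridVec (H T : ℝ) [Fact (H ∈ Set.Ioo (0 : ℝ) 1)] (m : ℕ) (j : ℤ) :
    FbmHilbert H T :=
  cell H T m (j.toNat + 1) - cell H T m j.toNat

/-- The terms of the covariance depending on one variable only cancel in second differences. -/
theorem inner_secondDiff_indH {s t δ ε : ℝ} (h1 : 0 ≤ s - δ) (h2 : s + δ ≤ T) (h3 : 0 ≤ δ)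
    (h4 : 0 ≤ t - ε) (h5 : t + ε ≤ T) (h6 : 0 ≤ ε) :
    inner ℝ (indH H T (s + δ) - (2 : ℝ) • indH H T s + indH H T (s - δ))
      (indH H T (t + ε) - (2 : ℝ) • indH H T t + indH H T (t - ε)) =
    -1 / 2 * (|s + δ - (t + ε)| ^ (2 * H) - 2 * |s + δ - t| ^ (2 * H)
      + |s + δ - (t - ε)| ^ (2 * H) - 2 * |s - (t + ε)| ^ (2 * H) + 4 * |s - t| ^ (2 * H)
      - 2 * |s - (t - ε)| ^ (2 * H) + |s - δ - (t + ε)| ^ (2 * H) - 2 * |s - δ - t| ^ (2 * H)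
      + |s - δ - (t - ε)| ^ (2 * H)) := by
  have m1 : s + δ ∈ Set.Icc 0 T := ⟨by linarith, h2⟩
  have m2 : s ∈ Set.Icc 0 T := ⟨by linarith, by linarith⟩
  have m3 : s - δ ∈ Set.Icc 0 T := ⟨h1, by linarith⟩
  have m4 : t + ε ∈ Set.Icc 0 T := ⟨by linarith, h5⟩
  have m5 : t ∈ Set.Icc 0 T := ⟨by linarith, by linarith⟩
  have m6 : t - ε ∈ Set.Icc 0 T := ⟨h4, by linarith⟩
  simp only [inner_add_left, inner_sub_left, inner_add_right, inner_sub_right,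
    real_inner_smul_left, real_inner_smul_right, inner_indH H T m1 m4, inner_indH H T m1 m5,
    inner_indH H T m1 m6, inner_indH H T m2 m4, inner_indH H T m2 m5, inner_indH H T m2 m6,
    inner_indH H T m3 m4, inner_indH H T m3 m5, inner_indH H T m3 m6, fbmCov,
    abs_sub_comm (t + ε), abs_sub_comm (t - ε), abs_sub_comm t]
  ring

theorem gridVec_eq {m : ℕ} {j : ℤ} (hj : j ∈ interior m) :
    gridVec H T m j = indH H T (j * (T / m) + T / m) - (2 : ℝ) • indH H T (j * (T / m))
      + indH H T (j * (T / m) - T / m) := by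
  obtain ⟨h0, -⟩ := mem_interior.1 hj
  lift j to ℕ using h0.le
  have h1 : 1 ≤ j := by omega
  have e1 : grid T m (j + 1) = j * (T / m) + T / m := by
    rw [grid]; push_cast; ring
  have e2 : grid T m j = j * (T / m) := by rw [grid]; ring
  have e3 : grid T m (j - 1) = j * (T / m) - T / m := by
    rw [grid, Nat.cast_sub h1]; push_cast; ring
  rw [gridVec, cell, cell, Int.toNat_natCast, Nat.add_sub_cancel, e1, e2, e3, Int.cast_natCast]
  module

theorem abs_mul_rpow (x : ℝ) {h : ℝ} (hh : 0 ≤ h) (q : ℝ) : |x * h| ^ q = h ^ q * |x| ^ q := by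
  rw [abs_mul, abs_of_nonneg hh, Real.mul_rpow (abs_nonneg _) hh, mul_comm]

theorem grid_bounds (hT : 0 < T) {m : ℕ} {j : ℤ} (hj : j ∈ interior m) :
    0 ≤ j * (T / m) - T / m ∧ j * (T / m) + T / m ≤ T ∧ 0 ≤ T / m := by
  obtain ⟨h0, h1⟩ := mem_interior.1 hj
  have hm : (0 : ℝ) < m := by
    have : (0 : ℤ) < m := h0.trans h1
    exact_mod_cast this
  have hh : 0 < T / m := by positivity
  have ha : (1 : ℝ) ≤ j := by exact_mod_cast h0
  have hb : (j : ℝ) + 1 ≤ m := by exact_mod_cast h1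
  have hT' : (m : ℝ) * (T / m) = T := by field_simp
  refine ⟨by nlinarith, ?_, hh.le⟩
  calc (j : ℝ) * (T / m) + T / m = (j + 1) * (T / m) := by ring
    _ ≤ m * (T / m) := by gcongr
    _ = T := hT'

theorem inner_gridVec (hT : 0 < T) {m : ℕ} {j k : ℤ} (hj : j ∈ interior m)
    (hk : k ∈ interior m) :
    inner ℝ (gridVec H T m j) (gridVec H T m k) = (T / m) ^ (2 * H) * rhoHat H (j - k) := by
  obtain ⟨a1, a2, a3⟩ := grid_bounds hT hj
  obtain ⟨b1, b2, -⟩ := grid_bounds hT hk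
  rw [gridVec_eq hj, gridVec_eq hk, inner_secondDiff_indH a1 a2 a3 b1 b2 a3, rhoHat]
  set h := T / m
  set x := (j : ℝ)
  set y := (k : ℝ)
  push_cast
  rw [show x * h + h - (y * h + h) = (x - y) * h by ring,
    show x * h + h - y * h = (x - y + 1) * h by ring,
    show x * h + h - (y * h - h) = (x - y + 2) * h by ring,
    show x * h - (y * h + h) = (x - y - 1) * h by ring,
    show x * h - y * h = (x - y) * h by ring,
    show x * h - (y * h - h) = (x - y + 1) * h by ring,
    show x * h - h - (y * h + h) = (x - y - 2) * h by ring,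
    show x * h - h - y * h = (x - y - 1) * h by ring,
    show x * h - h - (y * h - h) = (x - y) * h by ring]
  simp only [abs_mul_rpow _ a3]
  ring

/-- The Gram matrix between the coarse and the fine grid. A coarse index `j` sits at the fine index
`2 * j`. -/
theorem inner_gridVec_two_mul (hT : 0 < T) {n : ℕ} {j k : ℤ} (hj : j ∈ interior n)
    (hk : k ∈ interior (2 * n)) :
    inner ℝ (gridVec H T n j) (gridVec H T (2 * n) k) =
      (T / n) ^ (2 * H) * rhoTilde H (k - 2 * j) := by
  obtain ⟨a1, a2, a3⟩ := grid_bounds hT hj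
  obtain ⟨b1, b2, b3⟩ := grid_bounds hT hk
  have hh : T / n = 2 * (T / (2 * n : ℕ)) := by
    push_cast
    rw [← div_div, mul_div_assoc', mul_div_cancel₀ T (two_ne_zero' ℝ)]
  rw [gridVec_eq hj, gridVec_eq hk, inner_secondDiff_indH a1 a2 a3 b1 b2 b3, rhoTilde, hh,
    Real.mul_rpow zero_le_two b3, Real.rpow_add two_pos, Real.rpow_one]
  set h := T / (2 * n : ℕ)
  set x := (j : ℝ)
  set y := (k : ℝ)
  have h2 : (2 : ℝ) ^ (2 * H) ≠ 0 := (Real.rpow_pos_of_pos two_pos _).ne'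
  push_cast
  rw [show x * (2 * h) + 2 * h - (y * h + h) = -(y - 2 * x - 1) * h by ring,
    show x * (2 * h) + 2 * h - y * h = -(y - 2 * x - 2) * h by ring,
    show x * (2 * h) + 2 * h - (y * h - h) = -(y - 2 * x - 3) * h by ring,
    show x * (2 * h) - (y * h + h) = -(y - 2 * x + 1) * h by ring,
    show x * (2 * h) - y * h = -(y - 2 * x) * h by ring,
    show x * (2 * h) - (y * h - h) = -(y - 2 * x - 1) * h by ring,
    show x * (2 * h) - 2 * h - (y * h + h) = -(y - 2 * x + 3) * h by ring,
    show x * (2 * h) - 2 * h - y * h = -(y - 2 * x + 2) * h by ring,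
    show x * (2 * h) - 2 * h - (y * h - h) = -(y - 2 * x + 1) * h by ring]
  simp only [abs_mul_rpow _ b3, abs_neg]
  field_simp
  ring

end Gram

section Expectation

variable {H T : ℝ} [hH : Fact (H ∈ Set.Ioo (0 : ℝ) 1)]
  {Ω : Type*} [MeasurableSpace Ω] {P : Measure Ω}

theorem integrable_sq_map (W : FbmHilbert H T →ₗᵢ[ℝ] Lp ℝ 2 P) (h : FbmHilbert H T) :
    Integrable (fun ω ↦ W h ω ^ 2) P := (Lp.memLp (W h)).integrable_sq

theorem integral_sq_map (W : FbmHilbert H T →ₗᵢ[ℝ] Lp ℝ 2 P) (h : FbmHilbert H T) :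
    ∫ ω, W h ω ^ 2 ∂P = ‖h‖ ^ 2 := by
  rw [← W.norm_map h, ← real_inner_self_eq_norm_sq (W h), L2.inner_def]
  simp [sq]

theorem ae_secondDiff_eq (W : FbmHilbert H T →ₗᵢ[ℝ] Lp ℝ 2 P) {m j : ℕ} :
    ∀ᵐ ω ∂P, secondDiff W m j ω = W (gridVec H T m j) ω := by
  have e : gridVec H T m j = (indH H T (grid T m (j + 1)) - indH H T (grid T m j))
      - (indH H T (grid T m j) - indH H T (grid T m (j - 1))) := by
    simp [gridVec, cell]
  rw [e, map_sub, map_sub, map_sub]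
  filter_upwards [Lp.coeFn_sub (W (indH H T (grid T m (j + 1))) - W (indH H T (grid T m j)))
      (W (indH H T (grid T m j)) - W (indH H T (grid T m (j - 1)))),
    Lp.coeFn_sub (W (indH H T (grid T m (j + 1)))) (W (indH H T (grid T m j))),
    Lp.coeFn_sub (W (indH H T (grid T m j))) (W (indH H T (grid T m (j - 1))))] with ω h1 h2 h3
  rw [h1, Pi.sub_apply, h2, h3, Pi.sub_apply, Pi.sub_apply, secondDiff, fbm, fbm, fbm]
  ring

theorem sum_Ico_eq_sum_interior {M : Type*} [AddCommMonoid M] (m : ℕ) (f : ℕ → M) :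
    ∑ j ∈ Finset.Ico 1 m, f j = ∑ j ∈ interior m, f j.toNat := by
  refine Finset.sum_bij' (fun j _ ↦ (j : ℤ)) (fun j _ ↦ j.toNat) ?_ ?_ ?_ ?_ ?_
  · intro j hj
    rw [Finset.mem_Ico] at hj
    rw [mem_interior]
    omega
  · intro j hj
    rw [mem_interior] at hj
    rw [Finset.mem_Ico]
    omega
  · simp
  · intro j hj
    rw [mem_interior] at hj
    exact Int.toNat_of_nonneg hj.1.le
  · simp

theorem integral_quadVar (hT : 0 < T) (W : FbmHilbert H T →ₗᵢ[ℝ] Lp ℝ 2 P) {m : ℕ}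
    (hm : 1 ≤ m) :
    ∫ ω, quadVar W m ω ∂P = (m - 1) * (T / m) ^ (2 * H) * cH H := by
  have h1 : ∀ j, ∫ ω, secondDiff W m j ω ^ 2 ∂P = ‖gridVec H T m j‖ ^ 2 := fun j ↦ by
    rw [← integral_sq_map W]
    refine integral_congr_ae ?_
    filter_upwards [ae_secondDiff_eq W (m := m) (j := j)] with ω h
    rw [h]
  have h2 : ∀ j, Integrable (fun ω ↦ secondDiff W m j ω ^ 2) P := fun j ↦ by
    refine (integrable_sq_map W (gridVec H T m j)).congr ?_
    filter_upwards [ae_secondDiff_eq W (m := m) (j := j)] with ω h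
    rw [h]
  simp only [quadVar]
  rw [integral_finsetSum _ fun j _ ↦ h2 j]
  have h3 : ∀ j ∈ Finset.Ico 1 m, ∫ ω, secondDiff W m j ω ^ 2 ∂P = (T / m) ^ (2 * H) * cH H := by
    intro j hj
    rw [Finset.mem_Ico] at hj
    have hj' : (j : ℤ) ∈ interior m := by rw [mem_interior]; omega
    rw [h1, ← real_inner_self_eq_norm_sq, inner_gridVec hT hj' hj', sub_self,
      rhoHat_zero hH.out.1]
  rw [Finset.sum_congr rfl h3, Finset.sum_const, Nat.card_Ico, nsmul_eq_mul, Nat.cast_sub hm]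
  push_cast
  ring

/-- The tensor `∑_{j=1}^{m-1} (1_{j+1}^m - 1_j^m)^{⊗2}`. -/
noncomputable def gridTensor (H T : ℝ) [Fact (H ∈ Set.Ioo (0 : ℝ) 1)] (m : ℕ) :
    FbmHilbert H T ⊗[ℝ] FbmHilbert H T :=
  ∑ j ∈ interior m, gridVec H T m j ⊗ₜ[ℝ] gridVec H T m j

/-- The scalar factor of the kernel `f_n^{[α]}`. -/
noncomputable def weight (H T : ℝ) (α n : ℕ) : ℝ :=
  √(n : ℝ) / (((α * n : ℕ) - 1) * (T / (α * n : ℕ)) ^ (2 * H) * cH H)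

theorem kernel_eq (hT : 0 < T) (W : FbmHilbert H T →ₗᵢ[ℝ] Lp ℝ 2 P) {α n : ℕ}
    (hm : 1 ≤ α * n) : kernel W α n = weight H T α n • gridTensor H T (α * n) := by
  rw [kernel, integral_quadVar hT W hm, sum_Ico_eq_sum_interior]
  rfl

theorem comm_kernel (W : FbmHilbert H T →ₗᵢ[ℝ] Lp ℝ 2 P) (α n : ℕ) :
    TensorProduct.comm ℝ _ _ (kernel W α n) = kernel W α n := by
  simp [kernel, map_sum]

end Expectation

section TraceFormulas

variable {E : Type*} [NormedAddCommGroup E] [InnerProductSpace ℝ E] {ι : Type*}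

theorem inner_sum_tmul (s t : Finset ι) (v u : ι → E) :
    inner ℝ (∑ j ∈ s, v j ⊗ₜ[ℝ] v j) (∑ k ∈ t, u k ⊗ₜ[ℝ] u k) =
      ∑ j ∈ s, ∑ k ∈ t, inner ℝ (v j) (u k) * inner ℝ (u k) (v j) := by
  simp only [sum_inner, inner_sum, TensorProduct.inner_tmul]
  rw [Finset.sum_comm]
  simp only [real_inner_comm]

theorem contr₁_sum_tmul (s t : Finset ι) (v u : ι → E) :
    contr₁ (∑ j ∈ s, v j ⊗ₜ[ℝ] v j) (∑ k ∈ t, u k ⊗ₜ[ℝ] u k) =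
      ∑ j ∈ s, ∑ k ∈ t, (inner ℝ (v j) (u k) : ℝ) • (v j ⊗ₜ[ℝ] u k) := by
  simp only [map_sum, LinearMap.sum_apply, contr₁_tmul]
  rw [Finset.sum_comm]

theorem inner_sum_tmul_contr₁ (s t r : Finset ι) (v u w : ι → E) :
    inner ℝ (∑ j ∈ s, v j ⊗ₜ[ℝ] v j)
      (contr₁ (∑ k ∈ t, u k ⊗ₜ[ℝ] u k) (∑ l ∈ r, w l ⊗ₜ[ℝ] w l)) =
      ∑ j ∈ s, ∑ k ∈ t, ∑ l ∈ r,
        inner ℝ (v j) (u k) * inner ℝ (u k) (w l) * inner ℝ (w l) (v j) := by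
  rw [contr₁_sum_tmul, sum_inner]
  refine Finset.sum_congr rfl fun j _ ↦ ?_
  rw [inner_sum]
  refine Finset.sum_congr rfl fun k _ ↦ ?_
  rw [inner_sum]
  refine Finset.sum_congr rfl fun l _ ↦ ?_
  rw [tensor_inner_smul_right, TensorProduct.inner_tmul, real_inner_comm (w l) (v j)]
  ring

theorem inner_contr₁_sum_tmul (s t r q : Finset ι) (v u w y : ι → E) :
    inner ℝ (contr₁ (∑ j ∈ s, v j ⊗ₜ[ℝ] v j) (∑ p ∈ q, y p ⊗ₜ[ℝ] y p))
      (contr₁ (∑ k ∈ t, u k ⊗ₜ[ℝ] u k) (∑ l ∈ r, w l ⊗ₜ[ℝ] w l)) =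
      ∑ j ∈ s, ∑ k ∈ t, ∑ l ∈ r, ∑ p ∈ q,
        inner ℝ (v j) (u k) * inner ℝ (u k) (w l) * inner ℝ (w l) (y p)
          * inner ℝ (y p) (v j) := by
  rw [contr₁_sum_tmul, contr₁_sum_tmul, sum_inner]
  refine Finset.sum_congr rfl fun j _ ↦ ?_
  rw [inner_sum]
  refine Finset.sum_congr rfl fun k _ ↦ ?_
  rw [inner_sum]
  refine Finset.sum_congr rfl fun l _ ↦ ?_
  rw [sum_inner]
  refine Finset.sum_congr rfl fun p _ ↦ ?_
  rw [tensor_inner_smul_right, tensor_inner_smul_left, TensorProduct.inner_tmul,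
    real_inner_comm (w l) (y p), real_inner_comm (v j) (y p)]
  ring

end TraceFormulas

/-! ### Symmetries of the traces -/

section TraceSymmetries

variable {E : Type*} [NormedAddCommGroup E] [InnerProductSpace ℝ E] {f g : E ⊗[ℝ] E}

/-- Cyclicity of the trace `tr(aᵗ b cᵗ)`, read as an inner product. -/
theorem inner_contr₁_left_comm (a b c : E ⊗[ℝ] E) :
    inner ℝ a (contr₁ b c) = inner ℝ b (contr₁ a (TensorProduct.comm ℝ E E c)) := by
  induction a with
  | zero => simp
  | add a a' ha ha' => simp [inner_add_left, inner_add_right, ha, ha']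
  | tmul a₁ a₂ =>
    induction b with
    | zero => simp
    | add b b' hb hb' => simp [inner_add_left, inner_add_right, hb, hb']
    | tmul b₁ b₂ =>
      induction c with
      | zero => simp
      | add c c' hc hc' => simp [inner_add_right, hc, hc']
      | tmul c₁ c₂ =>
        rw [TensorProduct.comm_tmul, contr₁_tmul, contr₁_tmul, tensor_inner_smul_right,
          tensor_inner_smul_right, TensorProduct.inner_tmul, TensorProduct.inner_tmul,
          real_inner_comm a₁ b₁]
        ring

/-- Cyclicity of the trace of a word of length four, read as an inner product. -/
theorem inner_contr₁_contr₁_comm (a b c d : E ⊗[ℝ] E) :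
    inner ℝ (contr₁ a b) (contr₁ c d) =
      inner ℝ (contr₁ (TensorProduct.comm ℝ E E a) (TensorProduct.comm ℝ E E c))
        (contr₁ (TensorProduct.comm ℝ E E b) (TensorProduct.comm ℝ E E d)) := by
  induction a with
  | zero => simp
  | add a a' ha ha' => simp [inner_add_left, ha, ha']
  | tmul a₁ a₂ =>
    induction b with
    | zero => simp
    | add b b' hb hb' => simp [inner_add_left, inner_add_right, hb, hb']
    | tmul b₁ b₂ =>
      induction c with
      | zero => simp
      | add c c' hc hc' => simp [inner_add_left, inner_add_right, hc, hc']
      | tmul c₁ c₂ =>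
        induction d with
        | zero => simp
        | add d d' hd hd' => simp [inner_add_right, hd, hd']
        | tmul d₁ d₂ =>
          simp only [TensorProduct.comm_tmul, contr₁_tmul, tensor_inner_smul_left,
            tensor_inner_smul_right, TensorProduct.inner_tmul]
          ring

/-- The squared norm of a linear combination of `f`, `g` and
`2 g ⊗₁ g - 4 g ⊙₁ f + 2 f ⊗₁ f`, in terms of the cyclic traces of words in `f` and `g`.

Words of length four with two letters of each kind give two different traces, according as equal
letters are adjacent, `⟨f ⊗₁ g, f ⊗₁ g⟩`, or alternate, `⟨f ⊗₁ g, g ⊗₁ f⟩`. -/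
theorem norm_sq_combination (hf : TensorProduct.comm ℝ E E f = f)
    (hg : TensorProduct.comm ℝ E E g = g) (a b y : ℝ) {z : E ⊗[ℝ] E}
    (hz : z = a • f + b • g + y • ((2 : ℝ) • contr₁ g g - (4 : ℝ) • symm₂ (contr₁ g f)
      + (2 : ℝ) • contr₁ f f)) :
    ‖z‖ ^ 2 = a ^ 2 * inner ℝ f f + 2 * a * b * inner ℝ f g + b ^ 2 * inner ℝ g g
      + 4 * a * y * (inner ℝ f (contr₁ g g) - 2 * inner ℝ f (contr₁ f g)
        + inner ℝ f (contr₁ f f))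
      + 4 * b * y * (inner ℝ g (contr₁ g g) - 2 * inner ℝ f (contr₁ g g)
        + inner ℝ f (contr₁ f g))
      + 4 * y ^ 2 * (inner ℝ (contr₁ g g) (contr₁ g g) - 4 * inner ℝ (contr₁ f g) (contr₁ g g)
        + 4 * inner ℝ (contr₁ f g) (contr₁ f g) + 2 * inner ℝ (contr₁ f g) (contr₁ g f)
        - 4 * inner ℝ (contr₁ f f) (contr₁ f g) + inner ℝ (contr₁ f f) (contr₁ f f)) := by
  have hs : ∀ p q r s : E ⊗[ℝ] E,
      inner ℝ (contr₁ p q) (contr₁ r s) = inner ℝ (contr₁ q p) (contr₁ s r) := by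
    intro p q r s
    rw [← TensorProduct.inner_comm_comm, comm_contr₁, comm_contr₁]
  -- cyclic traces of words of length three
  have t1 : inner ℝ f (contr₁ g f) = inner ℝ f (contr₁ f g) := by
    rw [← TensorProduct.inner_comm_comm, comm_contr₁, hf]
  have t2 : inner ℝ g (contr₁ g f) = inner ℝ f (contr₁ g g) := by
    rw [← TensorProduct.inner_comm_comm, comm_contr₁, hg, inner_contr₁_left_comm, hg]
  have t3 : inner ℝ g (contr₁ f g) = inner ℝ f (contr₁ g g) := by
    rw [inner_contr₁_left_comm, hg]
  have t4 : inner ℝ g (contr₁ f f) = inner ℝ f (contr₁ f g) := by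
    rw [inner_contr₁_left_comm, hf, t1]
  -- cyclic traces of words of length four
  have q1 : inner ℝ (contr₁ f f) (contr₁ g f) = inner ℝ (contr₁ f f) (contr₁ f g) :=
    hs _ _ _ _
  have q2 : inner ℝ (contr₁ g f) (contr₁ g g) = inner ℝ (contr₁ f g) (contr₁ g g) :=
    hs _ _ _ _
  have q3 : inner ℝ (contr₁ g f) (contr₁ g f) = inner ℝ (contr₁ f g) (contr₁ f g) :=
    hs _ _ _ _
  have q4 : inner ℝ (contr₁ f f) (contr₁ g g) = inner ℝ (contr₁ f g) (contr₁ f g) := by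
    rw [inner_contr₁_contr₁_comm, hf, hg]
  have c1 := real_inner_comm f g
  have c2 := real_inner_comm f (contr₁ f f)
  have c3 := real_inner_comm f (contr₁ g f)
  have c4 := real_inner_comm f (contr₁ f g)
  have c5 := real_inner_comm f (contr₁ g g)
  have c6 := real_inner_comm g (contr₁ f f)
  have c7 := real_inner_comm g (contr₁ g f)
  have c8 := real_inner_comm g (contr₁ f g)
  have c9 := real_inner_comm g (contr₁ g g)
  have d1 := real_inner_comm (contr₁ f f) (contr₁ f g)
  have d2 := real_inner_comm (contr₁ f f) (contr₁ g f)
  have d3 := real_inner_comm (contr₁ f f) (contr₁ g g)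
  have d4 := real_inner_comm (contr₁ f g) (contr₁ g f)
  have d5 := real_inner_comm (contr₁ f g) (contr₁ g g)
  have d6 := real_inner_comm (contr₁ g f) (contr₁ g g)
  have hz' : z = a • f + b • g + (2 * y) • (contr₁ g g - contr₁ g f - contr₁ f g
      + contr₁ f f) := by
    rw [hz, symm₂, comm_contr₁]
    module
  rw [← real_inner_self_eq_norm_sq, hz']
  simp only [inner_add_left, inner_add_right, inner_sub_left, inner_sub_right,
    tensor_inner_smul_left, tensor_inner_smul_right]
  simp only [c1, c2, c3, c4, c5, c6, c7, c8, c9, d1, d2, d3, d4, d5, d6, t1, t2, t3,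
    t4, q1, q2, q3, q4]
  ring

end TraceSymmetries

/-! ### Limits of the traces of the kernels -/

theorem cH_pos (hH : H < 1) : 0 < cH H := by
  have : (2 : ℝ) ^ (2 * H) < 2 ^ (2 : ℝ) :=
    Real.rpow_lt_rpow_of_exponent_lt one_lt_two (by linarith)
  rw [cH]
  norm_num at this
  linarith

theorem two_rpow_sub_one (x : ℝ) : (2 : ℝ) ^ (x - 1) = 2 ^ x / 2 := by
  rw [Real.rpow_sub two_pos, Real.rpow_one]

theorem two_rpow_sub_two (x : ℝ) : (2 : ℝ) ^ (x - 2) = 2 ^ x / 4 := by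
  rw [Real.rpow_sub two_pos]
  norm_num

theorem two_rpow_sub_three (x : ℝ) : (2 : ℝ) ^ (x - 3) = 2 ^ x / 8 := by
  rw [Real.rpow_sub two_pos]
  norm_num

theorem two_rpow_four_mul_sub_three (H : ℝ) :
    (2 : ℝ) ^ (4 * H - 3) = (2 ^ (2 * H)) ^ 2 / 8 := by
  rw [two_rpow_sub_three, show 4 * H = 2 * H + 2 * H by ring, Real.rpow_add two_pos, sq]

section Mesh

variable {H T : ℝ}

theorem rpow_mesh_pos (hT : 0 < T) {n : ℕ} (hn : 1 ≤ n) : 0 < (T / n) ^ (2 * H) := by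
  have : (0 : ℝ) < n := by exact_mod_cast hn
  positivity

theorem rpow_mesh_two_mul (hT : 0 < T) (n : ℕ) :
    (T / (2 * n : ℕ)) ^ (2 * H) = (T / n) ^ (2 * H) * (2 ^ (2 * H))⁻¹ := by
  rw [← Real.inv_rpow zero_le_two, ← Real.mul_rpow (by positivity) (by norm_num)]
  congr 1
  push_cast
  rw [mul_comm, div_mul_eq_div_div, div_eq_mul_inv]

/-- The factor `n^{1/2} (T/n)^{2H} w`, where `w` is the scalar in the kernel `f_n^{[1]}`. At `n = 1`
both this and `w` are divisions by zero, with value `0`. -/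
noncomputable def coarseFactor (H : ℝ) (n : ℕ) : ℝ := n / ((n - 1) * cH H)

/-- The factor `n^{1/2} (T/n)^{2H} w`, where `w` is the scalar in the kernel `f_n^{[2]}`. -/
noncomputable def fineFactor (H : ℝ) (n : ℕ) : ℝ := 2 ^ (2 * H) * n / ((2 * n - 1) * cH H)

theorem tendsto_coarseFactor : Tendsto (coarseFactor H) atTop (𝓝 (1 / cH H)) := by
  have h1 : Tendsto (fun n : ℕ ↦ 1 / (1 - 1 / (n : ℝ)) / cH H) atTop (𝓝 (1 / (1 - 0) / cH H)) :=
    ((tendsto_const_nhds (x := (1 : ℝ))).div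
      ((tendsto_const_div_atTop_nhds_zero_nat (1 : ℝ)).const_sub 1) (by norm_num)).div_const _
  rw [sub_zero, div_one] at h1
  refine h1.congr' ?_
  filter_upwards [eventually_ge_atTop 2] with n hn
  have h2 : (2 : ℝ) ≤ n := by exact_mod_cast hn
  have h3 : (n : ℝ) - 1 ≠ 0 := by linarith
  have h4 : (n : ℝ) ≠ 0 := by linarith
  rw [coarseFactor, ← div_div]
  congr 1
  field_simp

theorem tendsto_fineFactor : Tendsto (fineFactor H) atTop (𝓝 (2 ^ (2 * H) / (2 * cH H))) := by
  have h1 : Tendsto (fun n : ℕ ↦ 2 ^ (2 * H) / (2 - 1 / (n : ℝ)) / cH H) atTop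
      (𝓝 (2 ^ (2 * H) / (2 - 0) / cH H)) :=
    ((tendsto_const_nhds (x := (2 : ℝ) ^ (2 * H))).div
      ((tendsto_const_div_atTop_nhds_zero_nat (1 : ℝ)).const_sub 2) (by norm_num)).div_const _
  rw [sub_zero, div_div] at h1
  refine h1.congr' ?_
  filter_upwards [eventually_ge_atTop 2] with n hn
  have h2 : (2 : ℝ) ≤ n := by exact_mod_cast hn
  have h3 : 2 * (n : ℝ) - 1 ≠ 0 := by linarith
  have h4 : (n : ℝ) ≠ 0 := by linarith
  rw [fineFactor, ← div_div]
  congr 1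
  field_simp

end Mesh

section KernelLimits

variable {H T : ℝ} [hH : Fact (H ∈ Set.Ioo (0 : ℝ) 1)]
  {Ω : Type*} [MeasurableSpace Ω] {P : Measure Ω}

theorem kernel_one_eq (hT : 0 < T) (W : FbmHilbert H T →ₗᵢ[ℝ] Lp ℝ 2 P) {n : ℕ} (hn : 1 ≤ n) :
    kernel W 1 n = (coarseFactor H n / (√(n : ℝ) * (T / n) ^ (2 * H))) • gridTensor H T n := by
  have hs : 0 < √(n : ℝ) := Real.sqrt_pos.2 (by exact_mod_cast hn)
  have hs2 : (n : ℝ) = √(n : ℝ) * √(n : ℝ) := (Real.mul_self_sqrt (Nat.cast_nonneg n)).symm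
  rw [kernel_eq hT W (by omega), weight, one_mul, coarseFactor]
  congr 1
  set s := √(n : ℝ)
  set A := (T / n) ^ (2 * H)
  set u := (n : ℝ) - 1
  rw [hs2, div_div, mul_comm s A, ← mul_assoc, mul_div_mul_right _ _ hs.ne']
  congr 1
  ring

theorem kernel_two_eq (hT : 0 < T) (W : FbmHilbert H T →ₗᵢ[ℝ] Lp ℝ 2 P) {n : ℕ} (hn : 1 ≤ n) :
    kernel W 2 n =
      (fineFactor H n / (√(n : ℝ) * (T / n) ^ (2 * H))) • gridTensor H T (2 * n) := by
  have hs : 0 < √(n : ℝ) := Real.sqrt_pos.2 (by exact_mod_cast hn)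
  have hs2 : (n : ℝ) = √(n : ℝ) * √(n : ℝ) := (Real.mul_self_sqrt (Nat.cast_nonneg n)).symm
  have hq : (2 : ℝ) ^ (2 * H) ≠ 0 := (Real.rpow_pos_of_pos two_pos _).ne'
  rw [kernel_eq hT W (by omega), weight, rpow_mesh_two_mul hT, fineFactor]
  congr 1
  have e : ((2 * n : ℕ) : ℝ) - 1 = 2 * n - 1 := by push_cast; ring
  have hu : 2 * (n : ℝ) - 1 ≠ 0 := by
    have : (1 : ℝ) ≤ n := by exact_mod_cast hn
    linarith
  rw [e]
  set s := √(n : ℝ)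
  set A := (T / n) ^ (2 * H)
  set u := 2 * (n : ℝ) - 1
  rw [hs2]
  have hA := rpow_mesh_pos (H := H) hT hn
  have hc := (cH_pos hH.out.2).ne'
  field_simp

/-- The Gram matrix on the fine grid, in terms of the coarse mesh `T / n`. -/
theorem inner_gridVec_fine (hT : 0 < T) {n : ℕ} {j k : ℤ} (hj : j ∈ interior (2 * n))
    (hk : k ∈ interior (2 * n)) :
    inner ℝ (gridVec H T (2 * n) j) (gridVec H T (2 * n) k) =
      (T / n) ^ (2 * H) * (2 ^ (2 * H))⁻¹ * rhoHat H (j - k) := by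
  rw [inner_gridVec hT hj hk, rpow_mesh_two_mul hT]

theorem inner_gridVec_two_mul' (hT : 0 < T) {n : ℕ} {j k : ℤ} (hj : j ∈ interior n)
    (hk : k ∈ interior (2 * n)) :
    inner ℝ (gridVec H T (2 * n) k) (gridVec H T n j) =
      (T / n) ^ (2 * H) * rhoTilde H (k - 2 * j) := by
  rw [real_inner_comm, inner_gridVec_two_mul hT hj hk]

/-- The limit of a trace of two kernels `f_i = b_i n^{-1/2} A⁻¹ D_i`, where `A² R S` is the trace of
the `D_i`: the powers of `A` cancel, and those of `n` turn `S` into an average. -/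
theorem tendsto_trace₂ {E : Type*} [NormedAddCommGroup E] [InnerProductSpace ℝ E]
    {f₁ f₂ D₁ D₂ : ℕ → E ⊗[ℝ] E} {b₁ b₂ A S : ℕ → ℝ} {β₁ β₂ R L : ℝ}
    (h₁ : ∀ n ≥ 1, f₁ n = (b₁ n / (√(n : ℝ) * A n)) • D₁ n)
    (h₂ : ∀ n ≥ 1, f₂ n = (b₂ n / (√(n : ℝ) * A n)) • D₂ n) (hA : ∀ n ≥ 1, 0 < A n)
    (hD : ∀ n ≥ 1, inner ℝ (D₁ n) (D₂ n) = A n ^ 2 * R * S n)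
    (t₁ : Tendsto b₁ atTop (𝓝 β₁)) (t₂ : Tendsto b₂ atTop (𝓝 β₂))
    (hS : Tendsto (fun n ↦ S n / n) atTop (𝓝 L)) :
    Tendsto (fun n ↦ inner ℝ (f₁ n) (f₂ n)) atTop (𝓝 (β₁ * β₂ * (R * L))) := by
  refine ((t₁.mul t₂).mul (hS.const_mul R)).congr' ?_
  filter_upwards [eventually_ge_atTop 1] with n hn
  have hs : 0 < √(n : ℝ) := Real.sqrt_pos.2 (by exact_mod_cast hn)
  have hs2 : (n : ℝ) = √(n : ℝ) ^ 2 := (Real.sq_sqrt (Nat.cast_nonneg n)).symm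
  have hA' := hA n hn
  rw [h₁ n hn, h₂ n hn, tensor_inner_smul_left, tensor_inner_smul_right, hD n hn]
  set s := √(n : ℝ)
  rw [hs2]
  field_simp

/-- The analogue of `tendsto_trace₂` for words of length three; the trace of three kernels is of
order `n^{-1/2}`. -/
theorem tendsto_trace₃ {E : Type*} [NormedAddCommGroup E] [InnerProductSpace ℝ E]
    {f₁ f₂ f₃ D₁ D₂ D₃ : ℕ → E ⊗[ℝ] E} {b₁ b₂ b₃ A S : ℕ → ℝ} {β₁ β₂ β₃ R L : ℝ}
    (h₁ : ∀ n ≥ 1, f₁ n = (b₁ n / (√(n : ℝ) * A n)) • D₁ n)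
    (h₂ : ∀ n ≥ 1, f₂ n = (b₂ n / (√(n : ℝ) * A n)) • D₂ n)
    (h₃ : ∀ n ≥ 1, f₃ n = (b₃ n / (√(n : ℝ) * A n)) • D₃ n) (hA : ∀ n ≥ 1, 0 < A n)
    (hD : ∀ n ≥ 1, inner ℝ (D₁ n) (contr₁ (D₂ n) (D₃ n)) = A n ^ 3 * R * S n)
    (t₁ : Tendsto b₁ atTop (𝓝 β₁)) (t₂ : Tendsto b₂ atTop (𝓝 β₂))
    (t₃ : Tendsto b₃ atTop (𝓝 β₃)) (hS : Tendsto (fun n ↦ S n / n) atTop (𝓝 L)) :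
    Tendsto (fun n : ℕ ↦ √(n : ℝ) * inner ℝ (f₁ n) (contr₁ (f₂ n) (f₃ n))) atTop
      (𝓝 (β₁ * β₂ * β₃ * (R * L))) := by
  refine (((t₁.mul t₂).mul t₃).mul (hS.const_mul R)).congr' ?_
  filter_upwards [eventually_ge_atTop 1] with n hn
  have hs : 0 < √(n : ℝ) := Real.sqrt_pos.2 (by exact_mod_cast hn)
  have hs2 : (n : ℝ) = √(n : ℝ) ^ 2 := (Real.sq_sqrt (Nat.cast_nonneg n)).symm
  have hA' := hA n hn
  rw [h₁ n hn, h₂ n hn, h₃ n hn]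
  simp only [map_smul, LinearMap.smul_apply, tensor_inner_smul_left, tensor_inner_smul_right,
    hD n hn]
  set s := √(n : ℝ)
  rw [hs2]
  field_simp

/-- The analogue of `tendsto_trace₂` for words of length four; the trace of four kernels is of
order `n⁻¹`. -/
theorem tendsto_trace₄ {E : Type*} [NormedAddCommGroup E] [InnerProductSpace ℝ E]
    {f₁ f₂ f₃ f₄ D₁ D₂ D₃ D₄ : ℕ → E ⊗[ℝ] E} {b₁ b₂ b₃ b₄ A S : ℕ → ℝ} {β₁ β₂ β₃ β₄ R L : ℝ}
    (h₁ : ∀ n ≥ 1, f₁ n = (b₁ n / (√(n : ℝ) * A n)) • D₁ n)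
    (h₂ : ∀ n ≥ 1, f₂ n = (b₂ n / (√(n : ℝ) * A n)) • D₂ n)
    (h₃ : ∀ n ≥ 1, f₃ n = (b₃ n / (√(n : ℝ) * A n)) • D₃ n)
    (h₄ : ∀ n ≥ 1, f₄ n = (b₄ n / (√(n : ℝ) * A n)) • D₄ n) (hA : ∀ n ≥ 1, 0 < A n)
    (hD : ∀ n ≥ 1, inner ℝ (contr₁ (D₁ n) (D₄ n)) (contr₁ (D₂ n) (D₃ n)) = A n ^ 4 * R * S n)
    (t₁ : Tendsto b₁ atTop (𝓝 β₁)) (t₂ : Tendsto b₂ atTop (𝓝 β₂))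
    (t₃ : Tendsto b₃ atTop (𝓝 β₃)) (t₄ : Tendsto b₄ atTop (𝓝 β₄))
    (hS : Tendsto (fun n ↦ S n / n) atTop (𝓝 L)) :
    Tendsto (fun n : ℕ ↦ n * inner ℝ (contr₁ (f₁ n) (f₄ n)) (contr₁ (f₂ n) (f₃ n))) atTop
      (𝓝 (β₁ * β₂ * β₃ * β₄ * (R * L))) := by
  refine ((((t₁.mul t₂).mul t₃).mul t₄).mul (hS.const_mul R)).congr' ?_
  filter_upwards [eventually_ge_atTop 1] with n hn
  have hs : 0 < √(n : ℝ) := Real.sqrt_pos.2 (by exact_mod_cast hn)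
  have hs2 : (n : ℝ) = √(n : ℝ) ^ 2 := (Real.sq_sqrt (Nat.cast_nonneg n)).symm
  have hA' := hA n hn
  rw [h₁ n hn, h₂ n hn, h₃ n hn, h₄ n hn]
  simp only [map_smul, LinearMap.smul_apply, tensor_inner_smul_left, tensor_inner_smul_right,
    hD n hn]
  set s := √(n : ℝ)
  rw [hs2]
  field_simp

/-- Sums over the fine grid alone have twice as many terms. -/
theorem tendsto_comp_two_mul {F : ℕ → ℝ} {L : ℝ}
    (h : Tendsto (fun n : ℕ ↦ F n / n) atTop (𝓝 L)) :
    Tendsto (fun n : ℕ ↦ F (2 * n) / n) atTop (𝓝 (2 * L)) := by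
  have h2 : Tendsto (fun n : ℕ ↦ 2 * n) atTop atTop :=
    tendsto_id.const_mul_atTop' (by norm_num)
  refine ((h.comp h2).const_mul 2).congr fun n ↦ ?_
  simp only [Function.comp_apply]
  push_cast
  rw [mul_div_assoc', mul_div_mul_left _ _ two_ne_zero]

/-! In the names below, the digits `1` and `2` are the superscripts of the kernels along a cyclic
trace. The exponent of `(2 ^ (2 * H))⁻¹` in the argument `R` counts the pairs of cyclically adjacent
fine kernels, each of which contributes a Gram matrix on the fine mesh. -/

variable (W : FbmHilbert H T →ₗᵢ[ℝ] Lp ℝ 2 P)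

theorem tendsto_trace_11 (hT : 0 < T) :
    Tendsto (fun n ↦ inner ℝ (kernel W 1 n) (kernel W 1 n)) atTop
      (𝓝 (Sigma11 H / 2)) := by
  have hc := (cH_pos hH.out.2).ne'
  have hq : (2 : ℝ) ^ (2 * H) ≠ 0 := (Real.rpow_pos_of_pos two_pos _).ne'
  have h := tendsto_trace₂ (R := ((2 : ℝ) ^ (2 * H))⁻¹ ^ 0)
    (fun n hn ↦ kernel_one_eq hT W hn) (fun n hn ↦ kernel_one_eq hT W hn)
    (fun n hn ↦ rpow_mesh_pos (H := H) hT hn) (fun n hn ↦ ?_)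
    tendsto_coarseFactor tendsto_coarseFactor
    (tendsto_sum_hat_hat hH.out.2)
  · convert h using 2
    rw [Sigma11, tsum_rhoHat_sq hH.out.1 hH.out.2]
    field_simp
  · rw [gridTensor, inner_sum_tmul]
    simp only [Finset.mul_sum]
    refine Finset.sum_congr rfl fun j hj ↦
      Finset.sum_congr rfl fun k hk ↦ ?_
    rw [inner_gridVec hT hj hk,
      inner_gridVec hT hk hj]
    ring

theorem tendsto_trace_12 (hT : 0 < T) :
    Tendsto (fun n ↦ inner ℝ (kernel W 1 n) (kernel W 2 n)) atTop
      (𝓝 (Sigma12 H / 2)) := by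
  have hc := (cH_pos hH.out.2).ne'
  have hq : (2 : ℝ) ^ (2 * H) ≠ 0 := (Real.rpow_pos_of_pos two_pos _).ne'
  have h := tendsto_trace₂ (R := ((2 : ℝ) ^ (2 * H))⁻¹ ^ 0)
    (fun n hn ↦ kernel_one_eq hT W hn) (fun n hn ↦ kernel_two_eq hT W hn)
    (fun n hn ↦ rpow_mesh_pos (H := H) hT hn) (fun n hn ↦ ?_)
    tendsto_coarseFactor tendsto_fineFactor
    (tendsto_sum_tilde_tilde hH.out.2)
  · convert h using 2
    rw [Sigma12]
    field_simp
  · rw [gridTensor, gridTensor, inner_sum_tmul]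
    simp only [Finset.mul_sum]
    refine Finset.sum_congr rfl fun j hj ↦
      Finset.sum_congr rfl fun k hk ↦ ?_
    rw [inner_gridVec_two_mul hT hj hk,
      inner_gridVec_two_mul' hT hj hk]
    ring

theorem tendsto_trace_22 (hT : 0 < T) :
    Tendsto (fun n ↦ inner ℝ (kernel W 2 n) (kernel W 2 n)) atTop
      (𝓝 (Sigma22 H / 2)) := by
  have hc := (cH_pos hH.out.2).ne'
  have hq : (2 : ℝ) ^ (2 * H) ≠ 0 := (Real.rpow_pos_of_pos two_pos _).ne'
  have h := tendsto_trace₂ (R := ((2 : ℝ) ^ (2 * H))⁻¹ ^ 2)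
    (fun n hn ↦ kernel_two_eq hT W hn) (fun n hn ↦ kernel_two_eq hT W hn)
    (fun n hn ↦ rpow_mesh_pos (H := H) hT hn) (fun n hn ↦ ?_)
    tendsto_fineFactor tendsto_fineFactor
    (tendsto_comp_two_mul (tendsto_sum_hat_hat hH.out.2))
  · convert h using 2
    rw [Sigma22, Sigma11, tsum_rhoHat_sq hH.out.1 hH.out.2]
    field_simp
  · rw [gridTensor, inner_sum_tmul]
    simp only [Finset.mul_sum]
    refine Finset.sum_congr rfl fun j hj ↦
      Finset.sum_congr rfl fun k hk ↦ ?_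
    rw [inner_gridVec_fine hT hj hk,
      inner_gridVec_fine hT hk hj]
    ring

theorem tendsto_trace_111 (hT : 0 < T) :
    Tendsto (fun n : ℕ ↦ √(n : ℝ) * inner ℝ (kernel W 1 n)
      (contr₁ (kernel W 1 n) (kernel W 1 n))) atTop
      (𝓝 (kappa1_11 H)) := by
  have hc := (cH_pos hH.out.2).ne'
  have hq : (2 : ℝ) ^ (2 * H) ≠ 0 := (Real.rpow_pos_of_pos two_pos _).ne'
  have h := tendsto_trace₃ (R := ((2 : ℝ) ^ (2 * H))⁻¹ ^ 0)
    (fun n hn ↦ kernel_one_eq hT W hn) (fun n hn ↦ kernel_one_eq hT W hn)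
    (fun n hn ↦ kernel_one_eq hT W hn)
    (fun n hn ↦ rpow_mesh_pos (H := H) hT hn) (fun n hn ↦ ?_)
    tendsto_coarseFactor tendsto_coarseFactor tendsto_coarseFactor
    (tendsto_sum_111 hH.out.2)
  · convert h using 2
    rw [kappa1_11]
    field_simp
  · rw [gridTensor, inner_sum_tmul_contr₁]
    simp only [Finset.mul_sum]
    refine Finset.sum_congr rfl fun j hj ↦
      Finset.sum_congr rfl fun k hk ↦
      Finset.sum_congr rfl fun l hl ↦ ?_
    rw [inner_gridVec hT hj hk,
      inner_gridVec hT hk hl,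
      inner_gridVec hT hl hj]
    ring

theorem tendsto_trace_112 (hT : 0 < T) :
    Tendsto (fun n : ℕ ↦ √(n : ℝ) * inner ℝ (kernel W 1 n)
      (contr₁ (kernel W 1 n) (kernel W 2 n))) atTop
      (𝓝 (kappa2_11 H)) := by
  have hc := (cH_pos hH.out.2).ne'
  have hq : (2 : ℝ) ^ (2 * H) ≠ 0 := (Real.rpow_pos_of_pos two_pos _).ne'
  have h := tendsto_trace₃ (R := ((2 : ℝ) ^ (2 * H))⁻¹ ^ 0)
    (fun n hn ↦ kernel_one_eq hT W hn) (fun n hn ↦ kernel_one_eq hT W hn)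
    (fun n hn ↦ kernel_two_eq hT W hn)
    (fun n hn ↦ rpow_mesh_pos (H := H) hT hn) (fun n hn ↦ ?_)
    tendsto_coarseFactor tendsto_coarseFactor tendsto_fineFactor
    (tendsto_sum_112 hH.out.2)
  · convert h using 2
    rw [kappa2_11, two_rpow_sub_one]
    field_simp
  · rw [gridTensor, gridTensor, inner_sum_tmul_contr₁]
    simp only [Finset.mul_sum]
    refine Finset.sum_congr rfl fun j hj ↦
      Finset.sum_congr rfl fun k hk ↦
      Finset.sum_congr rfl fun l hl ↦ ?_
    rw [inner_gridVec hT hj hk,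
      inner_gridVec_two_mul hT hk hl,
      inner_gridVec_two_mul' hT hj hl]
    ring

theorem tendsto_trace_122 (hT : 0 < T) :
    Tendsto (fun n : ℕ ↦ √(n : ℝ) * inner ℝ (kernel W 1 n)
      (contr₁ (kernel W 2 n) (kernel W 2 n))) atTop
      (𝓝 (kappa1_22 H)) := by
  have hc := (cH_pos hH.out.2).ne'
  have hq : (2 : ℝ) ^ (2 * H) ≠ 0 := (Real.rpow_pos_of_pos two_pos _).ne'
  have h := tendsto_trace₃ (R := ((2 : ℝ) ^ (2 * H))⁻¹ ^ 1)
    (fun n hn ↦ kernel_one_eq hT W hn) (fun n hn ↦ kernel_two_eq hT W hn)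
    (fun n hn ↦ kernel_two_eq hT W hn)
    (fun n hn ↦ rpow_mesh_pos (H := H) hT hn) (fun n hn ↦ ?_)
    tendsto_coarseFactor tendsto_fineFactor tendsto_fineFactor
    (tendsto_sum_122 hH.out.2)
  · convert h using 2
    rw [kappa1_22, two_rpow_sub_two]
    field_simp
    norm_num
  · rw [gridTensor, gridTensor, inner_sum_tmul_contr₁]
    simp only [Finset.mul_sum]
    refine Finset.sum_congr rfl fun j hj ↦
      Finset.sum_congr rfl fun k hk ↦
      Finset.sum_congr rfl fun l hl ↦ ?_
    rw [inner_gridVec_two_mul hT hj hk,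
      inner_gridVec_fine hT hk hl,
      inner_gridVec_two_mul' hT hj hl]
    ring

theorem tendsto_trace_222 (hT : 0 < T) :
    Tendsto (fun n : ℕ ↦ √(n : ℝ) * inner ℝ (kernel W 2 n)
      (contr₁ (kernel W 2 n) (kernel W 2 n))) atTop
      (𝓝 (kappa2_22 H)) := by
  have hc := (cH_pos hH.out.2).ne'
  have hq : (2 : ℝ) ^ (2 * H) ≠ 0 := (Real.rpow_pos_of_pos two_pos _).ne'
  have h := tendsto_trace₃ (R := ((2 : ℝ) ^ (2 * H))⁻¹ ^ 3)
    (fun n hn ↦ kernel_two_eq hT W hn) (fun n hn ↦ kernel_two_eq hT W hn)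
    (fun n hn ↦ kernel_two_eq hT W hn)
    (fun n hn ↦ rpow_mesh_pos (H := H) hT hn) (fun n hn ↦ ?_)
    tendsto_fineFactor tendsto_fineFactor tendsto_fineFactor
    (tendsto_comp_two_mul (tendsto_sum_111 hH.out.2))
  · convert h using 2
    rw [kappa2_22, kappa1_11]
    field_simp
    ring
  · rw [gridTensor, inner_sum_tmul_contr₁]
    simp only [Finset.mul_sum]
    refine Finset.sum_congr rfl fun j hj ↦
      Finset.sum_congr rfl fun k hk ↦
      Finset.sum_congr rfl fun l hl ↦ ?_
    rw [inner_gridVec_fine hT hj hk,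
      inner_gridVec_fine hT hk hl,
      inner_gridVec_fine hT hl hj]
    ring

theorem tendsto_trace_1111 (hT : 0 < T) :
    Tendsto (fun n : ℕ ↦ n * inner ℝ (contr₁ (kernel W 1 n) (kernel W 1 n))
      (contr₁ (kernel W 1 n) (kernel W 1 n))) atTop
      (𝓝 (kappa11_11 H)) := by
  have hc := (cH_pos hH.out.2).ne'
  have hq : (2 : ℝ) ^ (2 * H) ≠ 0 := (Real.rpow_pos_of_pos two_pos _).ne'
  have h := tendsto_trace₄ (R := ((2 : ℝ) ^ (2 * H))⁻¹ ^ 0)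
    (fun n hn ↦ kernel_one_eq hT W hn) (fun n hn ↦ kernel_one_eq hT W hn)
    (fun n hn ↦ kernel_one_eq hT W hn) (fun n hn ↦ kernel_one_eq hT W hn)
    (fun n hn ↦ rpow_mesh_pos (H := H) hT hn) (fun n hn ↦ ?_)
    tendsto_coarseFactor tendsto_coarseFactor tendsto_coarseFactor tendsto_coarseFactor
    (tendsto_sum_1111 hH.out.2)
  · convert h using 2
    rw [kappa11_11]
    field_simp
  · rw [gridTensor, inner_contr₁_sum_tmul]
    simp only [Finset.mul_sum]
    refine Finset.sum_congr rfl fun j hj ↦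
      Finset.sum_congr rfl fun k hk ↦
      Finset.sum_congr rfl fun l hl ↦
      Finset.sum_congr rfl fun p hp ↦ ?_
    rw [inner_gridVec hT hj hk,
      inner_gridVec hT hk hl,
      inner_gridVec hT hl hp,
      inner_gridVec hT hp hj]
    ring

theorem tendsto_trace_1121 (hT : 0 < T) :
    Tendsto (fun n : ℕ ↦ n * inner ℝ (contr₁ (kernel W 1 n) (kernel W 1 n))
      (contr₁ (kernel W 1 n) (kernel W 2 n))) atTop
      (𝓝 (kappa11_12 H)) := by
  have hc := (cH_pos hH.out.2).ne'
  have hq : (2 : ℝ) ^ (2 * H) ≠ 0 := (Real.rpow_pos_of_pos two_pos _).ne'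
  have h := tendsto_trace₄ (R := ((2 : ℝ) ^ (2 * H))⁻¹ ^ 0)
    (fun n hn ↦ kernel_one_eq hT W hn) (fun n hn ↦ kernel_one_eq hT W hn)
    (fun n hn ↦ kernel_two_eq hT W hn) (fun n hn ↦ kernel_one_eq hT W hn)
    (fun n hn ↦ rpow_mesh_pos (H := H) hT hn) (fun n hn ↦ ?_)
    tendsto_coarseFactor tendsto_coarseFactor tendsto_fineFactor tendsto_coarseFactor
    (tendsto_sum_1112 hH.out.2)
  · convert h using 2
    rw [kappa11_12, two_rpow_sub_one]
    field_simp
  · rw [gridTensor, gridTensor, inner_contr₁_sum_tmul]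
    simp only [Finset.mul_sum]
    refine Finset.sum_congr rfl fun j hj ↦
      Finset.sum_congr rfl fun k hk ↦
      Finset.sum_congr rfl fun l hl ↦
      Finset.sum_congr rfl fun p hp ↦ ?_
    rw [inner_gridVec hT hj hk,
      inner_gridVec_two_mul hT hk hl,
      inner_gridVec_two_mul' hT hp hl,
      inner_gridVec hT hp hj]
    ring

theorem tendsto_trace_1222 (hT : 0 < T) :
    Tendsto (fun n : ℕ ↦ n * inner ℝ (contr₁ (kernel W 1 n) (kernel W 2 n))
      (contr₁ (kernel W 2 n) (kernel W 2 n))) atTop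
      (𝓝 (kappa12_22 H)) := by
  have hc := (cH_pos hH.out.2).ne'
  have hq : (2 : ℝ) ^ (2 * H) ≠ 0 := (Real.rpow_pos_of_pos two_pos _).ne'
  have h := tendsto_trace₄ (R := ((2 : ℝ) ^ (2 * H))⁻¹ ^ 2)
    (fun n hn ↦ kernel_one_eq hT W hn) (fun n hn ↦ kernel_two_eq hT W hn)
    (fun n hn ↦ kernel_two_eq hT W hn) (fun n hn ↦ kernel_two_eq hT W hn)
    (fun n hn ↦ rpow_mesh_pos (H := H) hT hn) (fun n hn ↦ ?_)
    tendsto_coarseFactor tendsto_fineFactor tendsto_fineFactor tendsto_fineFactor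
    (tendsto_sum_1222 hH.out.2)
  · convert h using 2
    rw [kappa12_22, two_rpow_sub_three]
    field_simp
    norm_num
  · rw [gridTensor, gridTensor, inner_contr₁_sum_tmul]
    simp only [Finset.mul_sum]
    refine Finset.sum_congr rfl fun j hj ↦
      Finset.sum_congr rfl fun k hk ↦
      Finset.sum_congr rfl fun l hl ↦
      Finset.sum_congr rfl fun p hp ↦ ?_
    rw [inner_gridVec_two_mul hT hj hk,
      inner_gridVec_fine hT hk hl,
      inner_gridVec_fine hT hl hp,
      inner_gridVec_two_mul' hT hj hp]
    ring

theorem tendsto_trace_1122 (hT : 0 < T) :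
    Tendsto (fun n : ℕ ↦ n * inner ℝ (contr₁ (kernel W 1 n) (kernel W 2 n))
      (contr₁ (kernel W 1 n) (kernel W 2 n))) atTop
      (𝓝 (kappa11_22 H)) := by
  have hc := (cH_pos hH.out.2).ne'
  have hq : (2 : ℝ) ^ (2 * H) ≠ 0 := (Real.rpow_pos_of_pos two_pos _).ne'
  have h := tendsto_trace₄ (R := ((2 : ℝ) ^ (2 * H))⁻¹ ^ 1)
    (fun n hn ↦ kernel_one_eq hT W hn) (fun n hn ↦ kernel_one_eq hT W hn)
    (fun n hn ↦ kernel_two_eq hT W hn) (fun n hn ↦ kernel_two_eq hT W hn)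
    (fun n hn ↦ rpow_mesh_pos (H := H) hT hn) (fun n hn ↦ ?_)
    tendsto_coarseFactor tendsto_coarseFactor tendsto_fineFactor tendsto_fineFactor
    (tendsto_sum_1122 hH.out.2)
  · convert h using 2
    rw [kappa11_22, tsum_t11_22_eq hH.out.2, two_rpow_sub_two]
    field_simp
    norm_num
  · rw [gridTensor, gridTensor, inner_contr₁_sum_tmul]
    simp only [Finset.mul_sum]
    refine Finset.sum_congr rfl fun j hj ↦
      Finset.sum_congr rfl fun k hk ↦
      Finset.sum_congr rfl fun l hl ↦
      Finset.sum_congr rfl fun p hp ↦ ?_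
    rw [inner_gridVec hT hj hk,
      inner_gridVec_two_mul hT hk hl,
      inner_gridVec_fine hT hl hp,
      inner_gridVec_two_mul' hT hj hp]
    ring

/-- `κ(1,2;1,2)` is a symmetrized quantity: it is the mean of the alternating trace and of the trace
`κ(1,1;2,2)` with equal kernels adjacent. -/
theorem tendsto_trace_1212 (hT : 0 < T) :
    Tendsto (fun n : ℕ ↦ n * inner ℝ (contr₁ (kernel W 1 n) (kernel W 2 n))
      (contr₁ (kernel W 2 n) (kernel W 1 n))) atTop
      (𝓝 (2 * kappa12_12 H - kappa11_22 H)) := by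
  have hc := (cH_pos hH.out.2).ne'
  have hq : (2 : ℝ) ^ (2 * H) ≠ 0 := (Real.rpow_pos_of_pos two_pos _).ne'
  have h := tendsto_trace₄ (R := ((2 : ℝ) ^ (2 * H))⁻¹ ^ 0)
    (fun n hn ↦ kernel_one_eq hT W hn) (fun n hn ↦ kernel_two_eq hT W hn)
    (fun n hn ↦ kernel_one_eq hT W hn) (fun n hn ↦ kernel_two_eq hT W hn)
    (fun n hn ↦ rpow_mesh_pos (H := H) hT hn) (fun n hn ↦ ?_)
    tendsto_coarseFactor tendsto_fineFactor tendsto_coarseFactor tendsto_fineFactor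
    (tendsto_sum_1212 hH.out.2)
  · convert h using 2
    rw [kappa12_12, kappa11_22, tsum_t11_22_eq hH.out.2, tsum_alternatingSummand hH.out.2,
      two_rpow_sub_two, two_rpow_sub_three, two_rpow_four_mul_sub_three]
    field_simp
    ring
  · rw [gridTensor, gridTensor, inner_contr₁_sum_tmul]
    simp only [Finset.mul_sum]
    refine Finset.sum_congr rfl fun j hj ↦
      Finset.sum_congr rfl fun k hk ↦
      Finset.sum_congr rfl fun l hl ↦
      Finset.sum_congr rfl fun p hp ↦ ?_
    rw [inner_gridVec_two_mul hT hj hk,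
      inner_gridVec_two_mul' hT hl hk,
      inner_gridVec_two_mul hT hl hp,
      inner_gridVec_two_mul' hT hj hp]
    ring

theorem tendsto_trace_2222 (hT : 0 < T) :
    Tendsto (fun n : ℕ ↦ n * inner ℝ (contr₁ (kernel W 2 n) (kernel W 2 n))
      (contr₁ (kernel W 2 n) (kernel W 2 n))) atTop
      (𝓝 (kappa22_22 H)) := by
  have hc := (cH_pos hH.out.2).ne'
  have hq : (2 : ℝ) ^ (2 * H) ≠ 0 := (Real.rpow_pos_of_pos two_pos _).ne'
  have h := tendsto_trace₄ (R := ((2 : ℝ) ^ (2 * H))⁻¹ ^ 4)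
    (fun n hn ↦ kernel_two_eq hT W hn) (fun n hn ↦ kernel_two_eq hT W hn)
    (fun n hn ↦ kernel_two_eq hT W hn) (fun n hn ↦ kernel_two_eq hT W hn)
    (fun n hn ↦ rpow_mesh_pos (H := H) hT hn) (fun n hn ↦ ?_)
    tendsto_fineFactor tendsto_fineFactor tendsto_fineFactor tendsto_fineFactor
    (tendsto_comp_two_mul (tendsto_sum_1111 hH.out.2))
  · convert h using 2
    rw [kappa22_22, kappa11_11]
    field_simp
    ring
  · rw [gridTensor, inner_contr₁_sum_tmul]
    simp only [Finset.mul_sum]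
    refine Finset.sum_congr rfl fun j hj ↦
      Finset.sum_congr rfl fun k hk ↦
      Finset.sum_congr rfl fun l hl ↦
      Finset.sum_congr rfl fun p hp ↦ ?_
    rw [inner_gridVec_fine hT hj hk,
      inner_gridVec_fine hT hk hl,
      inner_gridVec_fine hT hl hp,
      inner_gridVec_fine hT hp hj]
    ring

end KernelLimits

/-! ### Linear combinations of the components and the limit law -/

section Combination

variable {H T : ℝ} [hH : Fact (H ∈ Set.Ioo (0 : ℝ) 1)]
  {Ω : Type*} [MeasurableSpace Ω] {P : Measure Ω}

/-- The symmetric tensor `z_n` with `I₂(z_n) = ⟨x, U_n⟩`. -/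
noncomputable def combKernel (W : FbmHilbert H T →ₗᵢ[ℝ] Lp ℝ 2 P) (x : Fin 3 → ℝ) (n : ℕ) :
    FbmHilbert H T ⊗[ℝ] FbmHilbert H T :=
  x 0 • kernel W 1 n + x 1 • kernel W 2 n + (x 2 * √(n : ℝ)) •
    ((2 : ℝ) • contr₁ (kernel W 2 n) (kernel W 2 n)
      - (4 : ℝ) • symm₂ (contr₁ (kernel W 2 n) (kernel W 1 n))
      + (2 : ℝ) • contr₁ (kernel W 1 n) (kernel W 1 n))

variable (W : FbmHilbert H T →ₗᵢ[ℝ] Lp ℝ 2 P)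

theorem comm_combKernel (x : Fin 3 → ℝ) (n : ℕ) :
    TensorProduct.comm ℝ _ _ (combKernel W x n) = combKernel W x n := by
  simp only [combKernel, map_add, map_sub, map_smul, comm_kernel, comm_contr₁, comm_symm₂]

/-- The variance of `⟨x, U_n⟩` converges to the quadratic form of `𝔘`. -/
theorem tendsto_norm_combKernel_sq (hT : 0 < T) (x : Fin 3 → ℝ) :
    Tendsto (fun n ↦ 2 * ‖combKernel W x n‖ ^ 2) atTop
      (𝓝 (x ⬝ᵥ (covU H).mulVec x)) := by
  -- the words of length two, three and four in the expansion of the squared norm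
  have h2 := (((tendsto_trace_11 W hT).const_mul (x 0 ^ 2)).add
    ((tendsto_trace_12 W hT).const_mul (2 * x 0 * x 1))).add
    ((tendsto_trace_22 W hT).const_mul (x 1 ^ 2))
  have h3 := (((((tendsto_trace_122 W hT).sub ((tendsto_trace_112 W hT).const_mul 2)).add
    (tendsto_trace_111 W hT))).const_mul (4 * x 0 * x 2)).add
    (((((tendsto_trace_222 W hT).sub ((tendsto_trace_122 W hT).const_mul 2)).add
    (tendsto_trace_112 W hT))).const_mul (4 * x 1 * x 2))
  have h4 := (((((((tendsto_trace_2222 W hT).sub ((tendsto_trace_1222 W hT).const_mul 4)).add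
    ((tendsto_trace_1122 W hT).const_mul 4)).add ((tendsto_trace_1212 W hT).const_mul 2)).sub
    ((tendsto_trace_1121 W hT).const_mul 4)).add (tendsto_trace_1111 W hT))).const_mul
    (4 * x 2 ^ 2)
  have h := ((h2.add h3).add h4).const_mul 2
  convert h using 2 with n
  · have hs : √(n : ℝ) ^ 2 = n := Real.sq_sqrt (Nat.cast_nonneg n)
    rw [norm_sq_combination (comm_kernel W 1 n) (comm_kernel W 2 n) (x 0) (x 1)
      (x 2 * √(n : ℝ)) (z := combKernel W x n) rfl, mul_pow, hs]
    ring
  · simp only [covU, dotProduct, Matrix.mulVec, Fin.sum_univ_three, Matrix.of_apply,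
      Matrix.cons_val, U13, U23, U33]
    ring

theorem covU_isHermitian (H : ℝ) : (covU H).IsHermitian := by
  ext i j
  fin_cases i <;> fin_cases j <;> rfl

/-- The quadratic form of `𝔘` is a limit of squared norms. -/
theorem covU_posSemidef (W : FbmHilbert H T →ₗᵢ[ℝ] Lp ℝ 2 P) (hT : 0 < T) :
    (covU H).PosSemidef := by
  refine .of_dotProduct_mulVec_nonneg (covU_isHermitian H) fun x ↦ ?_
  exact ge_of_tendsto' (tendsto_norm_combKernel_sq W hT x) fun n ↦ by positivity

theorem ae_inner_vecU (x : EuclideanSpace ℝ (Fin 3)) (n : ℕ) :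
    ∀ᵐ ω ∂P, inner ℝ (vecU W n ω) x = I2 W (combKernel W x n) ω := by
  have e : I2 W (combKernel W x n) = x 0 • I2 W (kernel W 1 n) + x 1 • I2 W (kernel W 2 n)
      + (x 2 * √(n : ℝ)) • gTilde W n := by
    simp only [combKernel, gTilde, map_add, map_sub, map_smul]
  rw [e]
  filter_upwards [AEEqFun.coeFn_add (x 0 • I2 W (kernel W 1 n) + x 1 • I2 W (kernel W 2 n))
      ((x 2 * √(n : ℝ)) • gTilde W n),
    AEEqFun.coeFn_add (x 0 • I2 W (kernel W 1 n)) (x 1 • I2 W (kernel W 2 n)),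
    AEEqFun.coeFn_smul (x 0) (I2 W (kernel W 1 n)),
    AEEqFun.coeFn_smul (x 1) (I2 W (kernel W 2 n)),
    AEEqFun.coeFn_smul (x 2 * √(n : ℝ)) (gTilde W n)] with ω h1 h2 h3 h4 h5
  rw [h1, Pi.add_apply, h2, Pi.add_apply, h3, h4, h5]
  simp only [vecU, PiLp.inner_apply, Fin.sum_univ_three, Pi.smul_apply, smul_eq_mul,
    RCLike.inner_apply, conj_trivial, Matrix.cons_val]
  ring

theorem aemeasurable_vecU (n : ℕ) : AEMeasurable (vecU W n) P := by
  refine (WithLp.measurable_toLp 2 _).comp_aemeasurable (aemeasurable_pi_lambda _ fun i ↦ ?_)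
  fin_cases i
  · exact (I2 W (kernel W 1 n)).aemeasurable
  · exact (I2 W (kernel W 2 n)).aemeasurable
  · exact (gTilde W n).aemeasurable.const_mul _

end Combination

section OperatorNorm

variable {H T : ℝ} [hH : Fact (H ∈ Set.Ioo (0 : ℝ) 1)]
  {Ω : Type*} [MeasurableSpace Ω] {P : Measure Ω}

/-- Row sums of the Gram matrix are bounded by the `ℓ¹` norm of `ρ̂`, uniformly in the grid. -/
theorem sum_abs_inner_gridVec_le (hT : 0 < T) {m : ℕ} {j : ℤ} (hj : j ∈ interior m) :
    ∑ k ∈ interior m, |inner ℝ (gridVec H T m j) (gridVec H T m k)| ≤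
      (T / m) ^ (2 * H) * ∑' i, |rhoHat H i| := by
  have hA : 0 ≤ (T / m) ^ (2 * H) := by positivity
  have hs := (summable_rhoHat hH.out.2).abs
  have e := (Equiv.subLeft j).tsum_eq fun i ↦ |rhoHat H i|
  have hs' : Summable fun k ↦ |rhoHat H (j - k)| := (Equiv.subLeft j).summable_iff.2 hs
  calc ∑ k ∈ interior m, |inner ℝ (gridVec H T m j) (gridVec H T m k)|
      = (T / m) ^ (2 * H) * ∑ k ∈ interior m, |rhoHat H (j - k)| := by
        rw [Finset.mul_sum]
        refine Finset.sum_congr rfl fun k hk ↦ ?_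
        rw [inner_gridVec hT hj hk, abs_mul, abs_of_nonneg hA]
    _ ≤ _ := by
        rw [← e]
        exact mul_le_mul_of_nonneg_left (hs'.sum_le_tsum _ fun _ _ ↦ abs_nonneg _) hA

theorem norm_tensorOp_gridTensor_le (hT : 0 < T) (m : ℕ) :
    ‖tensorOp (gridTensor H T m)‖ ≤ (T / m) ^ (2 * H) * ∑' i, |rhoHat H i| :=
  norm_tensorOp_sum_tmul_self_le _ _
    (mul_nonneg (by positivity) (tsum_nonneg fun _ ↦ abs_nonneg _))
    fun _ hj ↦ sum_abs_inner_gridVec_le hT hj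

/-- A multiple `b_n / (√n A_n)` of tensors whose operators are bounded by `A_n S` is of order
`n^{-1/2}` in operator norm, if `b_n` converges. -/
theorem exists_norm_tensorOp_le {E : Type*} [NormedAddCommGroup E] [InnerProductSpace ℝ E]
    {f D : ℕ → E ⊗[ℝ] E} {b A : ℕ → ℝ} {β S : ℝ}
    (h : ∀ n ≥ 1, f n = (b n / (√(n : ℝ) * A n)) • D n) (hA : ∀ n ≥ 1, 0 < A n)
    (hD : ∀ n ≥ 1, ‖tensorOp (D n)‖ ≤ A n * S) (hb : Tendsto b atTop (𝓝 β)) :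
    ∃ B, ∀ n ≥ 1, ‖tensorOp (f n)‖ ≤ B / √(n : ℝ) := by
  obtain ⟨M, hM⟩ := hb.norm.bddAbove_range
  refine ⟨M * S, fun n hn ↦ ?_⟩
  have hs : 0 < √(n : ℝ) := Real.sqrt_pos.2 (by exact_mod_cast hn)
  have hA' := hA n hn
  have hS : 0 ≤ S := nonneg_of_mul_nonneg_right ((norm_nonneg _).trans (hD n hn)) hA'
  have hbn : ‖b n‖ ≤ M := hM ⟨n, rfl⟩
  rw [h n hn, map_smul, norm_smul, norm_div, norm_mul, Real.norm_of_nonneg hs.le,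
    Real.norm_of_nonneg hA'.le]
  calc ‖b n‖ / (√(n : ℝ) * A n) * ‖tensorOp (D n)‖
      ≤ ‖b n‖ / (√(n : ℝ) * A n) * (A n * S) := by gcongr; exact hD n hn
    _ = ‖b n‖ * S / √(n : ℝ) := by field_simp
    _ ≤ M * S / √(n : ℝ) := by gcongr

variable (W : FbmHilbert H T →ₗᵢ[ℝ] Lp ℝ 2 P)

theorem exists_norm_tensorOp_kernel_one_le (hT : 0 < T) :
    ∃ B, ∀ n ≥ 1, ‖tensorOp (kernel W 1 n)‖ ≤ B / √(n : ℝ) :=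
  exists_norm_tensorOp_le (fun _ hn ↦ kernel_one_eq hT W hn)
    (fun _ hn ↦ rpow_mesh_pos (H := H) hT hn)
    (fun n _ ↦ norm_tensorOp_gridTensor_le hT n) tendsto_coarseFactor

theorem exists_norm_tensorOp_kernel_two_le (hT : 0 < T) :
    ∃ B, ∀ n ≥ 1, ‖tensorOp (kernel W 2 n)‖ ≤ B / √(n : ℝ) :=
  exists_norm_tensorOp_le (fun _ hn ↦ kernel_two_eq hT W hn)
    (fun _ hn ↦ rpow_mesh_pos (H := H) hT hn)
    (fun n _ ↦ by
      rw [← mul_assoc, ← rpow_mesh_two_mul hT]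
      exact norm_tensorOp_gridTensor_le hT (2 * n)) tendsto_fineFactor

theorem norm_tensorOp_combKernel_le (x : Fin 3 → ℝ) (n : ℕ) {r : ℝ}
    (h1 : ‖tensorOp (kernel W 1 n)‖ ≤ r) (h2 : ‖tensorOp (kernel W 2 n)‖ ≤ r) :
    ‖tensorOp (combKernel W x n)‖ ≤
      |x 0| * r + |x 1| * r + |x 2| * √(n : ℝ) * (8 * (r * r)) := by
  have hr : 0 ≤ r := (norm_nonneg _).trans h1
  have hc : ∀ {z w : FbmHilbert H T ⊗[ℝ] FbmHilbert H T}, ‖tensorOp z‖ ≤ r → ‖tensorOp w‖ ≤ r →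
      ‖tensorOp (contr₁ z w)‖ ≤ r * r := fun hz hw ↦
    (norm_tensorOp_contr₁_le _ _).trans (mul_le_mul hz hw (norm_nonneg _) hr)
  have hG : ‖tensorOp ((2 : ℝ) • contr₁ (kernel W 2 n) (kernel W 2 n)
      - (4 : ℝ) • symm₂ (contr₁ (kernel W 2 n) (kernel W 1 n))
      + (2 : ℝ) • contr₁ (kernel W 1 n) (kernel W 1 n))‖ ≤ 8 * (r * r) := by
    rw [map_add, map_sub, map_smul, map_smul, map_smul]
    refine (norm_add_le_of_le (norm_sub_le_of_le ?_ ?_) ?_).trans_eq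
      (show 2 * (r * r) + 4 * (r * r) + 2 * (r * r) = 8 * (r * r) by ring)
    · rw [norm_smul, Real.norm_ofNat]
      exact mul_le_mul_of_nonneg_left (hc h2 h2) zero_le_two
    · rw [norm_smul, Real.norm_ofNat]
      exact mul_le_mul_of_nonneg_left ((norm_tensorOp_symm₂_le _).trans (hc h2 h1)) zero_le_four
    · rw [norm_smul, Real.norm_ofNat]
      exact mul_le_mul_of_nonneg_left (hc h1 h1) zero_le_two
  rw [combKernel, map_add, map_add, map_smul, map_smul, map_smul]
  refine norm_add_le_of_le (norm_add_le_of_le ?_ ?_) ?_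
  · rw [norm_smul, Real.norm_eq_abs]
    exact mul_le_mul_of_nonneg_left h1 (abs_nonneg _)
  · rw [norm_smul, Real.norm_eq_abs]
    exact mul_le_mul_of_nonneg_left h2 (abs_nonneg _)
  · rw [norm_smul, Real.norm_eq_abs, abs_mul, abs_of_nonneg (Real.sqrt_nonneg _)]
    exact mul_le_mul_of_nonneg_left hG (by positivity)

/-- As each kernel is of order `n^{-1/2}` in operator norm, so is `√n` times a contraction of
two. -/
theorem tendsto_norm_tensorOp_combKernel (hT : 0 < T) (x : Fin 3 → ℝ) :
    Tendsto (fun n ↦ ‖tensorOp (combKernel W x n)‖) atTop (𝓝 0) := by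
  obtain ⟨B₁, h₁⟩ := exists_norm_tensorOp_kernel_one_le W hT
  obtain ⟨B₂, h₂⟩ := exists_norm_tensorOp_kernel_two_le W hT
  set B := max B₁ B₂
  have hsqrt : Tendsto (fun n : ℕ ↦ √(n : ℝ)) atTop atTop :=
    Real.tendsto_sqrt_atTop.comp tendsto_natCast_atTop_atTop
  refine squeeze_zero' (.of_forall fun _ ↦ norm_nonneg _) ?_
    (hsqrt.const_div_atTop (|x 0| * B + |x 1| * B + |x 2| * (8 * (B * B))))
  filter_upwards [eventually_ge_atTop 1] with n hn
  have hs : 0 < √(n : ℝ) := Real.sqrt_pos.2 (by exact_mod_cast hn)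
  refine (norm_tensorOp_combKernel_le W x n (r := B / √(n : ℝ))
    ((h₁ n hn).trans ?_) ((h₂ n hn).trans ?_)).trans_eq ?_
  · gcongr
    exact le_max_left _ _
  · gcongr
    exact le_max_right _ _
  · field_simp

end OperatorNorm

section Limit

variable {H T : ℝ} [hH : Fact (H ∈ Set.Ioo (0 : ℝ) 1)]
  {Ω : Type*} [MeasurableSpace Ω] {P : Measure Ω} [IsProbabilityMeasure P]

theorem tendsto_charFun_vecU (hT : 0 < T) {W : FbmHilbert H T →ₗᵢ[ℝ] Lp ℝ 2 P}
    (hW : IsIsonormal W) (x : EuclideanSpace ℝ (Fin 3)) :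
    Tendsto (fun n ↦ charFun (P.map (vecU W n)) x) atTop
      (𝓝 (charFun (multivariateGaussian 0 (covU H)) x)) := by
  rw [charFun_multivariateGaussian (covU_posSemidef W hT)]
  have h := hW.tendsto_integral_exp_I2 (fun n ↦ combKernel W x n) (comm_combKernel W x)
    (tendsto_norm_tensorOp_combKernel W hT x) (tendsto_norm_combKernel_sq W hT x)
  convert h using 2 with n
  · rw [charFun_apply, integral_map (aemeasurable_vecU W n)
      (by fun_prop : Continuous _).aestronglyMeasurable]
    refine integral_congr_ae ?_
    filter_upwards [ae_inner_vecU W x n] with ω hω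
    rw [hω]
  · simp

end Limit

end FBM

theorem proposition2108140105 {Ω : Type*} [MeasurableSpace Ω] (P : Measure Ω)
    [IsProbabilityMeasure P] (H T : ℝ) [Fact (H ∈ Set.Ioo (0 : ℝ) 1)] (hT : 0 < T)
    (W : FBM.FbmHilbert H T →ₗᵢ[ℝ] Lp ℝ 2 P) (hW : FBM.IsIsonormal W) :
    FBM.LatticeSummable H ∧ (FBM.covU H).PosSemidef ∧
      TendstoInDistribution (fun n : ℕ ↦ FBM.vecU W n) atTop id (fun _ ↦ P)
        (multivariateGaussian 0 (FBM.covU H)) := by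
  refine ⟨FBM.latticeSummable (Fact.out : H ∈ Set.Ioo (0 : ℝ) 1).2,
    FBM.covU_posSemidef W hT, FBM.aemeasurable_vecU W, aemeasurable_id, ?_⟩
  refine ProbabilityMeasure.tendsto_iff_tendsto_charFun.2 fun x ↦ ?_
  simpa using FBM.tendsto_charFun_vecU hT hW x
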